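/- **Setting.** Write $\{0,1\}^n$ for $n$-bit strings, $\oplus$ for bitwise XOR, $a\cdot b$ for the inner product mod 2. For $w\in\{\mathbb 1,X,Z\}^n$ and $a,u\in\{0,1\}^n$ let $\sigma_w(a)=\bigotimes_i\sigma_{w_i}^{a_i}$ (in particular $\sigma_X(a)$, $\sigma_Z(a)$ for constant $w$) and $\pi^w_u=\bigotimes_i\frac{\mathbb 1+(-1)^{u_i}\sigma_{w_i}}2$. The squared state-dependent norm is $\|A\|_\psi^2=\mathrm{Tr}[A^\dagger A\psi]$. *Instances.* For every security parameter $\lambda$ let there be given an instance: a number of qubits $n=n(\lambda)$; a nonempty set $S\subseteq\{0,1\}^n$; a distribution $D$ on $\{\mathbb 1,X,Z\}^n$ given by a map $r\mapsto w(r)$ on uniformly random seeds $r\in\{0,1\}^\ell$; accepting sets $Q(w)\subseteq\{0,1\}^n$; and injective fixed-length binary encodings of the questions below. The number $n$ and the lengths of the encodings are polynomially bounded in $\lambda$ (a fixed instance is a special case), and $S$ is $\mu$-biased, i.e. $|\mathbb E_{a\in S}(-1)^{a\cdot b}|\le\mu$ for all $b\neq0$, for a constant $\mu<1$. The Hamiltonian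 is $$H(n)=\mathbb 1-\mathop{\mathbb E}_{w\sim D}\sum_{u\in Q(w)}\pi^w_u .$$ *Encryption.* Fix an encryption scheme $(\mathsf{Gen},\mathsf{Enc},\mathsf{Dec})$ with classical keys and ciphertexts (for instance the one underlying a quantum homomorphic encryption scheme). The only assumption is that, for any two sequences of messages of equal polynomial length, $\mathsf{Enc}_{sk}(m_0)$ and $\mathsf{Enc}_{sk}(m_1)$, with $sk\leftarrow\mathsf{Gen}(1^\lambda)$, are distinguished with only negligible advantage by polynomial-size quantum circuits with quantum advice (this follows from IND-CPA security against such adversaries). *Prover and compiled tests.* The prover $P$ is a family, indexed by $\lambda$, of polynomial-size quantum circuits with an arbitrary initial pure state $\psi$ on a space $\mathcal H$ of polynomially many qubits. In a compiled test with question pair $(x,y)$ the verifier samples $sk\leftarrow\mathsf{Gen}(1^\lambda)$ and sends $c\leftarrow\mathsf{Enc}_{sk}(x)$; the prover applies a circuit and measures some qubits to obtain a reply $\alpha$, which yields the subnormalised state $\psi^c_\alpha=A^c_\alpha\psi(A^c_\alpha)^\dagger$; the verifier sends $y$ in the clear; the prover applies a second circuit and measures, i.e. performs a projective measurement $\{B^y_b\}_b$,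 and returns $b$. The verifier evaluates the test on $a=\mathsf{Dec}_{sk}(\alpha)$ and $b$. Put $\psi^{\mathsf{Enc}(x)}=\mathbb E_{sk}\,\mathbb E_{c\leftarrow\mathsf{Enc}_{sk}(x)}\sum_\alpha\psi^c_\alpha$. The tests are the following. 1. **Pauli braiding.** Pick $a,b\in S$ uniformly. * If $a\cdot b=0$ (commutation test): $x=(\mathsf{com},a,b)$ with answer bits $(u_a,u_b)$; $y=W\in\{X,Z\}$ is uniform, with answer $v\in\{0,1\}^n$. Accept iff $a\cdot v=u_a$ (for $W=Z$), respectively $b\cdot v=u_b$ (for $W=X$). * If $a\cdot b=1$ (magic square test): pick a uniform cell $j$ of a $3\times3$ grid and, uniformly, the row or the column containing it. $x$ is $(\mathsf{MS},a,b)$ together with this line, and is answered by three bits, one per cell of the line in order; they must XOR to $0$ for a row and to $1$ for a column. If $j$ is the top centre (resp. centre left) cell, then $y=Z$ (resp. $y=X$), with answer $v\in\{0,1\}^n$, and $a\cdot v$ (resp. $b\cdot v$) must equal the bit for cell $j$. Otherwise $y=(\mathsf{MS},a,b,j)$, and the one-bit answer must equal the bit for cell $j$. 2. **Mixed-versus-pure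 basis.** $x=W\in\{X,Z\}$ is uniform, with answer $u\in\{0,1\}^n$. With probability $\tfrac12$, $y=W$ with answer $v\in\{0,1\}^n$: accept iff $u=v$. With probability $\tfrac12$, $y=r$ is a uniform seed, with answer $v\in\{0,1\}^n$: accept iff $u_i=v_i$ for all $i$ with $w(r)_i=W$. 3. **Hamiltonian.** $x=\mathsf{tele}$, with answer $(u_x,u_z)\in\{0,1\}^n\times\{0,1\}^n$; $y=r$ is a uniform seed, with answer $v\in\{0,1\}^n$. Put $w=w(r)$, and let $s_i=0$ if $w_i=\mathbb 1$, $s_i=v_i\oplus(u_z)_i$ if $w_i=X$, and $s_i=v_i\oplus(u_x)_i$ if $w_i=Z$. Accept iff $s\in Q(w)$. Alice's questions are $(\mathsf{com},a,b)$, $(\mathsf{MS},a,b,\text{line})$, $X$, $Z$, $\mathsf{tele}$, and (never used in the tests) seeds $r$. For a seed $r$, let $M^r_u$ be the prover's measurement $\{B^r_v\}_v$, with the outcome bits at positions where $w(r)_i=\mathbb 1$ reset to $0$. **Lemma.** For every $\mu<1$ there is a constant $C>0$ such that the following holds for all schemes, families of instances and provers as above, and all $\delta=\delta(\lambda)$.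 Suppose that, for every $\lambda$, $P$ succeeds in the compiled Pauli braiding test and in the compiled mixed-versus-pure basis test with probability at least $1-\delta$ each, and let $p_H=p_H(\lambda)$ be its success probability in the compiled Hamiltonian test. Then there is a negligible function $\eta$ such that for every $\lambda$ there are a finite-dimensional space $\mathcal H_{\mathrm{aux}}$ and an isometry $V:\mathcal H\to(\mathbb C^2)^{\otimes n}\otimes\mathcal H_{\mathrm{aux}}$ with $$\mathop{\mathbb E}_{r}\sum_{u}\big\|M^r_u-V^\dagger(\pi^{w(r)}_u\otimes\mathbb 1)V\big\|^2_{\psi^{\mathsf{Enc}(x)}}\le C\sqrt\delta+\eta(\lambda)\qquad\text{for every Alice question }x,$$ and such that the operator $$\rho=\mathrm{Tr}_{\mathrm{aux}}\mathop{\mathbb E}_{sk}\ \mathop{\mathbb E}_{c\leftarrow\mathsf{Enc}_{sk}(\mathsf{tele})}\sum_\alpha\big(\sigma_X(u_x)\sigma_Z(u_z)\otimes\mathbb 1\big)V\psi^c_\alpha V^\dagger\big(\sigma_Z(u_z)\sigma_X(u_x)\otimes\mathbb 1\big),\qquad(u_x,u_z)=\mathsf{Dec}_{sk}(\alpha)$$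 (averaged over the coins of $\mathsf{Dec}$ if it is randomised), is an $n$-qubit quantum state satisfying $$\mathrm{Tr}[\rho H(n)]\le(1-p_H)+C\,\delta^{1/4}+\eta(\lambda).$$ -/

import Mathlib

open scoped Matrix Kronecker ComplexOrder

noncomputable section

namespace CompiledQMA

/-! ### Bit strings, expectations, asymptotics -/

/-- Bit strings of length `n`; addition is bitwise exclusive or, and `a ⬝ᵥ b` is the inner product
modulo two. -/
abbrev Bits (n : ℕ) : Type := Fin n → ZMod 2

/-- `(-1) ^ b`. -/
def sgn (b : ZMod 2) : ℝ := if b = 0 then 1 else -1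

/-- The expectation of `f` under a probability distribution on a finite set. -/
def expect {α E : Type*} [Fintype α] [AddCommMonoid E] [Module ℝ E] (p : PMF α) (f : α → E) : E :=
  ∑ a, (p a).toReal • f a

/-- The expectation of `f` at a uniformly random argument. -/
def avg {α E : Type*} [Fintype α] [Nonempty α] [AddCommMonoid E] [Module ℝ E] (f : α → E) : E :=
  expect (PMF.uniformOfFintype α) f

/-- `f` is bounded by a polynomial. -/
def PolyBounded (f : ℕ → ℕ) : Prop := ∃ p : Polynomial ℕ, ∀ κ, f κ ≤ p.eval κ

/-- `η` decays faster than every inverse polynomial. -/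
def Negligible (η : ℕ → ℝ) : Prop :=
  Asymptotics.SuperpolynomialDecay Filter.atTop (fun κ : ℕ => (κ : ℝ)) η

/-! ### Qubits and quantum circuits

Operators on `N` qubits are complex matrices indexed by the computational basis `Bits N`. -/

/-- Operators on `N` qubits. -/
abbrev Op (N : ℕ) : Type := Matrix (Bits N) (Bits N) ℂ

/-- A gate on `N` wires: an arbitrary unitary on `arity ≤ 2` distinct wires. -/
structure Gate (N : ℕ) where
  arity : ℕ
  arity_le : arity ≤ 2
  wires : Fin arity ↪ Fin N
  unitary : Matrix.unitaryGroup (Bits arity) ℂ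

open Classical in
/-- The action of a gate on all `N` wires: the unitary on the wires it touches, tensored with the
identity on the others. -/
def Gate.toOp {N : ℕ} (g : Gate N) : Op N := Matrix.of fun x y =>
  if ∀ i, i ∉ Set.range g.wires → x i = y i then
    (g.unitary : Matrix (Bits g.arity) (Bits g.arity) ℂ) (x ∘ g.wires) (y ∘ g.wires)
  else 0

/-- A quantum circuit on `N` wires, listed in the order of application. Its size is the number of
gates, i.e. the length of the list. -/
abbrev Circuit (N : ℕ) : Type := List (Gate N)

/-- The unitary computed by a circuit. -/
def Circuit.toOp {N : ℕ} (C : Circuit N) : Op N := C.foldl (fun M g => g.toOp * M) 1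

/-- The classical string `c` placed on the wires `off, off + 1, …` of an `N`-wire register (bits
that fall off the end of the register are dropped), all other wires being `0`. -/
def place (N off : ℕ) {m : ℕ} (c : Bits m) : Bits N := fun i =>
  if h : off ≤ i.val ∧ i.val - off < m then c ⟨i.val - off, h.2⟩ else 0

/-- The unitary writing (by exclusive or) the classical string `c` on the wires starting at
`off`. -/
def writeOp (N off : ℕ) {m : ℕ} (c : Bits m) : Op N := Matrix.of fun x y =>
  if x = y + place N off c then 1 else 0

/-- The first `m` bits of a register content (zeros if the register is too short). -/
def readBits {N : ℕ} (m : ℕ) (x : Bits N) : Bits m := fun i =>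
  if h : i.val < N then x ⟨i.val, h⟩ else 0

/-- The projector on outcome `b` of the computational basis measurement of the first `m` wires. -/
def outProj (N : ℕ) {m : ℕ} (b : Bits m) : Op N :=
  Matrix.diagonal fun x => if readBits m x = b then 1 else 0

/-- The rank one operator `|φ⟩⟨φ|`. -/
def pureState {ι : Type*} (φ : ι → ℂ) : Matrix ι ι ℂ := Matrix.vecMulVec φ (star φ)

/-- `ρ` is a (normalised) quantum state. -/
def IsState {ι : Type*} [Fintype ι] (ρ : Matrix ι ι ℂ) : Prop := ρ.PosSemidef ∧ ρ.trace = 1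

/-- The squared state-dependent norm `‖A‖²_ψ = Tr[A† A ψ]`. -/
def stateNormSq {ι : Type*} [Fintype ι] (A ψ : Matrix ι ι ℂ) : ℝ := (Aᴴ * A * ψ).trace.re

/-- The partial trace over the second tensor factor. -/
def traceAux {ι κ : Type*} [Fintype κ] (M : Matrix (ι × κ) (ι × κ) ℂ) : Matrix ι ι ℂ :=
  Matrix.of fun x y => ∑ j, M (x, j) (y, j)

/-! ### Encryption -/

/-- The part of a (homomorphic) encryption scheme that is used by the verifier of a compiled game,
for every value `κ` of the security parameter: the distribution of the secret key, the randomised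
encryption of classical strings as classical ciphertexts, and the (possibly randomised) decryption
of an `l`-bit classical ciphertext to an `m`-bit answer. -/
structure EncScheme where
  keyLen : ℕ → ℕ
  ctLen : ℕ → ℕ → ℕ
  gen : ∀ κ, PMF (Bits (keyLen κ))
  enc : ∀ κ {m : ℕ}, Bits (keyLen κ) → Bits m → PMF (Bits (ctLen κ m))
  dec : ∀ κ {l : ℕ} (m : ℕ), Bits (keyLen κ) → Bits l → PMF (Bits m)

/-- A distinguisher: an advice state on `N` qubits and a circuit. The ciphertext is written on the
first wires, the circuit is run, and the output bit is obtained by measuring the first wire. -/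
structure Distinguisher where
  N : ℕ
  advice : Bits N → ℂ
  advice_norm : star advice ⬝ᵥ advice = 1
  circuit : Circuit N

/-- The probability that the distinguisher outputs `1` on input `c`. -/
def Distinguisher.outProb (A : Distinguisher) {m : ℕ} (c : Bits m) : ℝ :=
  let φ := (A.circuit.toOp * writeOp A.N 0 c) *ᵥ A.advice
  (outProj A.N (fun _ : Fin 1 => 1) * pureState φ).trace.re

/-- Encryptions of any two messages of equal (polynomial) length are indistinguishable for
polynomial-size quantum circuits with quantum advice. -/
def EncScheme.Secure (E : EncScheme) : Prop :=
  ∀ (len : ℕ → ℕ) (m₀ m₁ : ∀ κ, Bits (len κ)) (A : ℕ → Distinguisher),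
    PolyBounded len → PolyBounded (fun κ => (A κ).N) →
    PolyBounded (fun κ => (A κ).circuit.length) →
    Negligible fun κ =>
      |(expect (E.gen κ) fun sk => expect (E.enc κ sk (m₀ κ)) fun c => (A κ).outProb c) -
        (expect (E.gen κ) fun sk => expect (E.enc κ sk (m₁ κ)) fun c => (A κ).outProb c)|

/-! ### Paulis and Hamiltonians -/

/-- The labels `𝟙, X, Z` of single-qubit Pauli operators. -/
inductive Pauli where
  | I | X | Z
  deriving DecidableEq

/-- The two pure bases `X` and `Z`. -/
inductive PureBasis where
  | X | Z
  deriving DecidableEq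

instance : Fintype PureBasis := ⟨{.X, .Z}, by intro W; cases W <;> simp⟩

instance : Nonempty PureBasis := ⟨.X⟩

/-- A pure basis as a Pauli label. -/
def PureBasis.toPauli : PureBasis → Pauli
  | .X => .X
  | .Z => .Z

/-- The Pauli matrices. -/
def Pauli.mat : Pauli → Matrix (ZMod 2) (ZMod 2) ℂ
  | .I => 1
  | .X => Matrix.of fun x y => if x = y + 1 then 1 else 0
  | .Z => Matrix.diagonal fun x => (sgn x : ℂ)

/-- The `n`-qubit operator `⨂ᵢ Mᵢ`. -/
def tensor {n : ℕ} (M : Fin n → Matrix (ZMod 2) (ZMod 2) ℂ) : Op n :=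
  Matrix.of fun x y => ∏ i, M i (x i) (y i)

/-- `σ_w(a) = ⨂ᵢ σ_{wᵢ}^{aᵢ}`. -/
def sigma {n : ℕ} (w : Fin n → Pauli) (a : Bits n) : Op n := tensor fun i => (w i).mat ^ (a i).val

/-- The Pauli projectors `π^w_u = ⨂ᵢ (𝟙 + (-1)^{uᵢ} σ_{wᵢ}) / 2`. -/
def pauliProj {n : ℕ} (w : Fin n → Pauli) (u : Bits n) : Op n :=
  tensor fun i => (2⁻¹ : ℂ) • (1 + (sgn (u i) : ℂ) • (w i).mat)

/-- `S` is `μ`-biased: `|𝔼_{a ∈ S} (-1)^{a·b}| ≤ μ` for every `b ≠ 0`. -/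
def IsBiased {n : ℕ} (μ : ℝ) (S : Finset (Bits n)) : Prop :=
  ∀ b : Bits n, b ≠ 0 → |(∑ a ∈ S, sgn (a ⬝ᵥ b)) / (S.card : ℝ)| ≤ μ

/-! ### The questions and the tests -/

/-- The questions to Alice; `R` is the set of seeds from which the Pauli string is sampled. -/
inductive AliceQ {n : ℕ} (S : Finset (Bits n)) (R : Type) where
  /-- commutation test -/
  | com (a b : S)
  /-- magic square: the row (`isCol = false`) or column (`isCol = true`) with index `line` -/
  | ms (a b : S) (isCol : Bool) (line : Fin 3)
  /-- measure everything in one pure basis -/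
  | pure (W : PureBasis)
  /-- measure in the mixed basis -/
  | mixed (r : R)
  /-- teleportation -/
  | tele

/-- The questions to Bob. -/
inductive BobQ {n : ℕ} (S : Finset (Bits n)) (R : Type) where
  /-- measure everything in one pure basis -/
  | pure (W : PureBasis)
  /-- magic square cell in the given row and column -/
  | cell (a b : S) (row col : Fin 3)
  /-- measure in the mixed basis sampled from the seed `r` -/
  | mixed (r : R)

/-- The number of bits of Alice's answer. -/
def AliceQ.ansLen {n : ℕ} {S : Finset (Bits n)} {R : Type} : AliceQ S R → ℕ
  | .com _ _ => 2
  | .ms _ _ _ _ => 3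
  | .pure _ => n
  | .mixed _ => n
  | .tele => n + n

/-- The number of bits of Bob's answer. -/
def BobQ.ansLen {n : ℕ} {S : Finset (Bits n)} {R : Type} : BobQ S R → ℕ
  | .pure _ => n
  | .cell _ _ _ _ => 1
  | .mixed _ => n

/-- The data of the protocol for one instance: the number `n` of qubits, the set `S` of the
Pauli braiding test, the sampler of the distribution `D` on Pauli strings from uniformly random
seeds of `seedLen` bits, the accepting sets `Q(w)`, and binary encodings of the questions. -/
structure ProtocolData where
  n : ℕ
  S : Finset (Bits n)
  S_nonempty : S.Nonempty
  seedLen : ℕ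
  sample : Bits seedLen → Fin n → Pauli
  Q : (Fin n → Pauli) → Finset (Bits n)
  aliceLen : ℕ
  aliceCode : AliceQ S (Bits seedLen) ↪ Bits aliceLen
  bobLen : ℕ
  bobCode : BobQ S (Bits seedLen) ↪ Bits bobLen

instance (T : ProtocolData) : Nonempty T.S := T.S_nonempty.to_subtype

/-- Alice questions of the protocol. -/
abbrev ProtocolData.AQ (T : ProtocolData) : Type := AliceQ T.S (Bits T.seedLen)

/-- Bob questions of the protocol. -/
abbrev ProtocolData.BQ (T : ProtocolData) : Type := BobQ T.S (Bits T.seedLen)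

/-- The Hamiltonian `H = 𝟙 - 𝔼_{w ∼ D} ∑_{u ∈ Q(w)} π^w_u`. -/
def ProtocolData.hamiltonian (T : ProtocolData) : Op T.n :=
  1 - avg fun r : Bits T.seedLen => ∑ u ∈ T.Q (T.sample r), pauliProj (T.sample r) u

/-- The teleportation correction of Bob's outcomes `v` by Alice's reported `(u_x, u_z)`. -/
def correct {n : ℕ} (w : Fin n → Pauli) (v ux uz : Bits n) : Bits n := fun i =>
  match w i with
  | .I => 0
  | .X => v i + uz i
  | .Z => v i + ux i

/-- Bob's outcomes with the positions carrying the identity reset to `0`. -/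
def mask {n : ℕ} (w : Fin n → Pauli) (v : Bits n) : Bits n := fun i =>
  if w i = .I then 0 else v i

/-- The string `u_x` in the answer to the teleportation question. -/
def teleX {n : ℕ} (a : Bits (n + n)) : Bits n := fun i => a (Fin.castAdd n i)

/-- The string `u_z` in the answer to the teleportation question. -/
def teleZ {n : ℕ} (a : Bits (n + n)) : Bits n := fun i => a (Fin.natAdd n i)

/-! ### Provers of compiled games -/

/-- A prover in the compiled game: it holds an initial pure state of `N` qubits (including advice
and ancillas). The first message `c` is written on the first wires, `circuit₁` is applied, and the
first `replyLen` wires are measured to obtain the reply `α`. The second message `y` is written on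
the wires following those holding `α`, `circuit₂` is applied and the first wires are measured to
obtain the answer `b`. -/
structure Prover where
  N : ℕ
  ψ : Bits N → ℂ
  ψ_norm : star ψ ⬝ᵥ ψ = 1
  replyLen : ℕ
  circuit₁ : Circuit N
  circuit₂ : Circuit N

/-- The operators `A^c_α` of the first round. -/
def Prover.alice (P : Prover) {m : ℕ} (c : Bits m) (α : Bits P.replyLen) : Op P.N :=
  outProj P.N α * P.circuit₁.toOp * writeOp P.N 0 c

/-- The unnormalised state `ψ^c_α = A^c_α |ψ⟩⟨ψ| (A^c_α)†`. -/
def Prover.postState (P : Prover) {m : ℕ} (c : Bits m) (α : Bits P.replyLen) : Op P.N :=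
  P.alice c α * pureState P.ψ * (P.alice c α)ᴴ

/-- The projective measurements `{B^y_b}_b` of the second round; `y` is a bit string and the answer
consists of `l` bits. -/
def Prover.bob (P : Prover) {m l : ℕ} (y : Bits m) (b : Bits l) : Op P.N :=
  (P.circuit₂.toOp * writeOp P.N P.replyLen y)ᴴ * outProj P.N b *
    (P.circuit₂.toOp * writeOp P.N P.replyLen y)

/-- A family of provers is efficient: the numbers of qubits, of gates and of communicated bits are
polynomially bounded. -/
def EfficientProver (P : ℕ → Prover) : Prop :=
  PolyBounded (fun κ => (P κ).N) ∧ PolyBounded (fun κ => (P κ).replyLen) ∧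
    PolyBounded (fun κ => (P κ).circuit₁.length) ∧ PolyBounded (fun κ => (P κ).circuit₂.length)

section Compiled

variable (E : EncScheme) (κ : ℕ) (T : ProtocolData) (P : Prover)

open Classical in
/-- The acceptance probability of the compiled game conditioned on the question pair `(x, y)`: the
verifier samples a key and sends an encryption `c` of `x`, receives `α`, sends `y` in the clear,
receives `b`, and accepts iff the decryption of `α` and `b` satisfy the predicate `acc`. -/
def acceptProb (x : T.AQ) (y : T.BQ) (acc : Bits x.ansLen → Bits y.ansLen → Prop) : ℝ :=
  expect (E.gen κ) fun sk => expect (E.enc κ sk (T.aliceCode x)) fun c =>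
    ∑ α : Bits P.replyLen, expect (E.dec κ x.ansLen sk α) fun a => ∑ b : Bits y.ansLen,
      if acc a b then (P.bob (T.bobCode y) b * P.postState c α).trace.re else 0

/-- The state `ψ^{Enc(x)}` after the first round, averaged over keys, ciphertexts and outcomes. -/
def encState (x : T.AQ) : Op P.N :=
  expect (E.gen κ) fun sk => expect (E.enc κ sk (T.aliceCode x)) fun c =>
    ∑ α : Bits P.replyLen, P.postState c α

/-- Success probability in the compiled commutation test for `a, b ∈ S`. -/
def comSuccess (a b : T.S) : ℝ :=
  avg fun W : PureBasis => acceptProb E κ T P (.com a b) (.pure W) fun u v =>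
    match W with
    | .Z => (a : Bits T.n) ⬝ᵥ (show Bits T.n from v) = (show Bits 2 from u) 0
    | .X => (b : Bits T.n) ⬝ᵥ (show Bits T.n from v) = (show Bits 2 from u) 1

/-- Alice's three answers obey the magic square constraint: the product of the `±1` outcomes is `1`
for a row and `-1` for a column. -/
def squareOk (isCol : Bool) (u : Bits 3) : Prop := u 0 + u 1 + u 2 = if isCol then 1 else 0

/-- Success probability in the compiled anticommutation (magic square) test for `a, b ∈ S` given the
cell `(row, col)` asked to Bob and the row or column through it asked to Alice. The top centre
cell `(0, 1)` is asked as the pure question `Z`, the centre left cell `(1, 0)` as the pure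
question `X`. -/
def squareSuccess (a b : T.S) (row col : Fin 3) (isCol : Bool) : ℝ :=
  let x : T.AQ := .ms a b isCol (if isCol then col else row)
  let pos : Fin 3 := if isCol then row else col
  if row = 0 ∧ col = 1 then
    acceptProb E κ T P x (.pure .Z) fun u v =>
      squareOk isCol u ∧ (a : Bits T.n) ⬝ᵥ (show Bits T.n from v) = (show Bits 3 from u) pos
  else if row = 1 ∧ col = 0 then
    acceptProb E κ T P x (.pure .X) fun u v =>
      squareOk isCol u ∧ (b : Bits T.n) ⬝ᵥ (show Bits T.n from v) = (show Bits 3 from u) pos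
  else
    acceptProb E κ T P x (.cell a b row col) fun u v =>
      squareOk isCol u ∧ (show Bits 1 from v) 0 = (show Bits 3 from u) pos

/-- Success probability in the compiled anticommutation (magic square) test for `a, b ∈ S`. -/
def antiSuccess (a b : T.S) : ℝ :=
  avg fun row : Fin 3 => avg fun col : Fin 3 => avg fun isCol : Bool =>
    squareSuccess E κ T P a b row col isCol

/-- Success probability in the compiled Pauli braiding test. -/
def braidingSuccess : ℝ :=
  avg fun a : T.S => avg fun b : T.S =>
    if (a : Bits T.n) ⬝ᵥ (b : Bits T.n) = 0 then comSuccess E κ T P a b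
    else antiSuccess E κ T P a b

/-- Success probability in the compiled mixed-versus-pure basis test. -/
def mixedPureSuccess : ℝ :=
  avg fun W : PureBasis => avg fun bit : Bool =>
    if bit then
      avg fun r : Bits T.seedLen => acceptProb E κ T P (.pure W) (.mixed r) fun u v =>
        ∀ i : Fin T.n, T.sample r i = W.toPauli →
          (show Bits T.n from u) i = (show Bits T.n from v) i
    else
      acceptProb E κ T P (.pure W) (.pure W) fun u v =>
        (show Bits T.n from u) = (show Bits T.n from v)

/-- Success probability in the compiled Hamiltonian test. -/
def hamiltonianSuccess : ℝ :=
  avg fun r : Bits T.seedLen => acceptProb E κ T P .tele (.mixed r) fun u v =>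
    correct (T.sample r) v (teleX u) (teleZ u) ∈ T.Q (T.sample r)

/-- Bob's mixed basis measurement `{M^w_u}_u`, where the answers on positions carrying the identity
(which the verifier ignores) are reset to `0`. -/
def mixedMeas (r : Bits T.seedLen) (u : Bits T.n) : Op P.N :=
  ∑ v : Bits T.n, if mask (T.sample r) v = u then P.bob (T.bobCode (.mixed r)) v else 0

/-- The error of rounding Bob's mixed basis measurements to Pauli measurements by the isometry `V`:
`𝔼_{w ∼ D} ∑_u ‖M^w_u - V† (π^w_u ⊗ 𝟙) V‖²` in the state `ψ^{Enc(x)}`. -/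
def roundingError {d : ℕ} (V : Matrix (Bits T.n × Fin d) (Bits P.N) ℂ) (x : T.AQ) : ℝ :=
  avg fun r : Bits T.seedLen => ∑ u : Bits T.n,
    stateNormSq
      (mixedMeas T P r u - Vᴴ * (pauliProj (T.sample r) u ⊗ₖ (1 : Matrix (Fin d) (Fin d) ℂ)) * V)
      (encState E κ T P x)

/-- The state obtained from the post-measurement states of the teleportation question by applying
`V`, then the Pauli corrections `σ_X(u_x) σ_Z(u_z)` for the decrypted answer `(u_x, u_z)`, and
tracing out the auxiliary register. -/
def correctedState {d : ℕ} (V : Matrix (Bits T.n × Fin d) (Bits P.N) ℂ) : Op T.n :=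
  let x : T.AQ := .tele
  expect (E.gen κ) fun sk => expect (E.enc κ sk (T.aliceCode x)) fun c =>
    ∑ α : Bits P.replyLen, expect (E.dec κ (T.n + T.n) sk α) fun u =>
      let K : Matrix (Bits T.n × Fin d) (Bits T.n × Fin d) ℂ :=
        (sigma (fun _ => .X) (teleX u) * sigma (fun _ => .Z) (teleZ u)) ⊗ₖ 1
      traceAux (K * V * P.postState c α * Vᴴ * Kᴴ)

end Compiled

end CompiledQMA

end

open CompiledQMA

noncomputable section

namespace CompiledQMA

/-! ### Characters of bit strings -/

/-! All estimates use the state-dependent seminorm `nsq ρ A`, the real part of Tr[A† A ρ], at the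
states ρ_x = `encState x`. This seminorm ignores isometries on the left but does not control
multiplication on the right, and no tensor product structure separates Alice from Bob. Cryptography
makes up for both.

Transfer between questions. The expectation of a product of boundedly many ±1 observables of Bob can
be estimated by a small Hadamard test, so security makes it independent of x up to a negligible
error (`exists_distinguisher`, `exists_negligible_indist`). The squared seminorm of a difference of
two signed products is an affine function of one such expectation. A relation between products that
a test yields at one ρ_x therefore holds at every ρ_x (`Indist.nsq_le`). If an observable is nearly
a sign once Alice's decrypted answer is known, multiplying by it on the right is harmless at her
question, and by transfer at every question (`Indist.mul_right`).

Pauli relations. In the commutation test both observables are nearly signs at the same question, so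
they nearly commute there. In the magic square test the six line relations combine to
anticommutation (`Indist.anticommute`). This controls Z(a)X(b) - (-1)^{a·b} X(b)Z(a) on average over
S. To reach all strings, the observable on the right is replaced by Alice's sign. The squared error
is then a mixture of terms 1 - (-1)^{a·d} with weights independent of a, and the bias bounds its
value at any a by 2/(1-μ) times its average over S (`nsq_twisted_commutator_le`). Doing this once in
each basis gives `Indist.pauli_relation`, with error O(δ + η) for every pair of strings.

Rounding. The isometry is V = ∑_u |u⟩ ⊗ X(u) B^Z_u. Parseval's identity in the outcome turns the
rounding error into an average over observables of the mixed measurement. A second Parseval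
identity, in the register |u⟩, turns each of these into an average of seminorms of relations between
Bob's observables. The mixed-versus-pure test replaces mixed observables by pure ones, and the Pauli
relations finish the bound (`Indist.mixed_relation`, `Indist.swapError_le`).

Energy. The Pauli correction permutes the projectors π^w_u exactly as the verifier corrects the
outcomes. Hence the success probability of the Hamiltonian test and 1 - Tr[ρH] are the same sum of
squared seminorms, taken of V M_u in the first case and of (π_u ⊗ 1)V in the second. Cauchy–Schwarz
bounds the difference by twice the square root of the rounding error
(`hamiltonianSuccess_sub_le_sqrt`). For δ ≤ 1 this gives rates δ and √δ, better than the stated √δ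
and δ^{1/4}. -/

theorem sgn_zero : sgn 0 = 1 := by simp [sgn]

theorem sgn_one : sgn 1 = -1 := by simp [sgn]

theorem zmod_two_cases : ∀ z : ZMod 2, z = 0 ∨ z = 1 := by decide

theorem sgn_add (a b : ZMod 2) : sgn (a + b) = sgn a * sgn b := by
  rcases zmod_two_cases a with rfl | rfl <;> rcases zmod_two_cases b with rfl | rfl <;>
    simp [sgn_zero, sgn_one, CharTwo.add_self_eq_zero]

theorem sgn_mul_self (a : ZMod 2) : sgn a * sgn a = 1 := by
  unfold sgn; split_ifs <;> norm_num

theorem sgn_eq_of_ne {a b : ZMod 2} (h : a ≠ b) : sgn a = -sgn b := by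
  rcases zmod_two_cases a with rfl | rfl <;> rcases zmod_two_cases b with rfl | rfl <;>
    simp_all [sgn_zero, sgn_one]

theorem bits_add_self {n : ℕ} (x : Bits n) : x + x = 0 :=
  funext fun i => CharTwo.add_self_eq_zero (x i)

theorem bits_add_eq_zero {n : ℕ} {x y : Bits n} : x + y = 0 ↔ x = y := by
  simp only [funext_iff, Pi.add_apply, Pi.zero_apply, CharTwo.add_eq_zero]

theorem sum_sgn_dotProduct {n : ℕ} (b : Bits n) :
    ∑ a : Bits n, sgn (a ⬝ᵥ b) = if b = 0 then (2 : ℝ) ^ n else 0 := by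
  split_ifs with h
  · simp [h, sgn_zero]
  · obtain ⟨i, hi⟩ := Function.ne_iff.mp h
    have h1 : b i = 1 := (zmod_two_cases (b i)).resolve_left hi
    -- Translating by a unit vector on which `b` is nonzero flips every sign, so the sum equals its
    -- own negative.
    have h2 := Equiv.sum_comp (Equiv.addRight (Pi.single i 1 : Bits n)) fun a => sgn (a ⬝ᵥ b)
    simp only [Equiv.coe_addRight, add_dotProduct, sgn_add, single_dotProduct, h1,
      sgn_one, mul_neg, mul_one, Finset.sum_neg_distrib] at h2
    linarith

/-! ### Expectations -/

section Expect

variable {α β E F : Type*} [Fintype α] [Fintype β] [AddCommGroup E] [Module ℝ E]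
  [AddCommGroup F] [Module ℝ F]

theorem sum_toReal_pmf (p : PMF α) : ∑ a, (p a).toReal = 1 := by
  have h := p.tsum_coe
  rw [tsum_fintype] at h
  rw [← ENNReal.toReal_sum fun a _ => p.apply_ne_top a, h, ENNReal.toReal_one]

theorem expect_const (p : PMF α) (e : E) : expect p (fun _ => e) = e := by
  rw [expect, ← Finset.sum_smul, sum_toReal_pmf, one_smul]

theorem expect_add (p : PMF α) (f g : α → E) :
    expect p (fun a => f a + g a) = expect p f + expect p g := by
  simp [expect, Finset.sum_add_distrib]

theorem expect_sub (p : PMF α) (f g : α → E) :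
    expect p (fun a => f a - g a) = expect p f - expect p g := by
  simp [expect, smul_sub, Finset.sum_sub_distrib]

theorem map_expect (L : E →ₗ[ℝ] F) (p : PMF α) (f : α → E) :
    L (expect p f) = expect p fun a => L (f a) := by
  simp [expect]

theorem expect_sum (p : PMF α) (f : α → β → E) :
    expect p (fun a => ∑ b, f a b) = ∑ b, expect p fun a => f a b := by
  simp only [expect, Finset.smul_sum]
  exact Finset.sum_comm

theorem expect_mul_left (p : PMF α) (c : ℝ) (f : α → ℝ) :
    expect p (fun a => c * f a) = c * expect p f :=
  (map_expect (LinearMap.mulLeft ℝ c) p f).symm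

theorem expect_mono (p : PMF α) {f g : α → ℝ} (h : ∀ a, f a ≤ g a) : expect p f ≤ expect p g :=
  Finset.sum_le_sum fun a _ => mul_le_mul_of_nonneg_left (h a) ENNReal.toReal_nonneg

theorem expect_nonneg (p : PMF α) {f : α → ℝ} (h : ∀ a, 0 ≤ f a) : 0 ≤ expect p f :=
  Finset.sum_nonneg fun a _ => mul_nonneg ENNReal.toReal_nonneg (h a)

theorem expect_posSemidef {ι : Type*} [Fintype ι] (p : PMF α) {f : α → Matrix ι ι ℂ}
    (h : ∀ a, (f a).PosSemidef) : (expect p f).PosSemidef :=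
  Matrix.posSemidef_sum _ fun a _ => (h a).smul ENNReal.toReal_nonneg

theorem avg_eq [Nonempty α] (f : α → E) : avg f = (Fintype.card α : ℝ)⁻¹ • ∑ a, f a := by
  simp [avg, expect, Finset.smul_sum]

theorem avg_const [Nonempty α] (e : E) : avg (fun _ : α => e) = e := expect_const _ e

theorem avg_mono [Nonempty α] {f g : α → ℝ} (h : ∀ a, f a ≤ g a) : avg f ≤ avg g :=
  expect_mono _ h

theorem avg_nonneg [Nonempty α] {f : α → ℝ} (h : ∀ a, 0 ≤ f a) : 0 ≤ avg f :=
  expect_nonneg _ h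

theorem avg_add [Nonempty α] (f g : α → E) : avg (fun a => f a + g a) = avg f + avg g :=
  expect_add _ f g

theorem avg_sub [Nonempty α] (f g : α → E) : avg (fun a => f a - g a) = avg f - avg g :=
  expect_sub _ f g

theorem avg_mul_left [Nonempty α] (c : ℝ) (f : α → ℝ) : avg (fun a => c * f a) = c * avg f :=
  expect_mul_left _ c f

theorem map_avg [Nonempty α] (L : E →ₗ[ℝ] F) (f : α → E) : L (avg f) = avg fun a => L (f a) :=
  map_expect L _ f

theorem expect_comm (p : PMF α) (q : PMF β) (f : α → β → E) :
    (expect p fun a => expect q fun b => f a b) = expect q fun b => expect p fun a => f a b := by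
  simp only [expect, Finset.smul_sum]
  rw [Finset.sum_comm]
  simp only [smul_comm (p _).toReal]

theorem avg_comm [Nonempty α] [Nonempty β] (f : α → β → E) :
    (avg fun a => avg fun b => f a b) = avg fun b => avg fun a => f a b := expect_comm _ _ f

/-- Each term of an average of nonnegative numbers is at most the number of terms times the
average. -/
theorem le_card_mul_avg [Nonempty α] {f : α → ℝ} (h : ∀ a, 0 ≤ f a) (a : α) :
    f a ≤ Fintype.card α * avg f := by
  have h0 : (Fintype.card α : ℝ) ≠ 0 := by exact_mod_cast Fintype.card_ne_zero
  rw [avg_eq, smul_eq_mul, mul_inv_cancel_left₀ h0]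
  exact Finset.single_le_sum (fun b _ => h b) (Finset.mem_univ a)

end Expect

/-! ### The state-dependent semi-inner product -/

section SemiNorm

variable {ι κ μ : Type*} [Fintype ι] [Fintype κ] [Fintype μ]

/-- The real semi-inner product `Re Tr[A† B ρ]`. -/
def ip (ρ : Matrix κ κ ℂ) : Matrix ι κ ℂ →ₗ[ℝ] Matrix ι κ ℂ →ₗ[ℝ] ℝ :=
  LinearMap.mk₂ ℝ (fun A B => (Aᴴ * B * ρ).trace.re)
    (fun A A' B => by simp [Matrix.add_mul])
    (fun c A B => by simp [Matrix.conjTranspose_smul])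
    (fun A B B' => by simp [Matrix.mul_add, Matrix.add_mul])
    (fun c A B => by simp)

/-- The squared seminorm `Re Tr[A† A ρ]`. -/
def nsq (ρ : Matrix κ κ ℂ) (A : Matrix ι κ ℂ) : ℝ := ip ρ A A

/-- The real part of `Tr[A ρ]`, as a linear functional of `A`. -/
def ev [DecidableEq κ] (ρ : Matrix κ κ ℂ) : Matrix κ κ ℂ →ₗ[ℝ] ℝ := ip ρ 1

theorem ip_apply (ρ : Matrix κ κ ℂ) (A B : Matrix ι κ ℂ) : ip ρ A B = (Aᴴ * B * ρ).trace.re := rfl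

theorem ev_apply [DecidableEq κ] (ρ A : Matrix κ κ ℂ) : ev ρ A = (A * ρ).trace.re := by
  simp [ev, ip_apply]

theorem ip_eq_ev [DecidableEq κ] (ρ : Matrix κ κ ℂ) (A B : Matrix ι κ ℂ) :
    ip ρ A B = ev ρ (Aᴴ * B) := by rw [ev_apply, ip_apply]

theorem nsq_eq_ev [DecidableEq κ] (ρ : Matrix κ κ ℂ) (A : Matrix ι κ ℂ) :
    nsq ρ A = ev ρ (Aᴴ * A) := ip_eq_ev ρ A A

theorem stateNormSq_eq (A ρ : Matrix κ κ ℂ) : stateNormSq A ρ = nsq ρ A := rfl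

theorem ip_sum_state {σ : Type*} (s : Finset σ) (ρ : σ → Matrix κ κ ℂ) (A B : Matrix ι κ ℂ) :
    ip (∑ a ∈ s, ρ a) A B = ∑ a ∈ s, ip (ρ a) A B := by
  simp [ip_apply, Matrix.mul_sum, Matrix.trace_sum]

theorem nsq_sum_state {σ : Type*} (s : Finset σ) (ρ : σ → Matrix κ κ ℂ) (A : Matrix ι κ ℂ) :
    nsq (∑ a ∈ s, ρ a) A = ∑ a ∈ s, nsq (ρ a) A := ip_sum_state s ρ A A

theorem ev_sum_state [DecidableEq κ] {σ : Type*} (s : Finset σ) (ρ : σ → Matrix κ κ ℂ)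
    (A : Matrix κ κ ℂ) : ev (∑ a ∈ s, ρ a) A = ∑ a ∈ s, ev (ρ a) A := ip_sum_state s ρ 1 A

variable {ρ : Matrix κ κ ℂ}

theorem ip_comm (h : ρ.PosSemidef) (A B : Matrix ι κ ℂ) : ip ρ A B = ip ρ B A := by
  have e : (Bᴴ * A * ρ).trace = star (Aᴴ * B * ρ).trace := by
    rw [← Matrix.trace_conjTranspose]
    simp only [Matrix.conjTranspose_mul, Matrix.conjTranspose_conjTranspose, h.1.eq]
    rw [Matrix.trace_mul_comm]
  rw [ip_apply, ip_apply, e, Complex.star_def, Complex.conj_re]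

theorem nsq_nonneg (h : ρ.PosSemidef) (A : Matrix ι κ ℂ) : 0 ≤ nsq ρ A := by
  have h1 := (h.mul_mul_conjTranspose_same A).trace_nonneg
  rw [Matrix.mul_assoc, Matrix.trace_mul_comm, Matrix.mul_assoc, Matrix.trace_mul_comm] at h1
  have h2 := (Complex.le_def.mp h1).1
  exact h2

theorem nsq_add (h : ρ.PosSemidef) (A B : Matrix ι κ ℂ) :
    nsq ρ (A + B) = nsq ρ A + nsq ρ B + 2 * ip ρ A B := by
  simp only [nsq, map_add, LinearMap.add_apply]
  rw [ip_comm h B A]; ring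

theorem nsq_sub (h : ρ.PosSemidef) (A B : Matrix ι κ ℂ) :
    nsq ρ (A - B) = nsq ρ A + nsq ρ B - 2 * ip ρ A B := by
  simp only [nsq, map_sub, LinearMap.sub_apply]
  rw [ip_comm h B A]; ring

theorem nsq_neg (A : Matrix ι κ ℂ) : nsq ρ (-A) = nsq ρ A := by
  simp [nsq]

theorem nsq_smul (c : ℝ) (A : Matrix ι κ ℂ) : nsq ρ (c • A) = c * c * nsq ρ A := by
  simp [nsq, mul_assoc]

theorem nsq_sgn_smul (c : ZMod 2) (A : Matrix ι κ ℂ) : nsq ρ (sgn c • A) = nsq ρ A := by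
  rw [nsq_smul, sgn_mul_self, one_mul]

theorem nsq_add_le (h : ρ.PosSemidef) (A B : Matrix ι κ ℂ) :
    nsq ρ (A + B) ≤ 2 * nsq ρ A + 2 * nsq ρ B := by
  have h1 := nsq_nonneg h (A - B)
  rw [nsq_sub h] at h1
  rw [nsq_add h]; linarith

theorem nsq_sub_le (h : ρ.PosSemidef) (A B : Matrix ι κ ℂ) :
    nsq ρ (A - B) ≤ 2 * nsq ρ A + 2 * nsq ρ B := by
  rw [sub_eq_add_neg, ← nsq_neg B]; exact nsq_add_le h A (-B)

theorem nsq_triangle (h : ρ.PosSemidef) (A B C : Matrix ι κ ℂ) :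
    nsq ρ (A - C) ≤ 2 * nsq ρ (A - B) + 2 * nsq ρ (B - C) := by
  rw [← sub_add_sub_cancel A B C]; exact nsq_add_le h _ _

theorem nsq_sub_comm (A B : Matrix ι κ ℂ) : nsq ρ (A - B) = nsq ρ (B - A) := by
  rw [← nsq_neg, neg_sub]

theorem nsq_isometry_mul [DecidableEq ι] {U : Matrix μ ι ℂ} (hU : Uᴴ * U = 1) (A : Matrix ι κ ℂ) :
    nsq ρ (U * A) = nsq ρ A := by
  simp only [nsq, ip_apply, Matrix.conjTranspose_mul]
  rw [Matrix.mul_assoc Aᴴ, ← Matrix.mul_assoc Uᴴ, hU, Matrix.one_mul]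

theorem nsq_isometry [DecidableEq κ] {U : Matrix μ κ ℂ} (hU : Uᴴ * U = 1) :
    nsq ρ U = ρ.trace.re := by
  rw [nsq_eq_ev, hU, ev_apply, one_mul]

/-- Right multiplication by an operator that acts almost as a sign on each part of the state. -/
theorem nsq_mul_right_le [DecidableEq κ] {σ : Type*} [Fintype σ] {ρ : σ → Matrix κ κ ℂ}
    (hρ : ∀ a, (ρ a).PosSemidef) {M M' O : Matrix κ κ ℂ} (hM : Mᴴ * M = 1) (hM' : M'ᴴ * M' = 1)
    (s : σ → ZMod 2) :
    nsq (∑ a, ρ a) ((M - M') * O) ≤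
      2 * nsq (∑ a, ρ a) (M - M') + 8 * ∑ a, nsq (ρ a) (O - sgn (s a) • 1) := by
  simp only [nsq_sum_state, Finset.mul_sum, ← Finset.sum_add_distrib]
  refine Finset.sum_le_sum fun a _ => ?_
  -- `O` is split into a sign, which commutes with everything, and a small remainder, which has only
  -- isometries to its left.
  have e : (M - M') * O = (M - M') * (O - sgn (s a) • 1) + sgn (s a) • (M - M') := by
    simp [mul_sub]
  rw [e]
  refine (nsq_add_le (hρ a) _ _).trans ?_
  rw [nsq_sgn_smul, sub_mul]
  have := nsq_sub_le (hρ a) (M * (O - sgn (s a) • 1)) (M' * (O - sgn (s a) • 1))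
  rw [nsq_isometry_mul hM, nsq_isometry_mul hM'] at this
  linarith

/-- Parseval's identity. -/
theorem sum_nsq_eq_avg {n : ℕ} (F : Bits n → Matrix ι κ ℂ) :
    ∑ u, nsq ρ (F u) = avg fun a : Bits n => nsq ρ (∑ u, sgn (a ⬝ᵥ u) • F u) := by
  -- The cross terms carry the character of `u + v`, so averaging over `a` removes all but the
  -- diagonal ones.
  have key : ∀ a : Bits n, nsq ρ (∑ u, sgn (a ⬝ᵥ u) • F u) =
      ∑ u, ∑ v, sgn (a ⬝ᵥ (u + v)) * ip ρ (F u) (F v) := fun a => by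
    simp only [nsq, map_sum, map_smul, LinearMap.sum_apply, LinearMap.smul_apply, smul_eq_mul,
      dotProduct_add, sgn_add, Finset.mul_sum]
    rw [Finset.sum_comm]
    refine Finset.sum_congr rfl fun u _ => Finset.sum_congr rfl fun v _ => ?_
    ring
  rw [avg_eq]
  simp only [key]
  rw [Finset.sum_comm, Finset.smul_sum]
  refine Finset.sum_congr rfl fun u _ => ?_
  rw [Finset.sum_comm]
  simp only [← Finset.sum_mul, sum_sgn_dotProduct, bits_add_eq_zero]
  simp [nsq, ZMod.card]

end SemiNorm

/-- The real part of `Tr[A ρ]`, as a linear functional of `ρ`. -/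
def evState {κ : Type*} [Fintype κ] [DecidableEq κ] (A : Matrix κ κ ℂ) : Matrix κ κ ℂ →ₗ[ℝ] ℝ :=
  Complex.reLm ∘ₗ Matrix.traceLinearMap κ ℝ ℂ ∘ₗ LinearMap.mulLeft ℝ A

theorem evState_apply {κ : Type*} [Fintype κ] [DecidableEq κ] (A ρ : Matrix κ κ ℂ) :
    evState A ρ = ev ρ A := by
  rw [ev_apply]; rfl

/-! ### Gates and circuits -/

section Gates

variable {N k : ℕ}

open Classical in
/-- The operator acting as `U` on the wires `w` and trivially on the others. -/
def wireOp (w : Fin k ↪ Fin N) (U : Matrix (Bits k) (Bits k) ℂ) : Op N := Matrix.of fun x y =>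
  if ∀ i, i ∉ Set.range w → x i = y i then U (x ∘ w) (y ∘ w) else 0

theorem Gate.toOp_eq (g : Gate N) : g.toOp = wireOp g.wires g.unitary := rfl

-- The strings that agree with `x` off the wires are those obtained from `x` by overwriting the
-- wires.
open Classical in
theorem sum_agree {E : Type*} [AddCommMonoid E] (w : Fin k ↪ Fin N) (x : Bits N) (F : Bits N → E) :
    (∑ y, if ∀ i, i ∉ Set.range w → x i = y i then F y else 0) =
      ∑ t : Bits k, F (Function.extend w t x) := by
  rw [← Finset.sum_filter]
  refine Finset.sum_nbij' (fun y => y ∘ w) (fun t => Function.extend w t x) (by simp) ?_ ?_ ?_ ?_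
  · intro t _
    simp only [Finset.mem_filter, Finset.mem_univ, true_and]
    intro i hi
    rw [Function.extend_apply' _ _ _ (by simpa using hi)]
  · intro y hy
    simp only [Finset.mem_filter, Finset.mem_univ, true_and] at hy
    funext i
    by_cases hi : ∃ j, w j = i
    · obtain ⟨j, rfl⟩ := hi
      rw [w.injective.extend_apply]; rfl
    · rw [Function.extend_apply' _ _ _ hi, hy i (by simpa using hi)]
  · intro t _
    funext j
    simp [w.injective.extend_apply]
  · intro y hy
    simp only [Finset.mem_filter, Finset.mem_univ, true_and] at hy
    congr 1
    funext i
    by_cases hi : ∃ j, w j = i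
    · obtain ⟨j, rfl⟩ := hi
      rw [w.injective.extend_apply]; rfl
    · rw [Function.extend_apply' _ _ _ hi, hy i (by simpa using hi)]

theorem extend_comp_self (w : Fin k ↪ Fin N) (x : Bits N) (t : Bits k) :
    Function.extend w t x ∘ w = t := funext fun j => by simp [w.injective.extend_apply]

theorem wireOp_mulVec (w : Fin k ↪ Fin N) (U : Matrix (Bits k) (Bits k) ℂ) (φ : Bits N → ℂ)
    (x : Bits N) :
    (wireOp w U *ᵥ φ) x = ∑ t, U (x ∘ w) t * φ (Function.extend w t x) := by
  classical
  simp only [Matrix.mulVec, dotProduct, wireOp, Matrix.of_apply, ite_mul, zero_mul]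
  rw [sum_agree w x fun y => U (x ∘ w) (y ∘ w) * φ y]
  simp only [extend_comp_self]

theorem wireOp_mul (w : Fin k ↪ Fin N) (U V : Matrix (Bits k) (Bits k) ℂ) :
    wireOp w U * wireOp w V = wireOp w (U * V) := by
  classical
  ext x y
  rw [Matrix.mul_apply]
  simp only [wireOp, Matrix.of_apply, ite_mul, zero_mul]
  rw [sum_agree w x fun z => U (x ∘ w) (z ∘ w) *
    if ∀ i, i ∉ Set.range w → z i = y i then V (z ∘ w) (y ∘ w) else 0]
  have h : ∀ t : Bits k, (∀ i, i ∉ Set.range w → Function.extend w t x i = y i) ↔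
      ∀ i, i ∉ Set.range w → x i = y i := fun t => by
    refine forall₂_congr fun i hi => ?_
    rw [Function.extend_apply' _ _ _ (by simpa using hi)]
  simp only [extend_comp_self, h, Matrix.mul_apply]
  split_ifs <;> simp

theorem wireOp_one (w : Fin k ↪ Fin N) : wireOp w (1 : Matrix (Bits k) (Bits k) ℂ) = 1 := by
  classical
  ext x y
  simp only [wireOp, Matrix.of_apply, Matrix.one_apply]
  by_cases hxy : x = y
  · simp [hxy]
  · simp only [hxy, if_false, ite_eq_right_iff]
    intro h h2
    exact absurd (funext fun i => by
      by_cases hi : ∃ j, w j = i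
      · obtain ⟨j, rfl⟩ := hi
        exact congrFun h2 j
      · exact h i (by simpa using hi)) hxy

theorem wireOp_conjTranspose (w : Fin k ↪ Fin N) (U : Matrix (Bits k) (Bits k) ℂ) :
    (wireOp w U)ᴴ = wireOp w Uᴴ := by
  classical
  ext x y
  simp only [wireOp, Matrix.conjTranspose_apply, Matrix.of_apply, eq_comm (a := x _)]
  split_ifs <;> simp

theorem Gate.toOp_isometry (g : Gate N) : g.toOpᴴ * g.toOp = 1 := by
  rw [Gate.toOp_eq, wireOp_conjTranspose, wireOp_mul]
  have h := Matrix.mem_unitaryGroup_iff'.mp g.unitary.2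
  rw [Matrix.star_eq_conjTranspose] at h
  rw [h, wireOp_one]

theorem Circuit.foldl_eq (C : Circuit N) (M : Op N) :
    C.foldl (fun M g => g.toOp * M) M = C.toOp * M := by
  unfold Circuit.toOp
  induction C generalizing M with
  | nil => simp
  | cons g C ih => simp only [List.foldl_cons]; rw [ih, ih (g.toOp * 1)]; simp [mul_assoc]

theorem Circuit.toOp_nil : Circuit.toOp ([] : Circuit N) = 1 := rfl

theorem Circuit.toOp_append (C C' : Circuit N) :
    Circuit.toOp (C ++ C') = Circuit.toOp C' * Circuit.toOp C := by
  rw [Circuit.toOp, List.foldl_append]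
  exact Circuit.foldl_eq C' _

theorem Circuit.toOp_singleton (g : Gate N) : Circuit.toOp [g] = g.toOp := by
  simp [Circuit.toOp]

theorem Circuit.toOp_cons (g : Gate N) (C : Circuit N) :
    Circuit.toOp (g :: C) = Circuit.toOp C * g.toOp := by
  rw [← List.singleton_append, Circuit.toOp_append, Circuit.toOp_singleton]

theorem Circuit.toOp_isometry (C : Circuit N) : C.toOpᴴ * C.toOp = 1 := by
  induction C with
  | nil => simp [Circuit.toOp_nil]
  | cons g C ih =>
    rw [Circuit.toOp_cons, Matrix.conjTranspose_mul, mul_assoc, ← mul_assoc _ (Circuit.toOp C), ih,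
      one_mul, g.toOp_isometry]

end Gates

/-! ### Shifts and phases -/

section Registers

variable {N : ℕ}

/-- The permutation operator `|x⟩ ↦ |x + p⟩`. -/
def shift (p : Bits N) : Op N := Matrix.of fun x y => if x = y + p then 1 else 0

/-- The diagonal operator `|x⟩ ↦ (-1)^{k·x} |x⟩`. -/
def phase (k : Bits N) : Op N := Matrix.diagonal fun x => (sgn (k ⬝ᵥ x) : ℂ)

theorem writeOp_eq_shift (off : ℕ) {m : ℕ} (c : Bits m) :
    writeOp N off c = shift (place N off c) := rfl

theorem bits_eq_add_iff {x y p : Bits N} : x = y + p ↔ y = x + p := by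
  constructor <;> rintro rfl <;> rw [add_assoc, bits_add_self, add_zero]

theorem shift_mulVec (p : Bits N) (φ : Bits N → ℂ) (x : Bits N) :
    (shift p *ᵥ φ) x = φ (x + p) := by
  simp only [shift, Matrix.mulVec, dotProduct, Matrix.of_apply, bits_eq_add_iff, ite_mul, one_mul,
    zero_mul, Finset.sum_ite_eq', Finset.mem_univ, if_true]

theorem shift_mul (p q : Bits N) : shift p * shift q = shift (p + q) := by
  refine Matrix.ext_of_mulVec_single fun i => ?_
  rw [← Matrix.mulVec_mulVec]
  funext x
  simp only [shift_mulVec, add_assoc]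

theorem shift_zero : shift (0 : Bits N) = 1 := by
  ext x y
  simp [shift, Matrix.one_apply]

theorem shift_conjTranspose (p : Bits N) : (shift p)ᴴ = shift p := by
  ext x y
  simp only [shift, Matrix.conjTranspose_apply, Matrix.of_apply]
  by_cases h : y = x + p
  · rw [if_pos h, if_pos (bits_eq_add_iff.mpr h), star_one]
  · rw [if_neg h, if_neg (mt bits_eq_add_iff.mp h), star_zero]

theorem writeOp_isometry (off : ℕ) {m : ℕ} (c : Bits m) :
    (writeOp N off c)ᴴ * writeOp N off c = 1 := by
  rw [writeOp_eq_shift, shift_conjTranspose, shift_mul, bits_add_self, shift_zero]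

theorem phase_add (k k' : Bits N) : phase (k + k') = phase k * phase k' := by
  rw [phase, phase, phase, Matrix.diagonal_mul_diagonal]
  simp only [add_dotProduct, sgn_add, Complex.ofReal_mul]

theorem phase_zero : phase (0 : Bits N) = 1 := by
  simp [phase, sgn_zero]

theorem phase_conjTranspose (k : Bits N) : (phase k)ᴴ = phase k := by
  simp only [phase, Matrix.diagonal_conjTranspose]
  congr 1
  funext x
  simp

theorem phase_mul_self (k : Bits N) : phase k * phase k = 1 := by
  rw [← phase_add, bits_add_self, phase_zero]

/-- String and register may have different lengths: `readBits` pads and `place` truncates, and both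
products reduce to the overlap. -/
theorem dotProduct_readBits {l : ℕ} (c : Bits l) (x : Bits N) :
    c ⬝ᵥ readBits l x = place N 0 c ⬝ᵥ x := by
  let f : ℕ → ZMod 2 := fun i => if h : i < l ∧ i < N then c ⟨i, h.1⟩ * x ⟨i, h.2⟩ else 0
  have h1 : c ⬝ᵥ readBits l x = ∑ i ∈ Finset.range l, f i := by
    rw [Finset.sum_range]
    refine Finset.sum_congr rfl fun i _ => ?_
    by_cases h : i.val < N <;> simp [f, readBits, h]
  have h2 : place N 0 c ⬝ᵥ x = ∑ i ∈ Finset.range N, f i := by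
    rw [Finset.sum_range]
    refine Finset.sum_congr rfl fun i _ => ?_
    by_cases h : i.val < l <;> simp [f, place, h]
  rw [h1, h2]
  have h3 : ∀ M, (∀ i, M ≤ i → f i = 0) → M ≤ max l N →
      ∑ i ∈ Finset.range M, f i = ∑ i ∈ Finset.range (max l N), f i := fun M hM hle =>
    Finset.sum_subset (Finset.range_subset_range.mpr hle) fun i _ hi =>
      hM i (by simpa using hi)
  rw [h3 l (fun i hi => dif_neg fun h => by omega) (le_max_left _ _),
    h3 N (fun i hi => dif_neg fun h => by omega) (le_max_right _ _)]

theorem outProj_conjTranspose {m : ℕ} (b : Bits m) : (outProj N b)ᴴ = outProj N b := by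
  simp only [outProj, Matrix.diagonal_conjTranspose]
  congr 1
  funext x
  simp only [Pi.star_apply]
  split_ifs <;> simp

theorem outProj_mul {m : ℕ} (b b' : Bits m) :
    outProj N b * outProj N b' = if b = b' then outProj N b else 0 := by
  simp only [outProj, Matrix.diagonal_mul_diagonal]
  ext x y
  by_cases hxy : x = y
  · subst hxy
    by_cases hb : b = b'
    · simp [hb]
    · simp only [hb, if_false, Matrix.diagonal_apply_eq, Matrix.zero_apply]
      by_cases h : readBits m x = b
      · simp [h, hb]
      · simp [h]
  · split_ifs <;> simp [hxy]

/-- A parity of measured bits is a diagonal unitary, so Bob's observables are conjugated phases and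
can be run as circuits. -/
theorem sum_sgn_smul_outProj {m : ℕ} (c : Bits m) :
    ∑ b : Bits m, sgn (c ⬝ᵥ b) • outProj N b = phase (place N 0 c) := by
  ext x y
  simp only [Matrix.sum_apply, Matrix.smul_apply, outProj, phase]
  by_cases hxy : x = y
  · subst hxy
    simp [← dotProduct_readBits]
  · simp [hxy]

theorem place_zero (off : ℕ) {m : ℕ} : place N off (0 : Bits m) = 0 := by
  funext i; simp [place]

theorem place_add (off : ℕ) {m : ℕ} (c c' : Bits m) :
    place N off (c + c') = place N off c + place N off c' := by
  funext i; simp only [place, Pi.add_apply]; split_ifs <;> simp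

theorem sum_outProj {m : ℕ} : ∑ b : Bits m, outProj N b = 1 := by
  have h := sum_sgn_smul_outProj (N := N) (0 : Bits m)
  simpa [sgn_zero, place_zero, phase_zero] using h

end Registers

/-! ### Bob's measurements and observables -/

section Bob

/-- The unitary preceding Bob's final measurement in the computational basis. -/
def Prover.bobU (P : Prover) {m : ℕ} (y : Bits m) : Op P.N :=
  P.circuit₂.toOp * writeOp P.N P.replyLen y

/-- The `±1`-valued observable `∑_b (-1)^{c·b} B^y_b`. -/
def Prover.obs (P : Prover) {m l : ℕ} (y : Bits m) (c : Bits l) : Op P.N :=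
  (P.bobU y)ᴴ * phase (place P.N 0 c) * P.bobU y

variable (P : Prover) {m l : ℕ} (y : Bits m)

theorem Prover.bobU_isometry : (P.bobU y)ᴴ * P.bobU y = 1 := by
  rw [bobU, Matrix.conjTranspose_mul, mul_assoc, ← mul_assoc _ (Circuit.toOp _),
    Circuit.toOp_isometry, one_mul, writeOp_isometry]

theorem Prover.bobU_mul_conjTranspose : P.bobU y * (P.bobU y)ᴴ = 1 :=
  mul_eq_one_comm.mp (P.bobU_isometry y)

theorem Prover.bob_eq (b : Bits l) : P.bob y b = (P.bobU y)ᴴ * outProj P.N b * P.bobU y := rfl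

theorem Prover.conj_mul_conj (A B : Op P.N) :
    (P.bobU y)ᴴ * A * P.bobU y * ((P.bobU y)ᴴ * B * P.bobU y) =
      (P.bobU y)ᴴ * (A * B) * P.bobU y := by
  simp only [mul_assoc]
  rw [← mul_assoc (P.bobU y) _ᴴ, bobU_mul_conjTranspose, one_mul]

theorem Prover.bob_conjTranspose (b : Bits l) : (P.bob y b)ᴴ = P.bob y b := by
  rw [bob_eq, Matrix.conjTranspose_mul, Matrix.conjTranspose_mul, outProj_conjTranspose,
    Matrix.conjTranspose_conjTranspose, mul_assoc]

theorem Prover.bob_mul (b b' : Bits l) :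
    P.bob y b * P.bob y b' = if b = b' then P.bob y b else 0 := by
  rw [bob_eq, bob_eq, conj_mul_conj, outProj_mul]
  split_ifs <;> simp

theorem Prover.sum_bob : ∑ b : Bits l, P.bob y b = 1 := by
  simp only [bob_eq, ← Finset.mul_sum, ← Finset.sum_mul, sum_outProj, mul_one, bobU_isometry]

theorem Prover.obs_eq_sum (c : Bits l) : P.obs y c = ∑ b : Bits l, sgn (c ⬝ᵥ b) • P.bob y b := by
  rw [obs, ← sum_sgn_smul_outProj]
  simp only [Finset.mul_sum, Finset.sum_mul, bob_eq, mul_smul_comm, smul_mul_assoc]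

theorem Prover.obs_conjTranspose (c : Bits l) : (P.obs y c)ᴴ = P.obs y c := by
  rw [obs, Matrix.conjTranspose_mul, Matrix.conjTranspose_mul, phase_conjTranspose,
    Matrix.conjTranspose_conjTranspose, mul_assoc]

theorem Prover.obs_add (c c' : Bits l) : P.obs y (c + c') = P.obs y c * P.obs y c' := by
  rw [obs, obs, obs, conj_mul_conj, ← phase_add, place_add]

theorem Prover.obs_zero : P.obs y (0 : Bits l) = 1 := by
  rw [obs, place_zero, phase_zero, mul_one, bobU_isometry]

theorem Prover.obs_mul_self (c : Bits l) : P.obs y c * P.obs y c = 1 := by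
  rw [← obs_add, bits_add_self, obs_zero]

theorem Prover.obs_isometry (c : Bits l) : (P.obs y c)ᴴ * P.obs y c = 1 := by
  rw [obs_conjTranspose, obs_mul_self]

variable {ρ : Op P.N}

theorem Prover.ev_bob (b : Bits l) : ev ρ (P.bob y b) = nsq ρ (P.bob y b) := by
  rw [nsq_eq_ev, bob_conjTranspose, bob_mul, if_pos rfl]

theorem Prover.ev_bob_nonneg (hρ : ρ.PosSemidef) (b : Bits l) : 0 ≤ ev ρ (P.bob y b) := by
  rw [ev_bob]; exact nsq_nonneg hρ _

theorem Prover.nsq_sum_bob (f : Bits l → ℝ) :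
    nsq ρ (∑ b, f b • P.bob y b) = ∑ b, f b * f b * ev ρ (P.bob y b) := by
  have h : (∑ b, f b • P.bob y b)ᴴ * (∑ b, f b • P.bob y b) = ∑ b, (f b * f b) • P.bob y b := by
    simp only [Matrix.conjTranspose_sum, Matrix.conjTranspose_smul, bob_conjTranspose,
      Finset.sum_mul, Finset.mul_sum, smul_mul_assoc, mul_smul_comm, bob_mul]
    simp [smul_smul]
  rw [nsq_eq_ev, h, map_sum]
  simp

/-- The difference vanishes on outcomes of parity `s` and is ±2 on the others, hence four times the
weight of the wrong parity. -/
theorem Prover.nsq_obs_sub_sgn (c : Bits l) (s : ZMod 2) :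
    nsq ρ (P.obs y c - sgn s • 1) =
      4 * ∑ b : Bits l, if c ⬝ᵥ b = s then 0 else ev ρ (P.bob y b) := by
  have h : P.obs y c - sgn s • 1 = ∑ b, (sgn (c ⬝ᵥ b) - sgn s) • P.bob y b := by
    simp only [sub_smul, Finset.sum_sub_distrib, ← Finset.smul_sum, sum_bob, obs_eq_sum]
  rw [h, nsq_sum_bob, Finset.mul_sum]
  refine Finset.sum_congr rfl fun b _ => ?_
  split_ifs with hb
  · simp [hb]
  · rw [sgn_eq_of_ne hb]
    have := sgn_mul_self s
    linear_combination 4 * ev ρ (P.bob y b) * this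

end Bob

/-! ### Alice's post-measurement states -/

section Alice

theorem pureState_posSemidef {ι : Type*} [Fintype ι] (φ : ι → ℂ) : (pureState φ).PosSemidef :=
  Matrix.posSemidef_vecMulVec_self_star φ

theorem Prover.postState_posSemidef (P : Prover) {m : ℕ} (c : Bits m) (α : Bits P.replyLen) :
    (P.postState c α).PosSemidef :=
  (pureState_posSemidef _).mul_mul_conjTranspose_same _

theorem Prover.sum_trace_postState (P : Prover) {m : ℕ} (c : Bits m) :
    ∑ α, (P.postState c α).trace = 1 := by
  have h1 : ∀ α, (P.postState c α).trace =
      ((P.circuit₁.toOp * writeOp P.N 0 c)ᴴ * outProj P.N α *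
        (P.circuit₁.toOp * writeOp P.N 0 c) * pureState P.ψ).trace := fun α => by
    have e : (outProj P.N α)ᴴ * outProj P.N α = outProj P.N α := by
      rw [outProj_conjTranspose, outProj_mul, if_pos rfl]
    rw [postState, alice, Matrix.trace_mul_comm, ← mul_assoc, mul_assoc (outProj _ _),
      Matrix.conjTranspose_mul, mul_assoc _ (outProj _ _)ᴴ, ← mul_assoc (outProj _ _)ᴴ, e,
      ← mul_assoc]
  simp only [h1, ← Matrix.trace_sum, ← Finset.sum_mul, ← Finset.mul_sum, sum_outProj, mul_one]
  rw [Matrix.conjTranspose_mul, mul_assoc (_ᴴ), ← mul_assoc _ (Circuit.toOp _),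
    Circuit.toOp_isometry, one_mul, writeOp_isometry, one_mul, pureState, Matrix.trace_vecMulVec,
    dotProduct_comm, P.ψ_norm]

variable (E : EncScheme) (κ : ℕ) (T : ProtocolData) (P : Prover)

/-- The unnormalised state after the first round, for the decrypted answer `a`. -/
def decState (x : T.AQ) (a : Bits x.ansLen) : Op P.N :=
  expect (E.gen κ) fun sk => expect (E.enc κ sk (T.aliceCode x)) fun c =>
    ∑ α : Bits P.replyLen, (E.dec κ x.ansLen sk α a).toReal • P.postState c α

theorem decState_posSemidef (x : T.AQ) (a : Bits x.ansLen) :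
    (decState E κ T P x a).PosSemidef :=
  expect_posSemidef _ fun _ => expect_posSemidef _ fun _ => Matrix.posSemidef_sum _ fun _ _ =>
    (P.postState_posSemidef _ _).smul ENNReal.toReal_nonneg

theorem encState_eq_sum (x : T.AQ) : encState E κ T P x = ∑ a, decState E κ T P x a := by
  simp only [encState, decState, ← expect_sum]
  congr 1; funext sk; congr 1; funext c
  rw [Finset.sum_comm]
  simp only [← Finset.sum_smul, sum_toReal_pmf, one_smul]

theorem encState_posSemidef (x : T.AQ) : (encState E κ T P x).PosSemidef := by
  rw [encState_eq_sum]
  exact Matrix.posSemidef_sum _ fun a _ => decState_posSemidef E κ T P x a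

theorem trace_encState (x : T.AQ) : (encState E κ T P x).trace = 1 := by
  have h : ∀ A : Op P.N, A.trace = (Matrix.traceLinearMap (Bits P.N) ℝ ℂ) A := fun _ => rfl
  rw [h, encState]
  simp only [map_expect, map_sum]
  simp only [← h, P.sum_trace_postState, expect_const]

/-- Linear functionals of the post-measurement states, averaged over the whole first round. -/
theorem expect_map_postState {F : Type*} [AddCommGroup F] [Module ℝ F] (x : T.AQ)
    (L : Bits x.ansLen → Op P.N →ₗ[ℝ] F) :
    (expect (E.gen κ) fun sk => expect (E.enc κ sk (T.aliceCode x)) fun c =>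
      ∑ α : Bits P.replyLen, expect (E.dec κ x.ansLen sk α) fun a => L a (P.postState c α)) =
    ∑ a, L a (decState E κ T P x a) := by
  simp only [decState, map_expect, map_sum, map_smul, ← expect_sum]
  congr 1; funext sk; congr 1; funext c
  rw [Finset.sum_comm]
  rfl

open Classical in
theorem acceptProb_eq (x : T.AQ) (y : T.BQ) (acc : Bits x.ansLen → Bits y.ansLen → Prop) :
    acceptProb E κ T P x y acc =
      ∑ a, ∑ b, if acc a b then ev (decState E κ T P x a) (P.bob (T.bobCode y) b) else 0 := by
  have h := expect_map_postState E κ T P x fun a => ∑ b : Bits y.ansLen,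
    (if acc a b then (1 : ℝ) else 0) • evState (P.bob (T.bobCode y) b)
  simp only [LinearMap.sum_apply, LinearMap.smul_apply, smul_eq_mul, ite_mul, one_mul, zero_mul,
    evState_apply] at h
  rw [acceptProb, ← h]
  simp only [ev_apply]

theorem sum_ev_decState (x : T.AQ) (y : T.BQ) :
    ∑ a, ∑ b : Bits y.ansLen, ev (decState E κ T P x a) (P.bob (T.bobCode y) b) = 1 := by
  simp only [← map_sum, P.sum_bob]
  rw [← ev_sum_state, ← encState_eq_sum, ev_apply, one_mul, trace_encState, Complex.one_re]

open Classical in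
theorem one_sub_acceptProb (x : T.AQ) (y : T.BQ) (acc : Bits x.ansLen → Bits y.ansLen → Prop) :
    1 - acceptProb E κ T P x y acc =
      ∑ a, ∑ b, if acc a b then 0 else ev (decState E κ T P x a) (P.bob (T.bobCode y) b) := by
  rw [← sum_ev_decState E κ T P x y, acceptProb_eq]
  simp only [← Finset.sum_sub_distrib]
  refine Finset.sum_congr rfl fun a _ => Finset.sum_congr rfl fun b _ => ?_
  split_ifs <;> simp

theorem acceptProb_le_one (x : T.AQ) (y : T.BQ) (acc : Bits x.ansLen → Bits y.ansLen → Prop) :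
    acceptProb E κ T P x y acc ≤ 1 := by
  classical
  have h : 0 ≤ 1 - acceptProb E κ T P x y acc := by
    rw [one_sub_acceptProb]
    refine Finset.sum_nonneg fun a _ => Finset.sum_nonneg fun b _ => ?_
    split_ifs
    · exact le_rfl
    · exact P.ev_bob_nonneg _ (decState_posSemidef E κ T P x a) b
  linarith

theorem acceptProb_nonneg (x : T.AQ) (y : T.BQ) (acc : Bits x.ansLen → Bits y.ansLen → Prop) :
    0 ≤ acceptProb E κ T P x y acc := by
  classical
  rw [acceptProb_eq]
  refine Finset.sum_nonneg fun a _ => Finset.sum_nonneg fun b _ => ?_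
  split_ifs
  · exact P.ev_bob_nonneg _ (decState_posSemidef E κ T P x a) b
  · exact le_rfl

/-- If acceptance forces Bob's answer to have parity `s a` on `c`, the corresponding observable acts
on Alice's post-measurement states as a sign, up to the failure probability. -/
theorem sum_nsq_obs_sub_sgn_le (x : T.AQ) (y : T.BQ)
    (acc : Bits x.ansLen → Bits y.ansLen → Prop) (c : Bits y.ansLen) (s : Bits x.ansLen → ZMod 2)
    (h : ∀ a b, acc a b → c ⬝ᵥ b = s a) :
    ∑ a, nsq (decState E κ T P x a) (P.obs (T.bobCode y) c - sgn (s a) • 1) ≤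
      4 * (1 - acceptProb E κ T P x y acc) := by
  classical
  rw [one_sub_acceptProb]
  simp only [P.nsq_obs_sub_sgn, ← Finset.mul_sum]
  refine mul_le_mul_of_nonneg_left ?_ (by norm_num)
  refine Finset.sum_le_sum fun a _ => Finset.sum_le_sum fun b _ => ?_
  by_cases hab : acc a b
  · rw [if_pos (h a b hab), if_pos hab]
  · rw [if_neg hab]
    split_ifs
    · exact P.ev_bob_nonneg _ (decState_posSemidef E κ T P x a) b
    · exact le_rfl

end Alice

/-! ### Circuits controlled by one additional wire -/

section Controlled

variable {N : ℕ}

/-- Append a last bit. -/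
def bsnoc (x : Bits N) (t : ZMod 2) : Bits (N + 1) := Fin.snoc (α := fun _ => ZMod 2) x t

theorem bsnoc_castSucc (x : Bits N) (t : ZMod 2) (i : Fin N) : bsnoc x t i.castSucc = x i :=
  Fin.snoc_castSucc (α := fun _ => ZMod 2) _ _ _

theorem bsnoc_last (x : Bits N) (t : ZMod 2) : bsnoc x t (Fin.last N) = t :=
  Fin.snoc_last (α := fun _ => ZMod 2) _ _

/-- Splitting off the last bit. -/
def bsnocEquiv (N : ℕ) : Bits N × ZMod 2 ≃ Bits (N + 1) where
  toFun p := bsnoc p.1 p.2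
  invFun x := (fun i => x i.castSucc, x (Fin.last N))
  left_inv p := by simp [bsnoc_castSucc, bsnoc_last]
  right_inv x := by
    funext i
    refine Fin.lastCases ?_ (fun i => ?_) i <;> simp [bsnoc_castSucc, bsnoc_last]

theorem sum_bsnoc {E : Type*} [AddCommMonoid E] (f : Bits (N + 1) → E) :
    ∑ x, f x = ∑ y : Bits N, ∑ t : ZMod 2, f (bsnoc y t) := by
  rw [← (bsnocEquiv N).sum_comp f, Fintype.sum_prod_type]; rfl

theorem sum_zmod_two {E : Type*} [AddCommMonoid E] (f : ZMod 2 → E) : ∑ t, f t = f 0 + f 1 :=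
  Fin.sum_univ_two f

/-- Some circuit with at most `s` gates applies `U t` to the first `N` wires when the last wire is
`t`, leaving the last wire unchanged. -/
def Implements (s : ℕ) (U : ZMod 2 → Op N) : Prop :=
  ∃ C : Circuit (N + 1), C.length ≤ s ∧ ∀ (χ : Bits (N + 1) → ℂ) (x : Bits N) (t : ZMod 2),
    (C.toOp *ᵥ χ) (bsnoc x t) = (U t *ᵥ fun y => χ (bsnoc y t)) x

theorem Implements.one : Implements 0 fun _ => (1 : Op N) :=
  ⟨[], le_rfl, fun χ x t => by simp [Circuit.toOp_nil]⟩

theorem Implements.mono {s s' : ℕ} {U : ZMod 2 → Op N} (h : Implements s U) (hs : s ≤ s') :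
    Implements s' U := by
  obtain ⟨C, h1, h2⟩ := h
  exact ⟨C, h1.trans hs, h2⟩

theorem Implements.mul {s s' : ℕ} {U V : ZMod 2 → Op N} (hV : Implements s' V)
    (hU : Implements s U) : Implements (s' + s) fun t => V t * U t := by
  obtain ⟨C, h1, h2⟩ := hU
  obtain ⟨C', h1', h2'⟩ := hV
  refine ⟨C ++ C', by simp only [List.length_append]; omega, fun χ x t => ?_⟩
  rw [Circuit.toOp_append, ← Matrix.mulVec_mulVec, h2', ← Matrix.mulVec_mulVec]
  simp only [h2]

theorem extend_bsnoc {k : ℕ} (w : Fin k ↪ Fin N) (z : Bits k) (x : Bits N) (t : ZMod 2) :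
    Function.extend (w.trans Fin.castSuccEmb) z (bsnoc x t) =
      bsnoc (Function.extend w z x) t := by
  funext i
  refine Fin.lastCases ?_ (fun i => ?_) i
  · rw [Function.extend_apply', bsnoc_last, bsnoc_last]
    rintro ⟨j, hj⟩
    exact absurd hj (Fin.castSucc_lt_last (w j)).ne
  · rw [bsnoc_castSucc]
    by_cases hi : ∃ j, w j = i
    · obtain ⟨j, rfl⟩ := hi
      rw [w.injective.extend_apply]
      exact (w.trans Fin.castSuccEmb).injective.extend_apply _ _ j
    · rw [Function.extend_apply' _ _ _ hi, Function.extend_apply', bsnoc_castSucc]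
      rintro ⟨j, hj⟩
      exact hi ⟨j, Fin.castSucc_injective _ hj⟩

theorem Implements.gate (g : Gate N) : Implements 1 fun _ => g.toOp := by
  let g' : Gate (N + 1) := ⟨g.arity, g.arity_le, g.wires.trans Fin.castSuccEmb, g.unitary⟩
  refine ⟨[g'], le_rfl, fun χ x t => ?_⟩
  have e : bsnoc x t ∘ (g.wires.trans Fin.castSuccEmb) = x ∘ g.wires :=
    funext fun j => bsnoc_castSucc x t _
  rw [Circuit.toOp_singleton, Gate.toOp_eq, Gate.toOp_eq, wireOp_mulVec, wireOp_mulVec]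
  simp only [g', extend_bsnoc, e]

theorem Implements.gate_conjTranspose (g : Gate N) : Implements 1 fun _ => g.toOpᴴ := by
  have h := Implements.gate (⟨g.arity, g.arity_le, g.wires, star g.unitary⟩ : Gate N)
  rw [Gate.toOp_eq, wireOp_conjTranspose]
  exact h

theorem Implements.circuit (C : Circuit N) : Implements C.length fun _ => C.toOp := by
  induction C with
  | nil => exact Implements.one
  | cons g C ih =>
    simp only [Circuit.toOp_cons, List.length_cons]
    exact ih.mul (Implements.gate g)

theorem Implements.circuit_conjTranspose (C : Circuit N) :
    Implements C.length fun _ => C.toOpᴴ := by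
  induction C with
  | nil => simpa [Circuit.toOp_nil] using Implements.one (N := N)
  | cons g C ih =>
    simp only [Circuit.toOp_cons, List.length_cons, Matrix.conjTranspose_mul]
    exact ((Implements.gate_conjTranspose g).mul ih).mono (by omega)

/-- A multiplicative family of operators indexed by bit strings is implementable if its values at
the unit vectors are. -/
theorem Implements.of_single (A : Bits N → ZMod 2 → Op N) (h0 : ∀ t, A 0 t = 1)
    (hA : ∀ k k' t, A (k + k') t = A k t * A k' t) (h1 : ∀ i, Implements 1 (A (Pi.single i 1)))
    (k : Bits N) : Implements N (A k) := by
  have key : ∀ s : Finset (Fin N), Implements s.card (A (∑ i ∈ s, Pi.single i 1)) := by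
    intro s
    induction s using Finset.induction_on with
    | empty =>
      have e : A (∑ i ∈ (∅ : Finset (Fin N)), Pi.single i 1) = fun _ => 1 := funext fun t => by
        rw [Finset.sum_empty, h0]
      rw [e]; exact Implements.one
    | insert i s hi ih =>
      have e : A (∑ j ∈ insert i s, Pi.single j 1) =
          fun t => A (Pi.single i 1) t * A (∑ j ∈ s, Pi.single j 1) t := funext fun t => by
        rw [Finset.sum_insert hi, hA]
      rw [e, Finset.card_insert_of_notMem hi, add_comm]
      exact (h1 i).mul ih
  -- A bit string is the sum of the unit vectors over its support.
  have e : k = ∑ i ∈ Finset.univ.filter fun i => k i = 1, Pi.single i 1 := by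
    funext j
    rw [Finset.sum_filter, Finset.sum_apply]
    simp only [apply_ite (fun f : Bits N => f j), Pi.single_apply, Pi.zero_apply]
    rw [Finset.sum_eq_single j]
    · rcases zmod_two_cases (k j) with h | h <;> simp [h]
    · intro i _ hij
      simp [hij.symm]
    · simp
  rw [e]
  exact (key _).mono ((Finset.card_le_univ _).trans (by simp))

/-- The embedding selecting a single wire. -/
def oneWire (i : Fin N) : Fin 1 ↪ Fin N := ⟨fun _ => i, fun _ _ _ => Subsingleton.elim _ _⟩

theorem oneWire_apply (i : Fin N) (j : Fin 1) : oneWire i j = i := rfl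

/-- The embedding selecting two distinct wires. -/
def twoWires (i j : Fin N) (h : i ≠ j) : Fin 2 ↪ Fin N :=
  ⟨![i, j], by intro a b; fin_cases a <;> fin_cases b <;> simp [h, h.symm]⟩

theorem twoWires_zero (i j : Fin N) (h : i ≠ j) : twoWires i j h 0 = i := rfl

theorem twoWires_one (i j : Fin N) (h : i ≠ j) : twoWires i j h 1 = j := rfl

theorem extend_oneWire (i : Fin N) (z : Bits 1) (x : Bits N) :
    Function.extend (oneWire i) z x = Function.update x i (z 0) := by
  funext j
  by_cases h : j = i
  · subst h
    rw [Function.update_self]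
    exact (oneWire j).injective.extend_apply _ _ 0
  · rw [Function.update_of_ne h, Function.extend_apply']
    rintro ⟨_, rfl⟩
    exact h rfl

theorem shift_mem_unitaryGroup (p : Bits N) : shift p ∈ Matrix.unitaryGroup (Bits N) ℂ := by
  rw [Matrix.mem_unitaryGroup_iff', Matrix.star_eq_conjTranspose, shift_conjTranspose, shift_mul,
    bits_add_self, shift_zero]

theorem Implements.shift (p : Bits N) : Implements N fun _ => shift p := by
  refine Implements.of_single (fun k _ => CompiledQMA.shift k) (fun _ => shift_zero)
    (fun k k' _ => (shift_mul k k').symm) (fun i => ?_) p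
  have h := Implements.gate (⟨1, by norm_num, oneWire i,
    ⟨CompiledQMA.shift (fun _ => 1), shift_mem_unitaryGroup _⟩⟩ : Gate N)
  have e : CompiledQMA.shift (Pi.single i 1 : Bits N) =
      wireOp (oneWire i) (CompiledQMA.shift (fun _ => 1)) := by
    refine Matrix.ext_of_mulVec_single fun j => ?_
    funext x
    rw [wireOp_mulVec, shift_mulVec]
    have h2 := shift_mulVec (fun _ => 1 : Bits 1)
      (fun t => (Pi.single j 1 : Bits N → ℂ) (Function.extend (oneWire i) t x)) (x ∘ oneWire i)
    rw [Matrix.mulVec, dotProduct] at h2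
    rw [h2, extend_oneWire]
    congr 1
    funext l
    by_cases hl : l = i
    · subst hl; simp [oneWire_apply]
    · simp [hl]
  rw [e]; exact h

theorem diagonal_sgn_mem_unitaryGroup {ι : Type*} [Fintype ι] [DecidableEq ι] (f : ι → ZMod 2) :
    Matrix.diagonal (fun x => (sgn (f x) : ℂ)) ∈ Matrix.unitaryGroup ι ℂ := by
  rw [Matrix.mem_unitaryGroup_iff, Matrix.star_eq_conjTranspose, Matrix.diagonal_conjTranspose,
    Matrix.diagonal_mul_diagonal, ← Matrix.diagonal_one]
  congr 1
  funext x
  simp [← Complex.ofReal_mul, sgn_mul_self]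

/-- A gate with a diagonal `±1` matrix. -/
def signGate {k : ℕ} (hk : k ≤ 2) (w : Fin k ↪ Fin N) (f : Bits k → ZMod 2) : Gate N :=
  ⟨k, hk, w, ⟨_, diagonal_sgn_mem_unitaryGroup f⟩⟩

theorem signGate_toOp {k : ℕ} (hk : k ≤ 2) (w : Fin k ↪ Fin N) (f : Bits k → ZMod 2) :
    (signGate hk w f).toOp = wireOp w (Matrix.diagonal fun x => (sgn (f x) : ℂ)) := rfl

theorem signGate_mulVec {k : ℕ} (hk : k ≤ 2) (w : Fin k ↪ Fin N) (f : Bits k → ZMod 2)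
    (χ : Bits N → ℂ) (x : Bits N) :
    ((signGate hk w f).toOp *ᵥ χ) x = sgn (f (x ∘ w)) * χ x := by
  rw [signGate_toOp, wireOp_mulVec]
  simp only [Matrix.diagonal_apply, ite_mul, zero_mul, Finset.sum_ite_eq,
    Finset.mem_univ, if_true]
  congr 2
  funext i
  by_cases hi : ∃ j, w j = i
  · obtain ⟨j, rfl⟩ := hi
    rw [w.injective.extend_apply]; rfl
  · rw [Function.extend_apply' _ _ _ hi]

theorem phase_mulVec (k : Bits N) (φ : Bits N → ℂ) (x : Bits N) :
    (phase k *ᵥ φ) x = sgn (k ⬝ᵥ x) * φ x := by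
  rw [phase, Matrix.mulVec_diagonal]

theorem Implements.phase (k : Bits N) : Implements N fun _ => phase k := by
  refine Implements.of_single (fun k _ => CompiledQMA.phase k) (fun _ => phase_zero)
    (fun k k' _ => phase_add k k') (fun i => ?_) k
  have h := Implements.gate (signGate (by norm_num) (oneWire i) fun t => t 0)
  have e : CompiledQMA.phase (Pi.single i 1 : Bits N) =
      (signGate (by norm_num) (oneWire i) fun t => t 0).toOp := by
    refine Matrix.ext_of_mulVec_single fun j => ?_
    funext x
    rw [phase_mulVec, signGate_mulVec]
    simp [oneWire_apply]
  rw [e]; exact h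

/-- At a unit vector this is a controlled-Z between one wire and the last. No other controlled
operation is needed, so gates on two wires suffice. -/
theorem Implements.controlled_phase (k : Bits N) :
    Implements N fun t => CompiledQMA.phase (t • k) := by
  refine Implements.of_single (fun k t => CompiledQMA.phase (t • k))
    (fun t => by rw [smul_zero, phase_zero])
    (fun k k' t => by rw [smul_add, phase_add]) (fun i => ?_) k
  refine ⟨[signGate le_rfl (twoWires i.castSucc (Fin.last N) (Fin.castSucc_lt_last i).ne)
    fun t => t 0 * t 1], le_rfl, fun χ x t => ?_⟩
  rw [Circuit.toOp_singleton, signGate_mulVec, phase_mulVec, smul_dotProduct,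
    single_one_dotProduct, smul_eq_mul, Function.comp_apply, Function.comp_apply, twoWires_zero,
    twoWires_one, bsnoc_castSucc, bsnoc_last, mul_comm t]

/-! ### The Hadamard test -/

theorem sqrt_two_inv_mul_self : ((√2 : ℝ)⁻¹ : ℂ) * ((√2 : ℝ)⁻¹ : ℂ) = 2⁻¹ := by
  rw [← mul_inv, ← Complex.ofReal_mul, Real.mul_self_sqrt (by norm_num)]; norm_num

/-- The Hadamard matrix. -/
def hadamard : Matrix (Bits 1) (Bits 1) ℂ :=
  Matrix.of fun p t => ((√2 : ℝ)⁻¹ : ℂ) * sgn (p 0 * t 0)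

theorem hadamard_apply (p t : Bits 1) : hadamard p t = ((√2 : ℝ)⁻¹ : ℂ) * sgn (p 0 * t 0) := rfl

theorem sum_bits_one {E : Type*} [AddCommMonoid E] (f : Bits 1 → E) :
    ∑ t, f t = f (fun _ => 0) + f fun _ => 1 := by
  rw [← sum_zmod_two fun t => f fun _ => t, ← (Equiv.funUnique (Fin 1) (ZMod 2)).symm.sum_comp]
  rfl

theorem hadamard_mem_unitaryGroup : hadamard ∈ Matrix.unitaryGroup (Bits 1) ℂ := by
  rw [Matrix.mem_unitaryGroup_iff, Matrix.star_eq_conjTranspose]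
  ext p q
  rw [Matrix.mul_apply, sum_bits_one]
  have h0 : ∀ p : Bits 1, p = (fun _ => 0) ∨ p = fun _ => 1 := fun p => by
    rcases zmod_two_cases (p 0) with h | h
    · exact Or.inl (funext fun i => by rw [Subsingleton.elim i 0, h])
    · exact Or.inr (funext fun i => by rw [Subsingleton.elim i 0, h])
  have h1 : ((fun _ => 0 : Bits 1) = fun _ => 1) ↔ False := by
    simp [funext_iff]
  have h2 : ((fun _ => 1 : Bits 1) = fun _ => 0) ↔ False := by
    simp [funext_iff]
  have h3 := sqrt_two_inv_mul_self
  rcases h0 p with rfl | rfl <;> rcases h0 q with rfl | rfl <;>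
    simp [hadamard_apply, sgn_zero, sgn_one, h1, h2, h3] <;> norm_num

theorem exists_hadamard_gate (N : ℕ) : ∃ g : Gate (N + 1), ∀ (χ : Bits (N + 1) → ℂ) (x : Bits N)
    (p : ZMod 2), (g.toOp *ᵥ χ) (bsnoc x p) =
      ((√2 : ℝ)⁻¹ : ℂ) * (χ (bsnoc x 0) + sgn p * χ (bsnoc x 1)) := by
  refine ⟨⟨1, by norm_num, oneWire (Fin.last N), ⟨hadamard, hadamard_mem_unitaryGroup⟩⟩,
    fun χ x p => ?_⟩
  have h : ∀ t : ZMod 2, Function.update (bsnoc x p) (Fin.last N) t = bsnoc x t := fun t => by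
    funext i
    refine Fin.lastCases ?_ (fun i => ?_) i
    · rw [Function.update_self, bsnoc_last]
    · rw [Function.update_of_ne (Fin.castSucc_lt_last i).ne, bsnoc_castSucc, bsnoc_castSucc]
  rw [Gate.toOp_eq, wireOp_mulVec, sum_bits_one]
  simp only [hadamard_apply, extend_oneWire, h, Function.comp_apply, oneWire_apply, bsnoc_last,
    mul_zero, mul_one, sgn_zero, Complex.ofReal_one]
  ring

/-- A circuit moving the last wire to the first position. -/
theorem exists_swap_circuit (N : ℕ) : ∃ C : Circuit (N + 1), C.length ≤ 1 ∧
    ∀ χ : Bits (N + 1) → ℂ, ∑ x : Bits (N + 1), (if x 0 = 1 then ‖(C.toOp *ᵥ χ) x‖ ^ 2 else 0) =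
      ∑ y : Bits N, ‖χ (bsnoc y 1)‖ ^ 2 := by
  have key : ∀ χ : Bits (N + 1) → ℂ,
      ∑ x : Bits (N + 1), (if x (Fin.last N) = 1 then ‖χ x‖ ^ 2 else 0) =
        ∑ y : Bits N, ‖χ (bsnoc y 1)‖ ^ 2 := fun χ => by
    rw [sum_bsnoc]
    simp [bsnoc_last]
  rcases N with _ | N
  -- With no other wire, the last wire is already the first.
  · exact ⟨[], by simp, fun χ => by rw [← key]; simp [Circuit.toOp_nil]⟩
  · let w : Fin 2 ↪ Fin (N + 1 + 1) := twoWires 0 (Fin.last (N + 1)) Fin.last_pos.ne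
    let S : Matrix (Bits 2) (Bits 2) ℂ :=
      Matrix.of fun p t => if t = p ∘ Equiv.swap 0 1 then 1 else 0
    have hS : S ∈ Matrix.unitaryGroup (Bits 2) ℂ := by
      rw [Matrix.mem_unitaryGroup_iff, Matrix.star_eq_conjTranspose]
      ext p q
      rw [Matrix.mul_apply]
      simp only [S, Matrix.of_apply, Matrix.conjTranspose_apply, ite_mul, one_mul, zero_mul,
        Finset.sum_ite_eq', Finset.mem_univ, if_true, Matrix.one_apply]
      have h : (p ∘ Equiv.swap 0 1 = q ∘ Equiv.swap (0 : Fin 2) 1) ↔ p = q :=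
        (Equiv.swap (0 : Fin 2) 1).surjective.injective_comp_right.eq_iff
      simp only [h]
      split_ifs <;> simp
    let σ : Equiv.Perm (Fin (N + 1 + 1)) := Equiv.swap 0 (Fin.last (N + 1))
    refine ⟨[⟨2, le_rfl, w, ⟨S, hS⟩⟩], le_rfl, fun χ => ?_⟩
    rw [← key, ← (Equiv.arrowCongr σ (Equiv.refl (ZMod 2))).sum_comp]
    refine Finset.sum_congr rfl fun x _ => ?_
    have h0 : Equiv.arrowCongr σ (Equiv.refl (ZMod 2)) x = x ∘ σ := by
      funext i; simp [Equiv.arrowCongr, σ, Equiv.symm_swap]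
    have h1 : (x ∘ σ) 0 = x (Fin.last (N + 1)) := by simp [σ]
    rw [h0, h1, Circuit.toOp_singleton, Gate.toOp_eq, wireOp_mulVec]
    simp only [S, Matrix.of_apply, ite_mul, one_mul, zero_mul, Finset.sum_ite_eq',
      Finset.mem_univ, if_true]
    have h2 : Function.extend w (((x ∘ σ) ∘ w) ∘ Equiv.swap 0 1) (x ∘ σ) = x := by
      funext i
      by_cases hi : ∃ j, w j = i
      · obtain ⟨j, rfl⟩ := hi
        rw [w.injective.extend_apply]
        fin_cases j <;> simp [w, σ, twoWires_zero, twoWires_one]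
      · rw [Function.extend_apply' _ _ _ hi]
        have hi0 : i ≠ 0 := fun h => hi ⟨0, h.symm⟩
        have hi1 : i ≠ Fin.last (N + 1) := fun h => hi ⟨1, h.symm⟩
        simp [σ, Equiv.swap_apply_of_ne_of_ne hi0 hi1]
    rw [h2]

end Controlled

/-! ### Distinguishers estimating products of observables -/

theorem nsq_pureState {ι κ : Type*} [Fintype ι] [Fintype κ] [DecidableEq κ] (φ : κ → ℂ)
    (A : Matrix ι κ ℂ) : nsq (pureState φ) A = ∑ y, ‖(A *ᵥ φ) y‖ ^ 2 := by
  have h : (Aᴴ * A * pureState φ).trace = star (A *ᵥ φ) ⬝ᵥ (A *ᵥ φ) := by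
    rw [pureState, Matrix.mul_vecMulVec, Matrix.trace_vecMulVec, ← Matrix.mulVec_mulVec,
      Matrix.star_mulVec, dotProduct_comm, Matrix.dotProduct_mulVec]
  rw [nsq, ip_apply, h, dotProduct, Complex.re_sum]
  refine Finset.sum_congr rfl fun y _ => ?_
  rw [Pi.star_apply, Complex.star_def, mul_comm, Complex.mul_conj, Complex.ofReal_re,
    Complex.normSq_eq_norm_sq]

theorem mul_pureState_mul {ι κ : Type*} [Fintype ι] [Fintype κ] (A : Matrix ι κ ℂ) (φ : κ → ℂ) :
    A * pureState φ * Aᴴ = pureState (A *ᵥ φ) := by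
  rw [pureState, pureState, Matrix.mul_vecMulVec, Matrix.vecMulVec_mul, Matrix.star_mulVec]

/-- Measuring the first `r` wires amounts to applying random phases to them. -/
theorem sum_outProj_conj {N r : ℕ} (σ : Op N) :
    ∑ α : Bits r, outProj N α * σ * outProj N α =
      avg fun k : Bits r => phase (place N 0 k) * σ * phase (place N 0 k) := by
  ext x y
  rw [avg_eq, Matrix.sum_apply, Matrix.smul_apply, Matrix.sum_apply]
  simp only [outProj, phase, Matrix.diagonal_mul, Matrix.mul_diagonal, ← dotProduct_readBits]
  -- Each matrix entry is multiplied by the character of the sum of the two read strings. Its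
  -- average over `k` keeps exactly the entries whose read strings agree.
  have h : ∀ k : Bits r, (sgn (k ⬝ᵥ readBits r x) : ℂ) * σ x y * (sgn (k ⬝ᵥ readBits r y) : ℂ) =
      (sgn (k ⬝ᵥ (readBits r x + readBits r y)) : ℝ) * σ x y := fun k => by
    rw [dotProduct_add, sgn_add]; push_cast; ring
  simp only [h, ← Finset.sum_mul, ← Complex.ofReal_sum, sum_sgn_dotProduct, bits_add_eq_zero]
  by_cases hxy : readBits r x = readBits r y
  · simp [hxy, ZMod.card]
  · simp only [hxy, if_false, Complex.ofReal_zero, zero_mul, smul_zero]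
    refine Finset.sum_eq_zero fun α _ => ?_
    by_cases h1 : readBits r x = α
    · have h2 : readBits r y ≠ α := fun h2 => hxy (h1.trans h2.symm)
      simp [h2]
    · simp [h1]

/-! ### Products of Bob's observables -/

section Word

variable (T : ProtocolData) (P : Prover)

/-- A question to Bob together with a parity of his answer bits. -/
abbrev Letter : Type := Σ y : T.BQ, Bits y.ansLen

instance : Finite T.AQ := Finite.of_injective _ T.aliceCode.injective

instance : Finite T.BQ := Finite.of_injective _ T.bobCode.injective

instance : Nonempty T.AQ := ⟨.tele⟩

instance : Nonempty (Letter T) := ⟨⟨.pure .Z, 0⟩⟩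

/-- The product of the observables of a list of letters. -/
def word (L : List (Letter T)) : Op P.N := (L.map fun l => P.obs (T.bobCode l.1) l.2).prod

theorem word_isometry (L : List (Letter T)) : (word T P L)ᴴ * word T P L = 1 := by
  induction L with
  | nil => simp [word]
  | cons l L ih =>
    rw [word, List.map_cons, List.prod_cons, ← word, Matrix.conjTranspose_mul, mul_assoc,
      ← mul_assoc _ (P.obs _ _), P.obs_isometry, one_mul, ih]

theorem word_append (L L' : List (Letter T)) :
    word T P (L ++ L') = word T P L * word T P L' := by
  simp [word]

/-- Observables are self-adjoint, so U†V is again a word whenever U and V are. -/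
theorem word_reverse (L : List (Letter T)) : word T P L.reverse = (word T P L)ᴴ := by
  induction L with
  | nil => simp [word]
  | cons l L ih =>
    rw [List.reverse_cons, word_append, ih, ← List.singleton_append (l := L), word_append,
      Matrix.conjTranspose_mul]
    simp [word, P.obs_conjTranspose]

theorem implements_bobU {m : ℕ} (y : Bits m) :
    Implements (P.circuit₂.length + P.N) fun _ => P.bobU y :=
  (Implements.circuit _).mul (Implements.shift _)

theorem implements_bobU_conjTranspose {m : ℕ} (y : Bits m) :
    Implements (P.N + P.circuit₂.length) fun _ => (P.bobU y)ᴴ := by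
  simp only [Prover.bobU, Matrix.conjTranspose_mul, writeOp_eq_shift, shift_conjTranspose]
  exact (Implements.shift _).mul (Implements.circuit_conjTranspose _)

/-- Only the phase in the middle of each observable is controlled: with control 0 the surrounding
unitaries cancel. Controlling arbitrary two-wire gates would need a third wire. -/
theorem implements_word (L : List (Letter T)) :
    Implements (L.length * (3 * P.N + 2 * P.circuit₂.length))
      fun t => if t = 0 then 1 else word T P L := by
  induction L with
  | nil => simpa [word] using Implements.one
  | cons l L ih =>
    have h := (((implements_bobU_conjTranspose P (T.bobCode l.1)).mul
      (Implements.controlled_phase (place P.N 0 l.2))).mul (implements_bobU P (T.bobCode l.1))).mul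
        ih
    have e : (fun t : ZMod 2 => if t = 0 then 1 else word T P (l :: L)) = fun t : ZMod 2 =>
        (P.bobU (T.bobCode l.1))ᴴ * phase (t • place P.N 0 l.2) * P.bobU (T.bobCode l.1) *
          if t = 0 then 1 else word T P L := by
      funext t
      rcases zmod_two_cases t with rfl | rfl
      · simp [phase_zero, P.bobU_isometry]
      · simp [word, Prover.obs]
    rw [e]
    exact h.mono (by rw [List.length_cons]; ring_nf; omega)

/-- The state after Alice's circuit, with phases `k` applied instead of her measurement. -/
def Prover.phasedState {m r : ℕ} (k : Bits r) (c : Bits m) : Bits P.N → ℂ :=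
  (phase (place P.N 0 k) * P.circuit₁.toOp * writeOp P.N 0 c) *ᵥ P.ψ

/-- Alice's measurement becomes a mixture of unitary evolutions, so a distinguisher with `k` built
in needs no measurement before its last step. -/
theorem sum_postState {m : ℕ} (c : Bits m) :
    ∑ α, P.postState c α = avg fun k : Bits P.replyLen => pureState (P.phasedState k c) := by
  have h := sum_outProj_conj (r := P.replyLen)
    (pureState ((P.circuit₁.toOp * writeOp P.N 0 c) *ᵥ P.ψ))
  have e1 : ∀ α, P.postState c α = outProj P.N α *
      pureState ((P.circuit₁.toOp * writeOp P.N 0 c) *ᵥ P.ψ) * outProj P.N α := fun α => by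
    rw [← mul_pureState_mul, Prover.postState, Prover.alice]
    simp only [Matrix.conjTranspose_mul, outProj_conjTranspose, mul_assoc]
  have e2 : ∀ k : Bits P.replyLen, pureState (P.phasedState k c) = phase (place P.N 0 k) *
      pureState ((P.circuit₁.toOp * writeOp P.N 0 c) *ᵥ P.ψ) * phase (place P.N 0 k) := fun k => by
    rw [← mul_pureState_mul, Prover.phasedState, ← mul_pureState_mul]
    simp only [Matrix.conjTranspose_mul, phase_conjTranspose, mul_assoc]
  simp only [e1, e2]
  exact h

theorem trace_pureState_phasedState {m r : ℕ} (k : Bits r) (c : Bits m) :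
    (pureState (P.phasedState k c)).trace = 1 := by
  have hU : (phase (place P.N 0 k) * P.circuit₁.toOp * writeOp P.N 0 c)ᴴ *
      (phase (place P.N 0 k) * P.circuit₁.toOp * writeOp P.N 0 c) = 1 := by
    simp only [Matrix.conjTranspose_mul, phase_conjTranspose, mul_assoc]
    rw [← mul_assoc (phase _) (phase _), phase_mul_self, one_mul, ← mul_assoc _ (Circuit.toOp _),
      Circuit.toOp_isometry, one_mul, writeOp_isometry]
  rw [Prover.phasedState, ← mul_pureState_mul, Matrix.trace_mul_comm, ← mul_assoc, hU, one_mul,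
    pureState, Matrix.trace_vecMulVec, dotProduct_comm, P.ψ_norm]

theorem place_bsnoc {N m : ℕ} (c : Bits m) :
    ∃ s : ZMod 2, place (N + 1) 0 c = bsnoc (place N 0 c) s := by
  refine ⟨place (N + 1) 0 c (Fin.last N), ?_⟩
  funext i
  refine Fin.lastCases ?_ (fun i => ?_) i
  · rw [bsnoc_last]
  · rw [bsnoc_castSucc]; rfl

theorem bsnoc_add {N : ℕ} (x y : Bits N) (s t : ZMod 2) :
    bsnoc x s + bsnoc y t = bsnoc (x + y) (s + t) := by
  funext i
  refine Fin.lastCases ?_ (fun i => ?_) i <;> simp [bsnoc_last, bsnoc_castSucc]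

/-- The Hadamard test for a product of Bob's observables. -/
theorem exists_distinguisher (L : List (Letter T)) {r : ℕ} (k : Bits r) :
    ∃ A : Distinguisher, A.N = P.N + 1 ∧
      A.circuit.length ≤ L.length * (3 * P.N + 2 * P.circuit₂.length) +
        (P.N + P.circuit₁.length) + 2 ∧
      ∀ {m : ℕ} (c : Bits m),
        A.outProb c = (1 - ev (pureState (P.phasedState k c)) (word T P L)) / 2 := by
  obtain ⟨C, hC, hC'⟩ := (implements_word T P L).mul
    ((Implements.phase (place P.N 0 k)).mul (Implements.circuit P.circuit₁))
  obtain ⟨g, hg⟩ := exists_hadamard_gate P.N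
  obtain ⟨S, hS, hS'⟩ := exists_swap_circuit P.N
  -- The advice is `P.ψ` together with a control wire already in the state |+⟩.
  let χ : Bits (P.N + 1) → ℂ := fun x => ((√2 : ℝ)⁻¹ : ℂ) * P.ψ fun i => x i.castSucc
  have hχ : ∀ x t, χ (bsnoc x t) = ((√2 : ℝ)⁻¹ : ℂ) * P.ψ x := fun x t => by
    simp only [χ, bsnoc_castSucc]
  have hnorm : star χ ⬝ᵥ χ = 1 := by
    have e : ∀ y : Bits P.N, star (((√2 : ℝ)⁻¹ : ℂ) * P.ψ y) * (((√2 : ℝ)⁻¹ : ℂ) * P.ψ y) =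
        2⁻¹ * (star (P.ψ y) * P.ψ y) := fun y => by
      have h := sqrt_two_inv_mul_self
      rw [star_mul', Complex.star_def, map_inv₀, Complex.conj_ofReal]
      linear_combination ((starRingEnd ℂ) (P.ψ y) * P.ψ y) * h
    rw [← P.ψ_norm, dotProduct, sum_bsnoc]
    simp only [Pi.star_apply, hχ, sum_zmod_two, e, dotProduct]
    refine Finset.sum_congr rfl fun y _ => ?_
    ring
  refine ⟨⟨P.N + 1, χ, hnorm, C ++ [g] ++ S⟩, rfl, ?_, fun {m} c => ?_⟩
  · simp only [List.length_append, List.length_singleton]; omega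
  · set φ := P.phasedState k c with hφ
    have hw : ∀ x t, (writeOp (P.N + 1) 0 c *ᵥ χ) (bsnoc x t) =
        ((√2 : ℝ)⁻¹ : ℂ) * (writeOp P.N 0 c *ᵥ P.ψ) x := fun x t => by
      -- A ciphertext longer than the prover's register may spill onto the control wire. This is
      -- harmless because |+⟩ is invariant under a bit flip.
      obtain ⟨s, hs⟩ := place_bsnoc (N := P.N) c
      rw [writeOp_eq_shift, writeOp_eq_shift, shift_mulVec, shift_mulVec, hs, bsnoc_add, hχ]
    have h1 : ∀ x t, (C.toOp *ᵥ writeOp (P.N + 1) 0 c *ᵥ χ) (bsnoc x t) =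
        ((√2 : ℝ)⁻¹ : ℂ) * (((if t = 0 then 1 else word T P L) : Op P.N) *ᵥ φ) x := fun x t => by
      rw [hC']
      simp only [hw]
      have e : (fun y => ((√2 : ℝ)⁻¹ : ℂ) * (writeOp P.N 0 c *ᵥ P.ψ) y) =
          ((√2 : ℝ)⁻¹ : ℂ) • (writeOp P.N 0 c *ᵥ P.ψ) := rfl
      rw [e, Matrix.mulVec_smul, Pi.smul_apply, smul_eq_mul, Matrix.mulVec_mulVec, mul_assoc, hφ,
        Prover.phasedState, Matrix.mulVec_mulVec]
    have h2 : ∀ (χ' : Bits (P.N + 1) → ℂ),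
        (outProj (P.N + 1) (fun _ : Fin 1 => (1 : ZMod 2)) * pureState χ').trace.re =
          ∑ x : Bits (P.N + 1), if x 0 = 1 then ‖χ' x‖ ^ 2 else 0 := fun χ' => by
      have e : nsq (pureState χ') (outProj (P.N + 1) (fun _ : Fin 1 => (1 : ZMod 2))) =
          (outProj (P.N + 1) (fun _ : Fin 1 => (1 : ZMod 2)) * pureState χ').trace.re := by
        rw [nsq, ip_apply, outProj_conjTranspose, outProj_mul, if_pos rfl]
      rw [← e, nsq_pureState]
      refine Finset.sum_congr rfl fun x _ => ?_
      have h : readBits 1 x = (fun _ : Fin 1 => (1 : ZMod 2)) ↔ x 0 = 1 := by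
        simp [funext_iff, readBits]
      rw [outProj, Matrix.mulVec_diagonal]
      simp only [h]
      split_ifs <;> simp
    -- After the Hadamard gate the branch with control 1 is (1 - W)φ/2, whose squared norm is (1 -
    -- Re⟨W⟩)/2.
    have h3 : ∀ y, (g.toOp *ᵥ C.toOp *ᵥ writeOp (P.N + 1) 0 c *ᵥ χ) (bsnoc y 1) =
        2⁻¹ * ((1 - word T P L) *ᵥ φ) y := fun y => by
      rw [hg, h1, h1, if_pos rfl, if_neg one_ne_zero, sgn_one, Matrix.sub_mulVec, Pi.sub_apply]
      push_cast
      linear_combination ((1 *ᵥ φ) y - (word T P L *ᵥ φ) y) * sqrt_two_inv_mul_self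
    rw [Distinguisher.outProb]
    simp only [Circuit.toOp_append, Circuit.toOp_singleton, ← Matrix.mulVec_mulVec, h2, hS', h3,
      norm_mul, mul_pow, ← Finset.mul_sum, ← nsq_pureState]
    rw [nsq_sub (pureState_posSemidef _), nsq_isometry (word_isometry T P L),
      nsq_isometry (by simp), hφ, trace_pureState_phasedState, ← ev]
    norm_num
    ring

/-! ### Computational indistinguishability of Alice's questions -/

theorem PolyBounded.add {f g : ℕ → ℕ} (hf : PolyBounded f) (hg : PolyBounded g) :
    PolyBounded fun κ => f κ + g κ := by
  obtain ⟨p, hp⟩ := hf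
  obtain ⟨q, hq⟩ := hg
  exact ⟨p + q, fun κ => by rw [Polynomial.eval_add]; exact add_le_add (hp κ) (hq κ)⟩

theorem PolyBounded.const_mul {f : ℕ → ℕ} (hf : PolyBounded f) (c : ℕ) :
    PolyBounded fun κ => c * f κ := by
  obtain ⟨p, hp⟩ := hf
  exact ⟨Polynomial.C c * p, fun κ => by
    rw [Polynomial.eval_mul, Polynomial.eval_C]; exact Nat.mul_le_mul_left c (hp κ)⟩

theorem PolyBounded.const (c : ℕ) : PolyBounded fun _ => c := ⟨Polynomial.C c, by simp⟩

theorem PolyBounded.mono {f g : ℕ → ℕ} (hg : PolyBounded g) (h : ∀ κ, f κ ≤ g κ) :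
    PolyBounded f := by
  obtain ⟨p, hp⟩ := hg
  exact ⟨p, fun κ => (h κ).trans (hp κ)⟩

theorem ev_encState_eq (E : EncScheme) (κ : ℕ) (x : T.AQ) (L : List (Letter T))
    (A : Bits P.replyLen → Distinguisher) (hA : ∀ k {m : ℕ} (c : Bits m),
      (A k).outProb c = (1 - ev (pureState (P.phasedState k c)) (word T P L)) / 2) :
    ev (encState E κ T P x) (word T P L) = avg fun k : Bits P.replyLen =>
      1 - 2 * expect (E.gen κ) fun sk => expect (E.enc κ sk (T.aliceCode x)) fun c =>
        (A k).outProb c := by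
  have h1 : ∀ k {m : ℕ} (c : Bits m), (A k).outProb c =
      1 / 2 - 1 / 2 * evState (word T P L) (pureState (P.phasedState k c)) := fun k m c => by
    rw [hA, evState_apply]; ring
  simp only [h1, expect_sub, expect_const, expect_mul_left]
  rw [← evState_apply, encState]
  simp only [sum_postState, map_expect, map_avg]
  have h2 : ∀ r : ℝ, 1 - 2 * (1 / 2 - 1 / 2 * r) = r := fun r => by ring
  simp only [h2, avg, expect_comm (PMF.uniformOfFintype _)]

/-- Words of length `m`, phase strings and pairs of questions form a finite set for each `κ`. The
worst choice is built into one nonuniform family of distinguishers, so a single `η` serves them all.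
-/
theorem exists_negligible_word (E : EncScheme) (T : ℕ → ProtocolData) (P : ℕ → Prover)
    (hE : E.Secure) (hT : PolyBounded fun κ => (T κ).aliceLen) (hP : EfficientProver P) (m : ℕ) :
    ∃ η : ℕ → ℝ, Negligible η ∧ (∀ κ, 0 ≤ η κ) ∧
      ∀ κ (L : List (Letter (T κ))), L.length = m → ∀ x x',
        ev (encState E κ (T κ) (P κ) x) (word (T κ) (P κ) L) ≤
          ev (encState E κ (T κ) (P κ) x') (word (T κ) (P κ) L) + η κ := by
  choose A hN hlen hprob using fun κ L (k : Bits (P κ).replyLen) =>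
    exists_distinguisher (T κ) (P κ) L k
  let G : ∀ κ, List (Letter (T κ)) → Bits (P κ).replyLen → (T κ).AQ → ℝ := fun κ L k x =>
    expect (E.gen κ) fun sk => expect (E.enc κ sk ((T κ).aliceCode x)) fun c => (A κ L k).outProb c
  have hmax := fun κ => Finite.exists_max
    fun p : (Fin m → Letter (T κ)) × Bits (P κ).replyLen × (T κ).AQ × (T κ).AQ =>
      |G κ (List.ofFn p.1) p.2.1 p.2.2.1 - G κ (List.ofFn p.1) p.2.1 p.2.2.2|
  choose p hp using hmax
  obtain ⟨hP1, hP2, hP3, hP4⟩ := hP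
  -- The factor 2 appears because the expectation is one minus twice the output probability.
  refine ⟨fun κ => |G κ (List.ofFn (p κ).1) (p κ).2.1 (p κ).2.2.1 -
    G κ (List.ofFn (p κ).1) (p κ).2.1 (p κ).2.2.2| * 2, ?_, fun κ => by positivity, ?_⟩
  · refine Asymptotics.SuperpolynomialDecay.mul_const ?_ 2
    refine hE (fun κ => (T κ).aliceLen) (fun κ => (T κ).aliceCode (p κ).2.2.1)
      (fun κ => (T κ).aliceCode (p κ).2.2.2)
      (fun κ => A κ (List.ofFn (p κ).1) (p κ).2.1) hT ?_ ?_
    · simp only [hN]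
      exact hP1.add (PolyBounded.const 1)
    · refine PolyBounded.mono ?_ fun κ => hlen κ _ _
      simp only [List.length_ofFn]
      exact ((((hP1.const_mul 3).add (hP4.const_mul 2)).const_mul m).add (hP1.add hP3)).add
        (PolyBounded.const 2)
  · intro κ L hL x x'
    obtain rfl := hL.symm
    beta_reduce
    rw [ev_encState_eq _ _ _ _ x L (A κ L) (hprob κ L), ev_encState_eq _ _ _ _ x' L (A κ L)
      (hprob κ L), ← sub_le_iff_le_add', ← avg_sub, ← avg_const (α := Bits (P κ).replyLen) (_ * _)]
    refine avg_mono fun k => ?_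
    have h := hp κ (L.get, k, x', x)
    simp only [List.ofFn_get] at h
    have h' := (le_abs_self _).trans h
    simp only [G] at h' ⊢
    linarith

/-- Alice's questions are indistinguishable, up to `η`, by products of at most eight of Bob's
observables. -/
def Indist (E : EncScheme) (κ : ℕ) (T : ProtocolData) (P : Prover) (η : ℝ) : Prop :=
  ∀ L : List (Letter T), L.length ≤ 8 → ∀ x x',
    ev (encState E κ T P x) (word T P L) ≤ ev (encState E κ T P x') (word T P L) + η

theorem exists_negligible_indist (E : EncScheme) (T : ℕ → ProtocolData) (P : ℕ → Prover)
    (hE : E.Secure) (hT : PolyBounded fun κ => (T κ).aliceLen) (hP : EfficientProver P) :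
    ∃ η : ℕ → ℝ, Negligible η ∧ (∀ κ, 0 ≤ η κ) ∧ ∀ κ, Indist E κ (T κ) (P κ) (η κ) := by
  choose η h1 h2 h3 using exists_negligible_word E T P hE hT hP
  -- One negligible function for each length from 0 to 8.
  refine ⟨fun κ => ∑ m ∈ Finset.range 9, η m κ, ?_, fun κ => Finset.sum_nonneg fun m _ => h2 m κ,
    fun κ L hL x x' => (h3 L.length κ L rfl x x').trans ?_⟩
  · have key : ∀ s : Finset ℕ, Negligible fun κ => ∑ m ∈ s, η m κ := fun s => by
      induction s using Finset.induction_on with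
      | empty => intro n; simp
      | insert m s hm ih =>
        simp only [Finset.sum_insert hm]
        exact Asymptotics.SuperpolynomialDecay.add (h1 m) ih
    exact key _
  · gcongr
    exact Finset.single_le_sum (f := fun m => η m κ) (fun m _ => h2 m κ)
      (Finset.mem_range.mpr (by omega))

variable {T P}

/-- For isometries U and V the squared seminorm of U ∓ V is 2 ∓ 2 Re⟨U†V⟩, and U†V is a word. Either
sign can occur, so indistinguishability is used in both directions. -/
theorem Indist.nsq_le {E : EncScheme} {κ : ℕ} {η : ℝ} (h : Indist E κ T P η)
    (L L' : List (Letter T)) (s : ZMod 2) (hL : L.length + L'.length ≤ 8) (x x' : T.AQ) :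
    nsq (encState E κ T P x) (word T P L - sgn s • word T P L') ≤
      nsq (encState E κ T P x') (word T P L - sgn s • word T P L') + 2 * η := by
  have e : ∀ x, nsq (encState E κ T P x) (word T P L - sgn s • word T P L') =
      2 - 2 * sgn s * ev (encState E κ T P x) (word T P (L.reverse ++ L')) := fun x => by
    rw [nsq_sub (encState_posSemidef E κ T P x), nsq_sgn_smul, nsq_isometry (word_isometry T P L),
      nsq_isometry (word_isometry T P L'), trace_encState, map_smul, ip_eq_ev, word_append,
      word_reverse, Complex.one_re, smul_eq_mul]
    ring
  have hl : (L.reverse ++ L').length ≤ 8 := by simpa using hL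
  have h1 := h _ hl x x'
  have h2 := h _ hl x' x
  rw [e, e]
  rcases zmod_two_cases s with rfl | rfl
  · rw [sgn_zero]; linarith
  · rw [sgn_one]; linarith

end Word

/-! ### Calculus of Bob's observables -/

section Calculus

variable {E : EncScheme} {κ : ℕ} {T : ProtocolData} {P : Prover} {η : ℝ}

/-- The observable of a letter. -/
def Prover.op (P : Prover) {T : ProtocolData} (l : Letter T) : Op P.N := P.obs (T.bobCode l.1) l.2

theorem Prover.op_isometry (l : Letter T) : (P.op l)ᴴ * P.op l = 1 := P.obs_isometry _ _

theorem Prover.op_mul_self (l : Letter T) : P.op l * P.op l = 1 := P.obs_mul_self _ _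

theorem Prover.op_mul_isometry (l : Letter T) {A : Op P.N} (hA : Aᴴ * A = 1) :
    (P.op l * A)ᴴ * (P.op l * A) = 1 := by
  rw [Matrix.conjTranspose_mul, mul_assoc, ← mul_assoc _ (P.op l), op_isometry, one_mul, hA]

theorem word_one (l : Letter T) : word T P [l] = P.op l := by simp [word, Prover.op]

theorem word_two (l l' : Letter T) : word T P [l, l'] = P.op l * P.op l' := by
  simp [word, Prover.op]

theorem sgn_smul_isometry {ι κ : Type*} [Fintype ι] [DecidableEq κ] {U : Matrix ι κ ℂ}
    (hU : Uᴴ * U = 1) (s : ZMod 2) : (sgn s • U)ᴴ * (sgn s • U) = 1 := by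
  rw [Matrix.conjTranspose_smul, star_trivial, Matrix.smul_mul, Matrix.mul_smul, smul_smul,
    sgn_mul_self, one_smul, hU]

/-- The letter `l` is nearly deterministic, with value `g`, given the decrypted answer to `x`. -/
def Consistent (E : EncScheme) (κ : ℕ) (T : ProtocolData) (P : Prover) (x : T.AQ) (l : Letter T)
    (g : Bits x.ansLen → ZMod 2) (ε : ℝ) : Prop :=
  ∑ a, nsq (decState E κ T P x a) (P.op l - sgn (g a) • 1) ≤ ε

/-- At the question `x₀` the new factor is nearly a sign, so the relation survives right
multiplication there. The longer relation is then transferred to `x`. The extra 2 in the length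
bound counts the letter once on each side. -/
theorem Indist.mul_right (h : Indist E κ T P η) (L L' : List (Letter T)) (l : Letter T)
    (s : ZMod 2) (hL : L.length + L'.length + 2 ≤ 8) {x₀ : T.AQ} {g : Bits x₀.ansLen → ZMod 2}
    {ε ε₀ : ℝ} (h₀ : Consistent E κ T P x₀ l g ε₀)
    (hε : nsq (encState E κ T P x₀) (word T P L - sgn s • word T P L') ≤ ε) (x : T.AQ) :
    nsq (encState E κ T P x) ((word T P L - sgn s • word T P L') * P.op l) ≤
      2 * ε + 8 * ε₀ + 2 * η := by
  have h1 := h.nsq_le (L ++ [l]) (L' ++ [l]) s (by simp; omega) x x₀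
  have e : word T P (L ++ [l]) - sgn s • word T P (L' ++ [l]) =
      (word T P L - sgn s • word T P L') * P.op l := by
    rw [word_append, word_append, word_one, sub_mul, smul_mul_assoc]
  rw [e] at h1
  have h2 := nsq_mul_right_le (decState_posSemidef E κ T P x₀) (O := P.op l)
    (word_isometry T P L) (sgn_smul_isometry (word_isometry T P L') s) g
  rw [← encState_eq_sum] at h2
  unfold Consistent at h₀
  linarith

/-- Combining two approximate relations `p = ± q r` and `l = ± r t` into `p l = ± q t`. -/
theorem Indist.mul_of_consistent (h : Indist E κ T P η) {p q r l t : Letter T} {i j : ZMod 2}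
    {ε ε₀ : ℝ}
    {x₀ : T.AQ} {g : Bits x₀.ansLen → ZMod 2} (h₀ : Consistent E κ T P x₀ l g ε₀)
    (h1 : ∀ x, nsq (encState E κ T P x) (P.op p - sgn i • (P.op q * P.op r)) ≤ ε)
    (h2 : ∀ x, nsq (encState E κ T P x) (P.op l - sgn j • (P.op r * P.op t)) ≤ ε) (x : T.AQ) :
    nsq (encState E κ T P x) (P.op p * P.op l - sgn (i + j) • (P.op q * P.op t)) ≤
      6 * ε + 16 * ε₀ + 4 * η := by
  have h3 := h.mul_right [p] [q, r] l i (by simp) h₀ (ε := ε) (by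
    rw [word_one, word_two]; exact h1 x₀) x
  rw [word_one, word_two] at h3
  have e : P.op p * P.op l - sgn (i + j) • (P.op q * P.op t) =
      (P.op p - sgn i • (P.op q * P.op r)) * P.op l +
        sgn i • ((P.op q * P.op r) * (P.op l - sgn j • (P.op r * P.op t))) := by
    have e2 : P.op q * P.op r * (P.op r * P.op t) = P.op q * P.op t := by
      rw [mul_assoc, ← mul_assoc (P.op r), P.op_mul_self, one_mul]
    rw [mul_sub, mul_smul_comm, e2, sub_mul, smul_sub, smul_smul, sgn_add, smul_mul_assoc]
    abel
  rw [e]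
  refine (nsq_add_le (encState_posSemidef E κ T P x) _ _).trans ?_
  rw [nsq_sgn_smul, nsq_isometry_mul (P.op_mul_isometry q (P.op_isometry r))]
  have := h2 x
  linarith

end Calculus

/-! ### The magic square -/

section Square

variable {E : EncScheme} {κ : ℕ} {T : ProtocolData} {P : Prover} {η : ℝ}

/-- The letter for a parity of the outcomes in a pure basis. -/
def pureLetter (T : ProtocolData) (W : PureBasis) (a : Bits T.n) : Letter T := ⟨.pure W, a⟩

/-- The letter asked for a cell of the magic square. -/
def cellLetter (a b : T.S) (row col : Fin 3) : Letter T :=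
  if row = 0 ∧ col = 1 then pureLetter T .Z a
  else if row = 1 ∧ col = 0 then pureLetter T .X b
  else ⟨.cell a b row col, fun _ => 1⟩

/-- The `k`-th cell of a line. -/
def lineLetter (a b : T.S) (isCol : Bool) (line k : Fin 3) : Letter T :=
  if isCol then cellLetter a b k line else cellLetter a b line k

/-- Brings the three kinds of question to Bob into one form, in which a parity of his answer is
compared with Alice's bit. -/
theorem squareSuccess_spec (a b : T.S) (row col : Fin 3) (isCol : Bool) :
    ∃ acc : Bits 3 → Bits (cellLetter a b row col).1.ansLen → Prop,
      squareSuccess E κ T P a b row col isCol =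
        acceptProb E κ T P (.ms a b isCol (if isCol then col else row))
          (cellLetter a b row col).1 acc ∧
      ∀ u v, acc u v → squareOk isCol u ∧
        (cellLetter a b row col).2 ⬝ᵥ v = u (if isCol then row else col) := by
  by_cases h1 : row = 0 ∧ col = 1
  · have hc : cellLetter a b row col = pureLetter T .Z a := if_pos h1
    rw [hc]
    exact ⟨_, if_pos h1, fun u v h => h⟩
  · by_cases h2 : row = 1 ∧ col = 0
    · have hc : cellLetter a b row col = pureLetter T .X b := (if_neg h1).trans (if_pos h2)
      rw [hc]
      exact ⟨_, (if_neg h1).trans (if_pos h2), fun u v h => h⟩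
    · have hc : cellLetter a b row col = ⟨.cell a b row col, fun _ => 1⟩ :=
        (if_neg h1).trans (if_neg h2)
      rw [hc]
      refine ⟨_, (if_neg h1).trans (if_neg h2), fun u v h => ⟨h.1, ?_⟩⟩
      refine Eq.trans ?_ h.2
      exact (Fin.sum_univ_one _).trans (one_mul _)

/-- There are 18 = 3 · 3 · 2 equally likely choices of cell and line. -/
theorem one_sub_squareSuccess_le (a b : T.S) (row col : Fin 3) (isCol : Bool) :
    1 - squareSuccess E κ T P a b row col isCol ≤ 18 * (1 - antiSuccess E κ T P a b) := by
  have h0 : ∀ row col isCol, 0 ≤ 1 - squareSuccess E κ T P a b row col isCol := fun r c i => by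
    obtain ⟨acc, h, -⟩ := squareSuccess_spec (E := E) (κ := κ) (P := P) a b r c i
    rw [h, sub_nonneg]; exact acceptProb_le_one ..
  have e : 1 - antiSuccess E κ T P a b = avg fun row : Fin 3 => avg fun col : Fin 3 =>
      avg fun isCol : Bool => (1 - squareSuccess E κ T P a b row col isCol) := by
    simp only [avg_sub, avg_const, antiSuccess]
  have h1 := le_card_mul_avg (fun r => avg_nonneg fun c => avg_nonneg fun i => h0 r c i) row
  have h2 := le_card_mul_avg (fun c => avg_nonneg fun i => h0 row c i) col
  have h3 := le_card_mul_avg (fun i => h0 row col i) isCol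
  simp only [Fintype.card_fin, Fintype.card_bool, Nat.cast_ofNat] at h1 h2 h3
  rw [e]
  linarith

theorem lineLetter_spec (a b : T.S) (isCol : Bool) (line k : Fin 3) :
    ∃ acc : Bits 3 → Bits (lineLetter a b isCol line k).1.ansLen → Prop,
      1 - acceptProb E κ T P (.ms a b isCol line) (lineLetter a b isCol line k).1 acc ≤
        18 * (1 - antiSuccess E κ T P a b) ∧
      ∀ u v, acc u v → squareOk isCol u ∧ (lineLetter a b isCol line k).2 ⬝ᵥ v = u k := by
  cases isCol
  · obtain ⟨acc, h, h'⟩ := squareSuccess_spec (E := E) (κ := κ) (P := P) a b line k false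
    refine ⟨acc, ?_, h'⟩
    have := one_sub_squareSuccess_le (E := E) (κ := κ) (P := P) a b line k false
    rwa [h] at this
  · obtain ⟨acc, h, h'⟩ := squareSuccess_spec (E := E) (κ := κ) (P := P) a b k line true
    refine ⟨acc, ?_, h'⟩
    have := one_sub_squareSuccess_le (E := E) (κ := κ) (P := P) a b k line true
    rwa [h] at this

theorem consistent_lineLetter (a b : T.S) (isCol : Bool) (line k : Fin 3) :
    Consistent E κ T P (.ms a b isCol line) (lineLetter a b isCol line k)
      (fun u : Bits 3 => u k) (72 * (1 - antiSuccess E κ T P a b)) := by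
  obtain ⟨acc, h, h'⟩ := lineLetter_spec (E := E) (κ := κ) (P := P) a b isCol line k
  refine (sum_nsq_obs_sub_sgn_le E κ T P (.ms a b isCol line) _ acc _ (fun u : Bits 3 => u k)
    fun u v huv => (h' u v huv).2).trans ?_
  linarith

/-- If A, B, C are near signs, then A ∓ BC is near the corresponding combination of signs. That
combination is zero when the signs fit and otherwise has square 4; two rounds of the triangle
inequality multiply every term by 4. -/
theorem nsq_line_relation {N : ℕ} {ρ : Op N} (hρ : ρ.PosSemidef) {A B C : Op N}
    (hB : Bᴴ * B = 1) (p s t u : ZMod 2) :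
    nsq ρ (A - sgn p • (B * C)) ≤ 4 * nsq ρ (A - sgn s • 1) + 4 * nsq ρ (B - sgn t • 1) +
      4 * nsq ρ (C - sgn u • 1) + if s = p + t + u then 0 else 16 * ρ.trace.re := by
  have e : A - sgn p • (B * C) = ((A - sgn s • 1) - sgn p • (B * (C - sgn u • 1))) +
      (((sgn s - sgn (p + t + u)) • (1 : Op N)) -
        sgn p • (sgn u • (B - sgn t • 1))) := by
    simp only [mul_sub, smul_sub, sub_smul, mul_smul_comm, mul_one, smul_smul, sgn_add]
    rw [mul_comm (sgn p * sgn t), mul_left_comm, mul_comm (sgn u)]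
    abel_nf
  rw [e]
  refine (nsq_add_le hρ _ _).trans ?_
  have h1 := nsq_sub_le hρ (A - sgn s • 1) (sgn p • (B * (C - sgn u • 1)))
  have h2 := nsq_sub_le hρ ((sgn s - sgn (p + t + u)) • (1 : Op N))
    (sgn p • (sgn u • (B - sgn t • 1)))
  rw [nsq_sgn_smul, nsq_isometry_mul hB] at h1
  rw [nsq_sgn_smul, nsq_sgn_smul, nsq_smul, nsq_isometry (U := (1 : Op N)) (by simp)] at h2
  split_ifs with hs
  · have h4 : (sgn s - sgn (p + t + u)) * (sgn s - sgn (p + t + u)) = 0 := by rw [hs]; ring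
    rw [h4] at h2
    linarith
  · have h3 := sgn_mul_self (p + t + u)
    have h4 : (sgn s - sgn (p + t + u)) * (sgn s - sgn (p + t + u)) = 4 := by
      rw [sgn_eq_of_ne hs]; linear_combination 4 * h3
    rw [h4] at h2
    linarith

/-- Consistency makes the three cells near Alice's bits, and her bits obey the line constraint
unless the verifier rejects. The constant is 3 · 4 · 72 + 16 · 18. -/
theorem Indist.line_relation (h : Indist E κ T P η) (a b : T.S) (isCol : Bool)
    (line i j k : Fin 3) (hijk : ∀ u : Bits 3, u 0 + u 1 + u 2 = u i + u j + u k) (x : T.AQ) :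
    nsq (encState E κ T P x) (P.op (lineLetter a b isCol line i) -
        sgn (if isCol then 1 else 0) •
          (P.op (lineLetter a b isCol line j) * P.op (lineLetter a b isCol line k))) ≤
      1152 * (1 - antiSuccess E κ T P a b) + 2 * η := by
  classical
  set f := 1 - antiSuccess E κ T P a b
  set p : ZMod 2 := if isCol then 1 else 0 with hp
  set x₀ : T.AQ := .ms a b isCol line
  have h1 := h.nsq_le [lineLetter a b isCol line i]
    [lineLetter a b isCol line j, lineLetter a b isCol line k] p (by simp) x x₀
  rw [word_one, word_two] at h1
  refine h1.trans (add_le_add_left ?_ _)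
  have hi : _ ≤ _ := consistent_lineLetter (E := E) (κ := κ) (P := P) a b isCol line i
  have hj : _ ≤ _ := consistent_lineLetter (E := E) (κ := κ) (P := P) a b isCol line j
  have hk : _ ≤ _ := consistent_lineLetter (E := E) (κ := κ) (P := P) a b isCol line k
  obtain ⟨acc, hacc, hacc'⟩ := lineLetter_spec (E := E) (κ := κ) (P := P) a b isCol line i
  have hacc2 := (one_sub_acceptProb E κ T P (.ms a b isCol line) _ acc).symm.trans_le hacc
  -- An answer that breaks the constraint is rejected whatever Bob replies, so its whole trace
  -- counts as failure.
  have h2 : ∑ u : Bits 3, (if u i = p + u j + u k then 0 else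
      16 * (decState E κ T P x₀ u).trace.re) ≤ 16 * (18 * f) := by
    refine le_trans ?_ (mul_le_mul_of_nonneg_left hacc2 (by norm_num))
    refine le_trans ?_ (Finset.mul_sum _ _ _).ge
    refine Finset.sum_le_sum fun u _ => ?_
    have hnn := fun v : Bits (lineLetter a b isCol line i).1.ansLen =>
      P.ev_bob_nonneg (T.bobCode (lineLetter a b isCol line i).1)
      (decState_posSemidef E κ T P x₀ u) v
    split_ifs with hu
    · refine mul_nonneg (by norm_num) (Finset.sum_nonneg fun v _ => ?_)
      split_ifs
      · exact le_rfl
      · exact hnn v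
    · refine mul_le_mul_of_nonneg_left (le_of_eq ?_) (by norm_num)
      have hno : ∀ v, ¬ acc u v := fun v hv => hu <| by
        have h3 : u i + u j + u k = p := (hijk u).symm.trans (hacc' u v hv).1
        rw [← h3]
        have h4 := CharTwo.add_self_eq_zero (u j)
        have h5 := CharTwo.add_self_eq_zero (u k)
        linear_combination -h4 - h5
      have h6 : ∀ v, (if acc u v then (0 : ℝ) else ev (decState E κ T P x₀ u)
          (P.bob (T.bobCode (lineLetter a b isCol line i).1) v)) =
          ev (decState E κ T P x₀ u)
            (P.bob (T.bobCode (lineLetter a b isCol line i).1) v) := fun v => if_neg (hno v)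
      refine Eq.trans ?_ (Finset.sum_congr rfl fun v _ => (h6 v).symm)
      rw [← map_sum, P.sum_bob, ev_apply, one_mul]
  have h3 : nsq (encState E κ T P x₀) (P.op (lineLetter a b isCol line i) - sgn p •
      (P.op (lineLetter a b isCol line j) * P.op (lineLetter a b isCol line k))) ≤
      4 * (72 * f) + 4 * (72 * f) + 4 * (72 * f) + 16 * (18 * f) := by
    rw [encState_eq_sum, nsq_sum_state]
    refine (Finset.sum_le_sum fun u _ => nsq_line_relation (decState_posSemidef E κ T P x₀ u)
      (P.op_isometry _) p ((show Bits 3 from u) i) ((show Bits 3 from u) j)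
        ((show Bits 3 from u) k)).trans ?_
    simp only [Finset.sum_add_distrib, ← Finset.mul_sum]
    exact add_le_add (add_le_add (add_le_add (mul_le_mul_of_nonneg_left hi (by norm_num))
      (mul_le_mul_of_nonneg_left hj (by norm_num)))
      (mul_le_mul_of_nonneg_left hk (by norm_num))) h2
  linarith

/-- The magic square forces anticommutation. -/
theorem Indist.anticommute (h : Indist E κ T P η) (a b : T.S) (x : T.AQ) :
    nsq (encState E κ T P x) (P.op (pureLetter T .Z a) * P.op (pureLetter T .X b) -
        sgn 1 • (P.op (pureLetter T .X b) * P.op (pureLetter T .Z a))) ≤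
      80640 * (1 - antiSuccess E κ T P a b) + 160 * η := by
  have hrow : ∀ line i j k : Fin 3, (∀ u : Bits 3, u 0 + u 1 + u 2 = u i + u j + u k) → ∀ x,
      nsq (encState E κ T P x) (P.op (cellLetter a b line i) -
        sgn 0 • (P.op (cellLetter a b line j) * P.op (cellLetter a b line k))) ≤
      1152 * (1 - antiSuccess E κ T P a b) + 2 * η := fun line i j k hijk x =>
    h.line_relation a b false line i j k hijk x
  have hcol : ∀ line i j k : Fin 3, (∀ u : Bits 3, u 0 + u 1 + u 2 = u i + u j + u k) → ∀ x,
      nsq (encState E κ T P x) (P.op (cellLetter a b i line) -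
        sgn 1 • (P.op (cellLetter a b j line) * P.op (cellLetter a b k line))) ≤
      1152 * (1 - antiSuccess E κ T P a b) + 2 * η := fun line i j k hijk x =>
    h.line_relation a b true line i j k hijk x
  have hcon : ∀ row col : Fin 3, Consistent E κ T P (.ms a b false row) (cellLetter a b row col)
      (fun u : Bits 3 => u col) (72 * (1 - antiSuccess E κ T P a b)) := fun row col =>
    consistent_lineLetter a b false row col
  -- With c_ij for the cells, the six lines are used once each and eliminate the diagonal cells
  -- c_11, c_22, c_00 in turn: ZX ≈ -c_21 c_12, c_21 c_12 ≈ -c_20 c_02, c_20 c_02 ≈ -XZ. Three signs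
  -- remain.
  have s1 := h.mul_of_consistent (hcon 1 0) 
    (hcol 1 0 2 1 (fun u => by ring)) (hrow 1 0 1 2 fun u => by ring) x
  have s2 := h.mul_of_consistent (hcon 1 2) 
    (hrow 2 1 0 2 (fun u => by ring)) (hcol 2 1 2 0 fun u => by ring) x
  have s3 := h.mul_of_consistent (hcon 0 2) 
    (hcol 0 2 1 0 (fun u => by ring)) (hrow 0 2 0 1 fun u => by ring) x
  have hρ := encState_posSemidef E κ T P x
  have e1 : (1 + 0 : ZMod 2) = 1 := by decide
  have e2 : (0 + 1 : ZMod 2) = 1 := by decide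
  rw [e1, sgn_one] at s1 s3
  rw [e2, sgn_one] at s2
  have hZ : cellLetter a b 0 1 = pureLetter T .Z a := rfl
  have hX : cellLetter a b 1 0 = pureLetter T .X b := rfl
  rw [hZ, hX] at s1 s3
  set A := P.op (pureLetter T .Z a) * P.op (pureLetter T .X b)
  set A' := P.op (pureLetter T .X b) * P.op (pureLetter T .Z a)
  set B := P.op (cellLetter a b 2 1) * P.op (cellLetter a b 1 2)
  set B' := P.op (cellLetter a b 2 0) * P.op (cellLetter a b 0 2)
  -- Writing f for the failure probability, each link costs 8064 f + 16 η. The weights 2, 4, 4 of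
  -- the two triangle inequalities add up to 10.
  have e : A - sgn 1 • A' = (A - (-1 : ℝ) • B) - ((B - (-1 : ℝ) • B') - (B' - (-1 : ℝ) • A')) := by
    rw [sgn_one]
    simp only [neg_smul, one_smul]
    abel
  rw [e]
  have t1 := nsq_sub_le hρ (A - (-1 : ℝ) • B) ((B - (-1 : ℝ) • B') - (B' - (-1 : ℝ) • A'))
  have t2 := nsq_sub_le hρ (B - (-1 : ℝ) • B') (B' - (-1 : ℝ) • A')
  linarith

end Square

/-! ### The Pauli braiding test on the set `S` -/

section Braiding

variable {E : EncScheme} {κ : ℕ} {T : ProtocolData} {P : Prover} {η : ℝ}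

/-- Subtracting scalars does not change a commutator, and A - s has operator norm at most 2. -/
theorem nsq_commutator_le_of_sign {N : ℕ} {ρ : Op N} (hρ : ρ.PosSemidef) {A B : Op N}
    (hA : Aᴴ * A = 1) (hB : Bᴴ * B = 1) (s t : ZMod 2) :
    nsq ρ (A * B - B * A) ≤ 8 * nsq ρ (A - sgn s • 1) + 8 * nsq ρ (B - sgn t • 1) := by
  have e : A * B - B * A = (A - sgn s • 1) * (B - sgn t • 1) -
      (B - sgn t • 1) * (A - sgn s • 1) := by
    simp only [mul_sub, sub_mul, smul_mul_assoc, mul_smul_comm, one_mul, mul_one, smul_sub,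
      smul_smul, mul_comm (sgn s)]
    abel
  have key : ∀ {A : Op N} (B : Op N) (s : ZMod 2), Aᴴ * A = 1 →
      nsq ρ ((A - sgn s • 1) * B) ≤ 4 * nsq ρ B := fun {A} B s hA => by
    rw [sub_mul, smul_mul_assoc, one_mul]
    refine (nsq_sub_le hρ _ _).trans ?_
    rw [nsq_sgn_smul, nsq_isometry_mul hA]
    linarith
  rw [e]
  refine (nsq_sub_le hρ _ _).trans ?_
  have h1 := key (B - sgn t • 1) s hA
  have h2 := key (A - sgn s • 1) t hB
  linarith

/-- The acceptance predicate of the commutation test. -/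
def comAcc (a b : T.S) (W : PureBasis) (u : Bits 2) (v : Bits T.n) : Prop :=
  match W with
  | .Z => (a : Bits T.n) ⬝ᵥ v = u 0
  | .X => (b : Bits T.n) ⬝ᵥ v = u 1

theorem comSuccess_eq (a b : T.S) : comSuccess E κ T P a b =
    avg fun W => acceptProb E κ T P (.com a b) (.pure W) (comAcc a b W) := by
  unfold comSuccess
  refine congrArg avg (funext fun W => ?_)
  refine congrArg (acceptProb E κ T P (.com a b) (.pure W)) (funext fun u => funext fun v => ?_)
  cases W <;> rfl

theorem one_sub_acceptProb_com_le (a b : T.S) (W : PureBasis) :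
    1 - acceptProb E κ T P (.com a b) (.pure W) (comAcc a b W) ≤
      2 * (1 - comSuccess E κ T P a b) := by
  have h := le_card_mul_avg (fun W => sub_nonneg.mpr
    (acceptProb_le_one E κ T P (.com a b) (.pure W) (comAcc a b W))) W
  have hc : Fintype.card PureBasis = 2 := rfl
  rw [avg_sub, avg_const, hc, Nat.cast_two] at h
  rwa [comSuccess_eq]

theorem Indist.commute (h : Indist E κ T P η) (a b : T.S) (x : T.AQ) :
    nsq (encState E κ T P x) (P.op (pureLetter T .Z a) * P.op (pureLetter T .X b) -
        sgn 0 • (P.op (pureLetter T .X b) * P.op (pureLetter T .Z a))) ≤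
      128 * (1 - comSuccess E κ T P a b) + 2 * η := by
  have h1 := h.nsq_le [pureLetter T .Z a, pureLetter T .X b] [pureLetter T .X b, pureLetter T .Z a]
    0 (by simp) x (.com a b)
  rw [word_two, word_two] at h1
  refine h1.trans (add_le_add_left ?_ _)
  have cZ := sum_nsq_obs_sub_sgn_le E κ T P (.com a b) (.pure .Z) (comAcc a b .Z) (a : Bits T.n)
    (fun u : Bits 2 => u 0) fun u v h => h
  have cX := sum_nsq_obs_sub_sgn_le E κ T P (.com a b) (.pure .X) (comAcc a b .X) (b : Bits T.n)
    (fun u : Bits 2 => u 1) fun u v h => h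
  have hZ' := one_sub_acceptProb_com_le (E := E) (κ := κ) (P := P) a b .Z
  have hX' := one_sub_acceptProb_com_le (E := E) (κ := κ) (P := P) a b .X
  rw [encState_eq_sum, nsq_sum_state, sgn_zero, one_smul]
  refine (Finset.sum_le_sum fun u _ => nsq_commutator_le_of_sign
    (decState_posSemidef E κ T P (.com a b) u) (P.op_isometry _) (P.op_isometry _)
    ((show Bits 2 from u) 0) ((show Bits 2 from u) 1)).trans ?_
  rw [Finset.sum_add_distrib, ← Finset.mul_sum, ← Finset.mul_sum]
  refine (add_le_add (mul_le_mul_of_nonneg_left cZ (by norm_num))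
    (mul_le_mul_of_nonneg_left cX (by norm_num))).trans ?_
  linarith

/-- The failure probability of the braiding test for the pair `a`, `b`. -/
def braidingFailure (E : EncScheme) (κ : ℕ) (T : ProtocolData) (P : Prover) (a b : T.S) : ℝ :=
  1 - if (a : Bits T.n) ⬝ᵥ (b : Bits T.n) = 0 then comSuccess E κ T P a b
    else antiSuccess E κ T P a b

theorem avg_braidingFailure : (avg fun a : T.S => avg fun b : T.S =>
    braidingFailure E κ T P a b) = 1 - braidingSuccess E κ T P := by
  simp only [braidingFailure, avg_sub, avg_const, braidingSuccess]

theorem Indist.braiding (h : Indist E κ T P η) (hη : 0 ≤ η) (a b : T.S) (x : T.AQ) :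
    nsq (encState E κ T P x) (P.op (pureLetter T .Z a) * P.op (pureLetter T .X b) -
        sgn ((a : Bits T.n) ⬝ᵥ (b : Bits T.n)) •
          (P.op (pureLetter T .X b) * P.op (pureLetter T .Z a))) ≤
      80640 * braidingFailure E κ T P a b + 160 * η := by
  unfold braidingFailure
  by_cases hab : (a : Bits T.n) ⬝ᵥ (b : Bits T.n) = 0
  · rw [if_pos hab, hab]
    have h1 : comSuccess E κ T P a b ≤ 1 :=
      (avg_mono fun W => acceptProb_le_one ..).trans_eq (avg_const _)
    have := h.commute a b x
    linarith
  · rw [if_neg hab, (zmod_two_cases _).resolve_left hab]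
    exact h.anticommute a b x

end Braiding

/-! ### From the set `S` to all bit strings -/

section AllStrings

variable {E : EncScheme} {κ : ℕ} {T : ProtocolData} {P : Prover} {η μ : ℝ}

/-- Each basis and subtest is chosen with probability 1/4. -/
theorem one_sub_acceptProb_pure_le (W : PureBasis) :
    1 - acceptProb E κ T P (.pure W) (.pure W) (fun u v : Bits T.n => u = v) ≤
      4 * (1 - mixedPureSuccess E κ T P) ∧
    (avg fun r : Bits T.seedLen => (1 - acceptProb E κ T P (.pure W) (.mixed r)
        fun u v : Bits T.n => ∀ i, T.sample r i = W.toPauli → u i = v i)) ≤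
      4 * (1 - mixedPureSuccess E κ T P) := by
  let p : PureBasis → Bool → ℝ := fun W bit => if bit then
      avg fun r : Bits T.seedLen => acceptProb E κ T P (.pure W) (.mixed r)
        fun u v : Bits T.n => ∀ i, T.sample r i = W.toPauli → u i = v i
    else acceptProb E κ T P (.pure W) (.pure W) fun u v : Bits T.n => u = v
  have hp : mixedPureSuccess E κ T P = avg fun W => avg fun bit => p W bit := rfl
  have h0 : ∀ W bit, 0 ≤ 1 - p W bit := fun W bit => by
    rw [sub_nonneg]
    cases bit
    · exact acceptProb_le_one ..
    · exact (avg_mono fun r => acceptProb_le_one ..).trans_eq (avg_const _)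
  have h1 := le_card_mul_avg (fun W => avg_nonneg fun bit => h0 W bit) W
  have h2 := fun bit => le_card_mul_avg (fun bit => h0 W bit) bit
  have hc : Fintype.card PureBasis = 2 := rfl
  simp only [avg_sub, avg_const, ← hp, Fintype.card_bool, hc, Nat.cast_ofNat] at h1 h2
  have h3 := h2 false
  have h4 := h2 true
  have e3 : p W false = acceptProb E κ T P (.pure W) (.pure W) fun u v : Bits T.n => u = v := rfl
  have e4 : p W true = avg fun r : Bits T.seedLen => acceptProb E κ T P (.pure W) (.mixed r)
        fun u v : Bits T.n => ∀ i, T.sample r i = W.toPauli → u i = v i := rfl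
  rw [avg_sub, avg_const, ← e3, ← e4]
  constructor <;> linarith

theorem consistent_pureLetter (W : PureBasis) (a : Bits T.n) :
    Consistent E κ T P (.pure W) (pureLetter T W a) (fun u : Bits T.n => a ⬝ᵥ u)
      (16 * (1 - mixedPureSuccess E κ T P)) := by
  refine (sum_nsq_obs_sub_sgn_le E κ T P (.pure W) (.pure W) (fun u v : Bits T.n => u = v) a
    (fun u : Bits T.n => a ⬝ᵥ u) fun u v huv => by subst huv; rfl).trans ?_
  linarith [(one_sub_acceptProb_pure_le (E := E) (κ := κ) (T := T) (P := P) W).1]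

/-- Terms with `d i = 0` vanish on both sides. Any other term is at most 2 pointwise, while its
average over the biased set is at least 1 - μ. -/
theorem sum_mul_one_sub_sgn_le (hμ : μ < 1) (hS : IsBiased μ T.S) {I : Type*} [Fintype I]
    (w : I → ℝ) (hw : ∀ i, 0 ≤ w i) (d : I → Bits T.n) (a' : Bits T.n) :
    ∑ i, w i * (1 - sgn (a' ⬝ᵥ d i)) ≤
      2 / (1 - μ) * avg fun a : T.S => ∑ i, w i * (1 - sgn ((a : Bits T.n) ⬝ᵥ d i)) := by
  have hμ' : 0 < 1 - μ := sub_pos.mpr hμ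
  have e : (avg fun a : T.S => ∑ i, w i * (1 - sgn ((a : Bits T.n) ⬝ᵥ d i))) =
      ∑ i, w i * (1 - avg fun a : T.S => sgn ((a : Bits T.n) ⬝ᵥ d i)) := by
    rw [avg, expect_sum]
    refine Finset.sum_congr rfl fun i _ => ?_
    rw [expect_mul_left, expect_sub, expect_const, avg]
  rw [e, Finset.mul_sum]
  refine Finset.sum_le_sum fun i _ => ?_
  rw [mul_left_comm]
  refine mul_le_mul_of_nonneg_left ?_ (hw i)
  by_cases hd : d i = 0
  · simp [hd, sgn_zero, avg_const]
  · have h1 : (avg fun a : T.S => sgn ((a : Bits T.n) ⬝ᵥ d i)) ≤ μ := by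
      refine le_trans (le_of_eq ?_) ((le_abs_self _).trans (hS (d i) hd))
      rw [avg_eq, smul_eq_mul, Fintype.card_coe, div_eq_inv_mul,
        Finset.sum_coe_sort T.S fun a => sgn (a ⬝ᵥ d i)]
    have h2 : -1 ≤ sgn (a' ⬝ᵥ d i) := by unfold sgn; split_ifs <;> norm_num
    calc 1 - sgn (a' ⬝ᵥ d i) ≤ 2 := by linarith
      _ = 2 / (1 - μ) * (1 - μ) := by field_simp
      _ ≤ _ := by gcongr

theorem nsq_mul_eq_conj {ι κ ν : Type*} [Fintype ι] [Fintype κ] [Fintype ν] (ρ : Matrix κ κ ℂ)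
    (A : Matrix ι ν ℂ) (X : Matrix ν κ ℂ) : nsq ρ (A * X) = nsq (X * ρ * Xᴴ) A := by
  rw [nsq, nsq, ip_apply, ip_apply, Matrix.conjTranspose_mul, Matrix.mul_assoc, Matrix.mul_assoc,
    Matrix.trace_mul_comm]
  simp only [Matrix.mul_assoc]

/-- The weights are those of Bob's outcome `v` after applying `X`. They do not involve `a`, which
enters only through one character. -/
theorem nsq_obs_mul_sub (W : PureBasis) (a s : Bits T.n) (ρ X : Op P.N) (u : Bits T.n) :
    nsq ρ (P.op (pureLetter T W a) * X - sgn (a ⬝ᵥ s) • sgn (a ⬝ᵥ u) • X) =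
      2 * ∑ v : Bits T.n, ev (X * ρ * Xᴴ) (P.bob (T.bobCode (.pure W)) v) *
        (1 - sgn (a ⬝ᵥ (s + u + v))) := by
  have e : P.op (pureLetter T W a) * X - sgn (a ⬝ᵥ s) • sgn (a ⬝ᵥ u) • X =
      (P.op (pureLetter T W a) - sgn (a ⬝ᵥ (s + u)) • 1) * X := by
    rw [sub_mul, smul_mul_assoc, one_mul, dotProduct_add, sgn_add, smul_smul]
  rw [e, nsq_mul_eq_conj]
  refine (P.nsq_obs_sub_sgn (T.bobCode (.pure W)) a _).trans ?_
  rw [Finset.mul_sum, Finset.mul_sum]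
  refine Finset.sum_congr rfl fun v _ => ?_
  have e2 : sgn (a ⬝ᵥ (s + u + v)) = sgn (a ⬝ᵥ v) * sgn (a ⬝ᵥ (s + u)) := by
    rw [dotProduct_add a (s + u) v, sgn_add, mul_comm]
  rw [e2]
  split_ifs with h
  · rw [h, sgn_mul_self]; ring
  · rw [sgn_eq_of_ne h, neg_mul, sgn_mul_self]; ring

/-- Commutation up to signs with the observables indexed by a biased set extends to all bit
strings. -/
theorem nsq_twisted_commutator_le (hμ : μ < 1) (hS : IsBiased μ T.S) (W : PureBasis) {ε₀ : ℝ}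
    (hc : ∀ a, Consistent E κ T P (.pure W) (pureLetter T W a) (fun u : Bits T.n => a ⬝ᵥ u) ε₀)
    {X : Op P.N} (hX : Xᴴ * X = 1) (s a' : Bits T.n) :
    nsq (encState E κ T P (.pure W)) (P.op (pureLetter T W a') * X -
        sgn (a' ⬝ᵥ s) • (X * P.op (pureLetter T W a'))) ≤
      8 / (1 - μ) * (avg fun a : T.S => nsq (encState E κ T P (.pure W))
        (P.op (pureLetter T W a) * X - sgn ((a : Bits T.n) ⬝ᵥ s) •
          (X * P.op (pureLetter T W a)))) + (8 / (1 - μ) + 2) * ε₀ := by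
  let ρ : Bits T.n → Op P.N := fun u => decState E κ T P (.pure W) u
  have hρ : ∀ u, (ρ u).PosSemidef := fun u => decState_posSemidef E κ T P (.pure W) u
  have hsum : encState E κ T P (.pure W) = ∑ u, ρ u := encState_eq_sum E κ T P (.pure W)
  have hc' : ∀ a : Bits T.n, ∑ u, nsq (ρ u) (P.op (pureLetter T W a) - sgn (a ⬝ᵥ u) • 1) ≤ ε₀ := hc
  -- `F` is `D` with the right-hand observable replaced by Alice's sign. The two agree up to factors
  -- 2 and `2 * ε₀` in both directions.
  let F : Bits T.n → ℝ := fun a => ∑ u, nsq (ρ u)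
    (P.op (pureLetter T W a) * X - sgn (a ⬝ᵥ s) • sgn (a ⬝ᵥ u) • X)
  let D : Bits T.n → ℝ := fun a => nsq (encState E κ T P (.pure W))
    (P.op (pureLetter T W a) * X - sgn (a ⬝ᵥ s) • (X * P.op (pureLetter T W a)))
  have hμ' : 0 < 1 - μ := sub_pos.mpr hμ
  have hd : ∀ a u, nsq (ρ u) (sgn (a ⬝ᵥ s) • (X * P.op (pureLetter T W a)) -
      sgn (a ⬝ᵥ s) • sgn (a ⬝ᵥ u) • X) =
        nsq (ρ u) (P.op (pureLetter T W a) - sgn (a ⬝ᵥ u) • 1) := fun a u => by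
    rw [← smul_sub, nsq_sgn_smul, ← nsq_isometry_mul hX (P.op _ - _), mul_sub, mul_smul_comm,
      mul_one]
  have hFD : ∀ a, F a ≤ 2 * D a + 2 * ε₀ := fun a => by
    refine le_trans ?_ (add_le_add_right (mul_le_mul_of_nonneg_left (hc' a) zero_le_two) _)
    simp only [F, D, hsum, nsq_sum_state, Finset.mul_sum, ← Finset.sum_add_distrib]
    refine Finset.sum_le_sum fun u _ => ?_
    rw [← hd]
    exact nsq_triangle (hρ u) _ _ _
  have hDF : ∀ a, D a ≤ 2 * F a + 2 * ε₀ := fun a => by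
    refine le_trans ?_ (add_le_add_right (mul_le_mul_of_nonneg_left (hc' a) zero_le_two) _)
    simp only [F, D, hsum, nsq_sum_state, Finset.mul_sum, ← Finset.sum_add_distrib]
    refine Finset.sum_le_sum fun u _ => ?_
    rw [← hd, nsq_sub_comm (sgn (a ⬝ᵥ s) • (X * P.op (pureLetter T W a)))]
    exact nsq_triangle (hρ u) _ _ _
  -- The mixture runs over pairs of Alice's answer and Bob's outcome.
  have hF : F a' ≤ 2 / (1 - μ) * avg fun a : T.S => F a := by
    have e : ∀ a, F a = ∑ p : Bits T.n × Bits T.n,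
        (2 * ev (X * ρ p.1 * Xᴴ) (P.bob (T.bobCode (.pure W)) p.2)) *
          (1 - sgn (a ⬝ᵥ (s + p.1 + p.2))) := fun a => by
      simp only [F, nsq_obs_mul_sub, Fintype.sum_prod_type, Finset.mul_sum, mul_assoc]
    simp only [e]
    refine sum_mul_one_sub_sgn_le hμ hS _ (fun p => mul_nonneg zero_le_two ?_) _ a'
    exact P.ev_bob_nonneg _ ((hρ p.1).mul_mul_conjTranspose_same X) _
  have hA : (avg fun a : T.S => F a) ≤ 2 * (avg fun a : T.S => D a) + 2 * ε₀ := by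
    refine (avg_mono fun a : T.S => hFD a).trans_eq ?_
    rw [avg_add, avg_mul_left, avg_const]
  have h1 : 2 / (1 - μ) * (avg fun a : T.S => F a) ≤
      2 / (1 - μ) * (2 * (avg fun a : T.S => D a) + 2 * ε₀) :=
    mul_le_mul_of_nonneg_left hA (by positivity)
  have h2 := hDF a'
  have e : 8 / (1 - μ) * (avg fun a : T.S => D a) + (8 / (1 - μ) + 2) * ε₀ =
      2 * (2 / (1 - μ) * (2 * (avg fun a : T.S => D a) + 2 * ε₀)) + 2 * ε₀ := by ring
  change D a' ≤ 8 / (1 - μ) * (avg fun a : T.S => D a) + (8 / (1 - μ) + 2) * ε₀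
  rw [e]
  linarith

/-- The constant in `Indist.pauli_relation`. -/
def pauliConst (μ : ℝ) : ℝ :=
  8 / (1 - μ) * (8 / (1 - μ) * 80640 + (8 / (1 - μ) + 2) * 16 + 2) + (8 / (1 - μ) + 2) * 16 + 2

theorem pauliConst_nonneg (hμ : μ < 1) : 0 ≤ pauliConst μ := by
  have : 0 < 1 - μ := sub_pos.mpr hμ
  unfold pauliConst
  positivity

/-- The extension from `S` is done twice: first in `a`, at the question Z with `b` in `S`, then in
`b`, at the question X with `a` already arbitrary. The change of question in between costs `2 * η`.
-/
theorem Indist.pauli_relation (h : Indist E κ T P η) (hη : 0 ≤ η) (hμ : μ < 1)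
    (hS : IsBiased μ T.S) {δ : ℝ} (hδ : 0 ≤ δ) (h1 : 1 - δ ≤ braidingSuccess E κ T P)
    (h2 : 1 - δ ≤ mixedPureSuccess E κ T P) (a b : Bits T.n) (x : T.AQ) :
    nsq (encState E κ T P x) (P.op (pureLetter T .Z a) * P.op (pureLetter T .X b) -
        sgn (a ⬝ᵥ b) • (P.op (pureLetter T .X b) * P.op (pureLetter T .Z a))) ≤
      pauliConst μ * (δ + η) := by
  have hμ' : 0 < 1 - μ := sub_pos.mpr hμ
  set K := 8 / (1 - μ) with hK
  have hK0 : 0 ≤ K := by positivity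
  have hcon : ∀ W a, Consistent E κ T P (.pure W) (pureLetter T W a)
      (fun u : Bits T.n => a ⬝ᵥ u) (16 * δ) := fun W a =>
    (consistent_pureLetter W a).trans (by linarith)
  let D : T.AQ → Bits T.n → Bits T.n → ℝ := fun x a b => nsq (encState E κ T P x)
    (P.op (pureLetter T .Z a) * P.op (pureLetter T .X b) -
        sgn (a ⬝ᵥ b) • (P.op (pureLetter T .X b) * P.op (pureLetter T .Z a)))
  have hD : ∀ x a b, D x a b = nsq (encState E κ T P x)
      (P.op (pureLetter T .X b) * P.op (pureLetter T .Z a) -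
        sgn (b ⬝ᵥ a) • (P.op (pureLetter T .Z a) * P.op (pureLetter T .X b))) := fun x a b => by
    rw [← nsq_sgn_smul (b ⬝ᵥ a), smul_sub, smul_smul, sgn_mul_self, one_smul, nsq_sub_comm,
      dotProduct_comm b a]
  have htr : ∀ x x' a b, D x a b ≤ D x' a b + 2 * η := fun x x' a b => by
    have := h.nsq_le [pureLetter T .Z a, pureLetter T .X b]
      [pureLetter T .X b, pureLetter T .Z a] (a ⬝ᵥ b) (by simp) x x'
    rwa [word_two, word_two] at this
  have hZ : ∀ b : T.S, D (.pure .X) a b ≤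
      K * (avg fun a : T.S => 80640 * braidingFailure E κ T P a b + 160 * η) +
        ((K + 2) * (16 * δ) + 2 * η) := fun b => by
    have h3 := nsq_twisted_commutator_le hμ hS .Z (hcon .Z) (P.op_isometry (pureLetter T .X b)) b a
    have h4 : (avg fun a : T.S => D (.pure .Z) a b) ≤
        avg fun a : T.S => 80640 * braidingFailure E κ T P a b + 160 * η :=
      avg_mono fun a => h.braiding hη a b _
    have h5 := mul_le_mul_of_nonneg_left h4 hK0
    have h6 := htr (.pure .X) (.pure .Z) a b
    have h7 : D (.pure .Z) a b ≤ K * (avg fun a : T.S => D (.pure .Z) a b) +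
      (K + 2) * (16 * δ) := h3
    linarith
  have hZavg : (avg fun b : T.S => D (.pure .X) a b) ≤
      K * (80640 * δ + 160 * η) + ((K + 2) * (16 * δ) + 2 * η) := by
    refine (avg_mono hZ).trans ?_
    rw [avg_add, avg_const, avg_mul_left, avg_comm]
    simp only [avg_add, avg_mul_left, avg_const]
    rw [avg_braidingFailure]
    gcongr
    linarith
  have hX := nsq_twisted_commutator_le hμ hS .X (hcon .X) (P.op_isometry (pureLetter T .Z a)) a b
  simp only [← hD] at hX
  have h8 := mul_le_mul_of_nonneg_left hZavg hK0
  have h9 := htr x (.pure .X) a b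
  have h10 : D x a b ≤ K * (K * (80640 * δ + 160 * η) + ((K + 2) * (16 * δ) + 2 * η)) +
    (K + 2) * (16 * δ) + 2 * η := by linarith
  refine h10.trans ?_
  have e : pauliConst μ = K * (K * 80640 + (K + 2) * 16 + 2) + (K + 2) * 16 + 2 := rfl
  rw [e]
  have q1 := mul_nonneg hK0 hδ
  have q2 := mul_nonneg hK0 hη
  have q3 := mul_nonneg hK0 q1
  have q4 := mul_nonneg hK0 q2
  linarith

end AllStrings

/-! ### Pauli operators -/

section Paulis

variable {n : ℕ}

/-- The string `c` with the positions not measured in the basis `W` reset to `0`. -/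
def restrict (w : Fin n → Pauli) (W : PureBasis) (c : Bits n) : Bits n := fun i =>
  if w i = W.toPauli then c i else 0

theorem mask_eq_add (w : Fin n → Pauli) (c : Bits n) :
    mask w c = restrict w .X c + restrict w .Z c := by
  funext i
  cases h : w i <;> simp [mask, restrict, PureBasis.toPauli, h]

theorem dotProduct_mask (w : Fin n → Pauli) (c v : Bits n) : c ⬝ᵥ mask w v = mask w c ⬝ᵥ v :=
  Finset.sum_congr rfl fun i _ => by simp only [mask]; split_ifs <;> simp

theorem sgn_sum {ι : Type*} (s : Finset ι) (f : ι → ZMod 2) :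
    sgn (∑ i ∈ s, f i) = ∏ i ∈ s, sgn (f i) := by
  classical
  induction s using Finset.induction_on with
  | empty => simp [sgn_zero]
  | insert i s hi ih => rw [Finset.sum_insert hi, Finset.prod_insert hi, sgn_add, ih]

theorem Pauli.pow_val_apply (A : Pauli) (c x y : ZMod 2) : (A.mat ^ c.val) x y =
    if x = y + (if A = .X then c else 0) then (sgn ((if A = .Z then c else 0) * y) : ℂ) else 0 := by
  rcases zmod_two_cases c with rfl | rfl
  · simp [Matrix.one_apply, sgn_zero]
  · have h1 : (1 : ZMod 2).val = 1 := rfl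
    rw [h1, pow_one]
    cases A
    · simp [Pauli.mat, Matrix.one_apply, sgn_zero]
    · simp [Pauli.mat, sgn_zero]
    · by_cases h : x = y
      · simp [Pauli.mat, h]
      · simp [Pauli.mat, h]

theorem sigma_eq (w : Fin n → Pauli) (c : Bits n) :
    sigma w c = shift (restrict w .X c) * phase (restrict w .Z c) := by
  ext x y
  rw [phase, Matrix.mul_diagonal]
  simp only [sigma, tensor, Matrix.of_apply, Pauli.pow_val_apply, shift]
  have hiff : x = y + restrict w .X c ↔
      ∀ i ∈ Finset.univ, x i = y i + if w i = .X then c i else 0 := by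
    simp only [funext_iff, Finset.mem_univ, true_implies]
    rfl
  rw [Finset.prod_ite_zero]
  by_cases h : x = y + restrict w .X c
  · rw [if_pos h, if_pos (hiff.mp h), one_mul, dotProduct, sgn_sum, Complex.ofReal_prod]
    rfl
  · rw [if_neg h, if_neg (mt hiff.mpr h), zero_mul]

/-- The Fourier transform factors over the qubits. At an identity position the projector is 1 for
outcome 0 and vanishes for outcome 1, so its transform is 1 there. -/
theorem sum_sgn_smul_pauliProj (w : Fin n → Pauli) (c : Bits n) :
    ∑ u, sgn (c ⬝ᵥ u) • pauliProj w u = sigma w c := by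
  have h : ∀ i (x y : ZMod 2), ((w i).mat ^ (c i).val) x y =
      ∑ t : ZMod 2, (sgn (c i * t) : ℂ) * ((2⁻¹ : ℂ) • (1 + (sgn t : ℂ) • (w i).mat)) x y :=
    fun i x y => by
      rw [sum_zmod_two]
      rcases zmod_two_cases (c i) with h | h
      · simp [h, sgn_zero, sgn_one]; ring
      · have h1 : (1 : ZMod 2).val = 1 := rfl
        simp [h, h1, sgn_zero, sgn_one]; ring
  ext x y
  simp only [sigma, tensor, Matrix.of_apply, h]
  rw [Finset.prod_univ_sum, Fintype.piFinset_univ, Matrix.sum_apply]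
  refine Finset.sum_congr rfl fun u _ => ?_
  rw [Finset.prod_mul_distrib, Matrix.smul_apply, dotProduct, sgn_sum, Complex.real_smul,
    Complex.ofReal_prod]
  rfl

theorem tensor_mul (A B : Fin n → Matrix (ZMod 2) (ZMod 2) ℂ) :
    tensor A * tensor B = tensor fun i => A i * B i := by
  ext x y
  simp only [tensor, Matrix.mul_apply, Matrix.of_apply, ← Finset.prod_mul_distrib]
  rw [Finset.prod_univ_sum, Fintype.piFinset_univ]

theorem tensor_conjTranspose (A : Fin n → Matrix (ZMod 2) (ZMod 2) ℂ) :
    (tensor A)ᴴ = tensor fun i => (A i)ᴴ := by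
  ext x y
  simp [tensor]

theorem Pauli.mat_conjTranspose (A : Pauli) : A.matᴴ = A.mat := by
  cases A
  · simp [Pauli.mat]
  · ext x y
    simp only [Pauli.mat, Matrix.conjTranspose_apply, Matrix.of_apply]
    have : y = x + 1 ↔ x = y + 1 := by revert x y; decide
    simp only [this]
    split_ifs <;> simp
  · ext x y
    simp only [Pauli.mat, Matrix.conjTranspose_apply, Matrix.diagonal_apply]
    by_cases h : x = y
    · simp [h]
    · simp [h, Ne.symm h]

theorem Pauli.mat_mul_self (A : Pauli) : A.mat * A.mat = 1 := by
  cases A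
  · simp [Pauli.mat]
  · ext x y
    rw [Matrix.mul_apply, sum_zmod_two]
    rcases zmod_two_cases x with rfl | rfl <;> rcases zmod_two_cases y with rfl | rfl <;>
      simp [Pauli.mat, CharTwo.add_self_eq_zero]
  · rw [Pauli.mat, Matrix.diagonal_mul_diagonal, ← Matrix.diagonal_one]
    congr 1
    funext x
    rw [← Complex.ofReal_mul, sgn_mul_self, Complex.ofReal_one]

theorem pauliProj_conjTranspose (w : Fin n → Pauli) (u : Bits n) :
    (pauliProj w u)ᴴ = pauliProj w u := by
  rw [pauliProj, tensor_conjTranspose]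
  congr 1
  funext i
  simp [Matrix.conjTranspose_smul, Pauli.mat_conjTranspose]

theorem pauliProj_mul_self (w : Fin n → Pauli) (u : Bits n) :
    pauliProj w u * pauliProj w u = pauliProj w u := by
  rw [pauliProj, tensor_mul]
  congr 1
  funext i
  have h : ((sgn (u i) : ℂ)) * (sgn (u i) : ℂ) = 1 := by
    rw [← Complex.ofReal_mul, sgn_mul_self, Complex.ofReal_one]
  have e : (1 + (sgn (u i) : ℂ) • (w i).mat) * (1 + (sgn (u i) : ℂ) • (w i).mat) =
      (2 : ℂ) • (1 + (sgn (u i) : ℂ) • (w i).mat) := by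
    simp only [mul_add, add_mul, one_mul, mul_one, smul_mul_assoc, mul_smul_comm,
      Pauli.mat_mul_self, smul_add, smul_smul, h, one_smul]
    module
  rw [smul_mul_assoc, mul_smul_comm, e, smul_smul, smul_smul]
  norm_num

theorem sum_pauliProj (w : Fin n → Pauli) : ∑ u, pauliProj w u = 1 := by
  have h := sum_sgn_smul_pauliProj w 0
  have e : ∀ W, restrict w W 0 = 0 := fun W => by funext i; simp [restrict]
  simpa [sigma_eq, e, shift_zero, phase_zero, sgn_zero] using h

/-- The change of the outcomes of the measurement in the basis `w` caused by the Pauli operator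
`σ_X(ux) σ_Z(uz)`. -/
theorem correct_eq (w : Fin n → Pauli) (v ux uz : Bits n) :
    correct w v ux uz = mask w v + correct w 0 ux uz := by
  funext i
  cases h : w i <;> simp [correct, mask, h]

theorem Pauli.conj_mat (A : Pauli) (p q : ZMod 2) :
    A.mat * (Pauli.X.mat ^ p.val * Pauli.Z.mat ^ q.val) =
      (sgn (match A with | .I => 0 | .X => q | .Z => p) : ℂ) •
        ((Pauli.X.mat ^ p.val * Pauli.Z.mat ^ q.val) * A.mat) := by
  have hZX : Pauli.Z.mat * Pauli.X.mat = (-1 : ℂ) • (Pauli.X.mat * Pauli.Z.mat) := by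
    ext x y
    simp only [Matrix.mul_apply, Matrix.smul_apply, sum_zmod_two]
    rcases zmod_two_cases x with rfl | rfl <;> rcases zmod_two_cases y with rfl | rfl <;>
      simp [Pauli.mat, sgn_zero, sgn_one, CharTwo.add_self_eq_zero]
  have h1 : (1 : ZMod 2).val = 1 := rfl
  have hI : Pauli.I.mat = 1 := rfl
  cases A
  · simp [hI, sgn_zero]
  · rcases zmod_two_cases p with rfl | rfl <;> rcases zmod_two_cases q with rfl | rfl <;>
      simp [h1, sgn_zero, sgn_one, hZX, mul_assoc]
  · rcases zmod_two_cases p with rfl | rfl <;> rcases zmod_two_cases q with rfl | rfl <;>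
      simp [h1, sgn_zero, sgn_one, hZX, mul_assoc, ← mul_assoc Pauli.Z.mat Pauli.X.mat]

/-- Each σ_{w_i} picks up a sign when it passes the correction, which flips the outcome label at
that position. -/
theorem pauliProj_mul_correction (w : Fin n → Pauli) (u ux uz : Bits n) :
    pauliProj w u * (sigma (fun _ => .X) ux * sigma (fun _ => .Z) uz) =
      (sigma (fun _ => .X) ux * sigma (fun _ => .Z) uz) *
        pauliProj w (u + correct w 0 ux uz) := by
  simp only [pauliProj, sigma, tensor_mul]
  congr 1
  funext i
  rw [smul_mul_assoc, mul_smul_comm, add_mul, mul_add, one_mul, mul_one, smul_mul_assoc,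
    mul_smul_comm, Pauli.conj_mat, smul_smul, ← Complex.ofReal_mul, ← sgn_add]
  congr 5
  cases h : w i <;> simp [correct, h]

theorem correction_isometry (ux uz : Bits n) :
    (sigma (fun _ => .X) ux * sigma (fun _ => .Z) uz)ᴴ *
      (sigma (fun _ => .X) ux * sigma (fun _ => .Z) uz) = 1 := by
  have e : ∀ (W : Pauli) (c : Bits n), (sigma (fun _ => W) c)ᴴ * sigma (fun _ => W) c = 1 :=
    fun W c => by
      rw [sigma_eq, Matrix.conjTranspose_mul, mul_assoc, ← mul_assoc _ (shift _),
        shift_conjTranspose, shift_mul, bits_add_self, shift_zero, one_mul, phase_conjTranspose,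
        phase_mul_self]
  rw [Matrix.conjTranspose_mul, mul_assoc, ← mul_assoc _ (sigma _ ux), e, one_mul, e]

end Paulis

/-! ### Stacked matrices -/

section Stack

variable {n : ℕ} {κ ν : Type*}

/-- The matrix with blocks `F u` below each other. -/
def stack (F : Bits n → Matrix κ ν ℂ) : Matrix (Bits n × κ) ν ℂ :=
  Matrix.of fun p k => F p.1 p.2 k

theorem stack_sub (F G : Bits n → Matrix κ ν ℂ) :
    stack F - stack G = stack fun u => F u - G u := rfl

theorem conjTranspose_stack_mul [Fintype κ] (F G : Bits n → Matrix κ ν ℂ) :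
    (stack F)ᴴ * stack G = ∑ u, (F u)ᴴ * G u := by
  ext x y
  simp [Matrix.mul_apply, Matrix.sum_apply, stack, Fintype.sum_prod_type]

theorem nsq_stack [Fintype κ] [Fintype ν] (ρ : Matrix ν ν ℂ) (F : Bits n → Matrix κ ν ℂ) :
    nsq ρ (stack F) = ∑ u, nsq ρ (F u) := by
  simp only [nsq, ip_apply, conjTranspose_stack_mul, Finset.sum_mul, Matrix.trace_sum,
    Complex.re_sum]

theorem stack_mul [Fintype ν] (F : Bits n → Matrix κ ν ℂ) (A : Matrix ν ν ℂ) :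
    stack F * A = stack fun u => F u * A := by
  ext p k
  simp [stack, Matrix.mul_apply]

theorem kronecker_mul_stack [Fintype κ] [DecidableEq κ] (K : Op n) (F : Bits n → Matrix κ ν ℂ) :
    (K ⊗ₖ (1 : Matrix κ κ ℂ)) * stack F = stack fun u => ∑ v, K u v • F v := by
  ext p k
  simp [stack, Matrix.mul_apply, Fintype.sum_prod_type, Matrix.sum_apply, Matrix.one_apply]

theorem shift_phase_kronecker_mul_stack [Fintype κ] [DecidableEq κ] (a b : Bits n)
    (F : Bits n → Matrix κ ν ℂ) : ((shift b * phase a) ⊗ₖ (1 : Matrix κ κ ℂ)) * stack F =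
      stack fun u => sgn (a ⬝ᵥ (u + b)) • F (u + b) := by
  rw [kronecker_mul_stack]
  congr 1
  funext u
  rw [Finset.sum_eq_single (u + b)]
  · rw [phase, Matrix.mul_diagonal, shift, Matrix.of_apply, if_pos (bits_eq_add_iff.mpr rfl),
      one_mul]
    ext x y; simp
  · intro v _ hv
    rw [phase, Matrix.mul_diagonal, shift, Matrix.of_apply, if_neg (mt bits_eq_add_iff.mp hv),
      zero_mul, zero_smul]
  · simp

theorem sum_smul_kronecker_mul [Fintype κ] [DecidableEq κ] {ι : Type*} [Fintype ι] (c : ι → ℝ)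
    (K : ι → Op n) (A : Matrix (Bits n × κ) ν ℂ) : ∑ i, c i • ((K i ⊗ₖ (1 : Matrix κ κ ℂ)) * A) =
      ((∑ i, c i • K i) ⊗ₖ (1 : Matrix κ κ ℂ)) * A := by
  have e : (∑ i, c i • K i) ⊗ₖ (1 : Matrix κ κ ℂ) = ∑ i, c i • (K i ⊗ₖ (1 : Matrix κ κ ℂ)) := by
    ext p q
    simp [Matrix.sum_apply, Finset.sum_mul, mul_assoc]
  rw [e, Matrix.sum_mul]
  simp only [Matrix.smul_mul]

/-- The adjoint of an isometry does not increase the seminorm. -/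
theorem nsq_conjTranspose_mul_le {ι : Type*} [Fintype ι] [Fintype κ] [Fintype ν]
    [DecidableEq κ] {ρ : Matrix ν ν ℂ}
    (hρ : ρ.PosSemidef) {V : Matrix ι κ ℂ} (hV : Vᴴ * V = 1) (A : Matrix ι ν ℂ) :
    nsq ρ (Vᴴ * A) ≤ nsq ρ A := by
  have h := nsq_nonneg hρ (A - V * (Vᴴ * A))
  have e : ip ρ A (V * (Vᴴ * A)) = nsq ρ (Vᴴ * A) := by
    rw [nsq, ip_apply, ip_apply, Matrix.conjTranspose_mul, Matrix.conjTranspose_conjTranspose]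
    simp only [Matrix.mul_assoc]
  rw [nsq_sub hρ, nsq_isometry_mul hV, e] at h
  linarith

end Stack

/-! ### The swap isometry -/

section Rounding

variable {E : EncScheme} {κ : ℕ} {T : ProtocolData} {P : Prover} {η μ : ℝ}

/-- The letter for a parity of the outcomes of the mixed basis measurement. -/
def mixedLetter (T : ProtocolData) (r : Bits T.seedLen) (c : Bits T.n) : Letter T := ⟨.mixed r, c⟩

/-- Bob's measurement in a pure basis. -/
def pureMeas (T : ProtocolData) (P : Prover) (W : PureBasis) (u : Bits T.n) : Op P.N :=
  P.bob (T.bobCode (.pure W)) u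

theorem op_pureLetter (W : PureBasis) (a : Bits T.n) :
    P.op (pureLetter T W a) = ∑ v, sgn (a ⬝ᵥ v) • pureMeas T P W v := P.obs_eq_sum _ _

theorem op_pureLetter_add (W : PureBasis) (a b : Bits T.n) :
    P.op (pureLetter T W (a + b)) = P.op (pureLetter T W a) * P.op (pureLetter T W b) :=
  P.obs_add _ _ _

/-- Resetting ignored outcome bits is dual to dropping those positions from `c`. The X and Z parts
factor exactly because both come from one measurement; the order matches `sigma_eq`. -/
theorem sum_sgn_smul_mixedMeas (r : Bits T.seedLen) (c : Bits T.n) :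
    ∑ u, sgn (c ⬝ᵥ u) • mixedMeas T P r u =
      P.op (mixedLetter T r (restrict (T.sample r) .X c)) *
        P.op (mixedLetter T r (restrict (T.sample r) .Z c)) := by
  have h : P.op (mixedLetter T r (restrict (T.sample r) .X c)) *
        P.op (mixedLetter T r (restrict (T.sample r) .Z c)) =
      ∑ v : Bits T.n, sgn (mask (T.sample r) c ⬝ᵥ v) • P.bob (T.bobCode (.mixed r)) v := by
    rw [mask_eq_add, ← P.obs_eq_sum]
    exact (P.obs_add _ _ _).symm
  rw [h]
  simp only [mixedMeas, Finset.smul_sum]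
  rw [Finset.sum_comm]
  refine Finset.sum_congr rfl fun v _ => ?_
  simp only [smul_ite, smul_zero, Finset.sum_ite_eq, Finset.mem_univ, if_true, dotProduct_mask]

/-- The matrix relabelling the basis states by numbers. -/
def relabel {ι : Type*} [DecidableEq ι] {d : ℕ} (e : ι ≃ Fin d) : Matrix (Fin d) ι ℂ :=
  (1 : Matrix ι ι ℂ).submatrix e.symm id

theorem relabel_isometry {ι : Type*} [Fintype ι] [DecidableEq ι] {d : ℕ} (e : ι ≃ Fin d) :
    (relabel e)ᴴ * relabel e = 1 := by
  rw [relabel, Matrix.conjTranspose_submatrix, Matrix.submatrix_mul_equiv]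
  simp

/-- The swap isometry `∑_u |u⟩ ⊗ X(u) B^Z_u`. -/
def swapIso (T : ProtocolData) (P : Prover) {d : ℕ} (e : Bits P.N ≃ Fin d) :
    Matrix (Bits T.n × Fin d) (Bits P.N) ℂ :=
  stack fun u => relabel e * (P.op (pureLetter T .X u) * pureMeas T P .Z u)

variable {d : ℕ} (e : Bits P.N ≃ Fin d)

theorem isometry_mul_conj {ι κ ν : Type*} [Fintype ι] [Fintype κ] [Fintype ν] [DecidableEq κ]
    {U : Matrix ι κ ℂ} (hU : Uᴴ * U = 1) (A : Matrix κ ν ℂ) : (U * A)ᴴ * (U * A) = Aᴴ * A := by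
  rw [Matrix.conjTranspose_mul, Matrix.mul_assoc, ← Matrix.mul_assoc _ U, hU, Matrix.one_mul]

theorem swapIso_isometry : (swapIso T P e)ᴴ * swapIso T P e = 1 := by
  rw [swapIso, conjTranspose_stack_mul]
  refine (Finset.sum_congr rfl fun u _ => ?_).trans (P.sum_bob (T.bobCode (.pure .Z)) (l := T.n))
  rw [isometry_mul_conj (relabel_isometry e), isometry_mul_conj (P.op_isometry _), pureMeas,
    P.bob_conjTranspose, P.bob_mul, if_pos rfl]

/-- The pure-basis observables satisfy X(u + b) = X(u)X(b) exactly, so X(u) can be pulled out of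
every block. -/
theorem swapIso_mul_sub (M : Op P.N) (a b : Bits T.n) :
    swapIso T P e * M - ((shift b * phase a) ⊗ₖ (1 : Matrix (Fin d) (Fin d) ℂ)) * swapIso T P e =
      stack fun u => relabel e * (P.op (pureLetter T .X u) * (pureMeas T P .Z u * M -
        sgn (a ⬝ᵥ (u + b)) • (P.op (pureLetter T .X b) * pureMeas T P .Z (u + b)))) := by
  rw [swapIso, shift_phase_kronecker_mul_stack, stack_mul, stack_sub]
  congr 1
  funext u
  simp only [op_pureLetter_add, mul_sub, Matrix.mul_sub, mul_smul_comm, Matrix.mul_smul,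
    mul_assoc, Matrix.mul_assoc]

/-- X(u) drops out as an isometry, and Parseval in the register turns the projectors B^Z_u into the
observables Z(a'). -/
theorem nsq_swapIso_mul_sub (ρ M : Op P.N) (a b : Bits T.n) :
    nsq ρ (swapIso T P e * M -
        ((shift b * phase a) ⊗ₖ (1 : Matrix (Fin d) (Fin d) ℂ)) * swapIso T P e) =
      avg fun a' : Bits T.n => nsq ρ (P.op (pureLetter T .Z a') * M -
        sgn (a' ⬝ᵥ b) • (P.op (pureLetter T .X b) * P.op (pureLetter T .Z a') *
          P.op (pureLetter T .Z a))) := by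
  rw [swapIso_mul_sub, nsq_stack]
  simp only [nsq_isometry_mul (relabel_isometry e), nsq_isometry_mul (P.op_isometry _)]
  rw [sum_nsq_eq_avg]
  refine congrArg avg (funext fun a' => congrArg (nsq ρ) ?_)
  simp only [smul_sub, Finset.sum_sub_distrib]
  refine congrArg₂ (· - ·) ?_ ?_
  · simp only [op_pureLetter, Finset.sum_mul, smul_mul_assoc]
  · rw [mul_assoc, ← op_pureLetter_add, op_pureLetter .Z, ← Equiv.sum_comp (Equiv.addRight b)]
    simp only [Finset.mul_sum, Finset.smul_sum, mul_smul_comm, Equiv.coe_addRight]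
    refine Finset.sum_congr rfl fun u _ => ?_
    have hs : sgn (a' ⬝ᵥ (u + b)) * sgn (a ⬝ᵥ u) =
        sgn (a' ⬝ᵥ b) * sgn ((a' + a) ⬝ᵥ u) := by
      rw [add_dotProduct, dotProduct_add a' u b, sgn_add, sgn_add]
      ring
    rw [smul_smul, smul_smul, add_assoc u b b, bits_add_self, add_zero, hs]

/-- The failure probability of the mixed-versus-pure test with seed `r`. -/
def mixedFailure (E : EncScheme) (κ : ℕ) (T : ProtocolData) (P : Prover) (W : PureBasis)
    (r : Bits T.seedLen) : ℝ :=
  1 - acceptProb E κ T P (.pure W) (.mixed r)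
    fun u v : Bits T.n => ∀ i, T.sample r i = W.toPauli → u i = v i

theorem consistent_mixedLetter (W : PureBasis) (r : Bits T.seedLen) (c : Bits T.n) :
    Consistent E κ T P (.pure W) (mixedLetter T r (restrict (T.sample r) W c))
      (fun u : Bits T.n => restrict (T.sample r) W c ⬝ᵥ u) (4 * mixedFailure E κ T P W r) := by
  refine sum_nsq_obs_sub_sgn_le E κ T P (.pure W) (.mixed r)
    (fun u v : Bits T.n => ∀ i, T.sample r i = W.toPauli → u i = v i)
    (restrict (T.sample r) W c) (fun u : Bits T.n => restrict (T.sample r) W c ⬝ᵥ u)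
    fun u v huv => Finset.sum_congr rfl fun i _ => ?_
  simp only [restrict]
  split_ifs with h
  · rw [huv i h]
  · rw [zero_mul, zero_mul]

/-- When Alice is asked `W`, both observables are near the same parity of her answer. -/
theorem Indist.mixed_sub_pure (h : Indist E κ T P η) {δ : ℝ}
    (h2 : 1 - δ ≤ mixedPureSuccess E κ T P) (W : PureBasis) (r : Bits T.seedLen) (c : Bits T.n)
    (x : T.AQ) : nsq (encState E κ T P x)
      (P.op (mixedLetter T r (restrict (T.sample r) W c)) -
        P.op (pureLetter T W (restrict (T.sample r) W c))) ≤
      8 * mixedFailure E κ T P W r + 32 * δ + 2 * η := by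
  set c' := restrict (T.sample r) W c with hc'
  have h1 := h.nsq_le [mixedLetter T r c'] [pureLetter T W c'] 0 (by simp) x (.pure W)
  rw [word_one, word_one, sgn_zero, one_smul] at h1
  have c1 : _ ≤ _ := consistent_mixedLetter (E := E) (κ := κ) (P := P) W r c
  have c2 : _ ≤ _ := consistent_pureLetter (E := E) (κ := κ) (P := P) W c'
  rw [← hc'] at c1
  have h3 : nsq (encState E κ T P (.pure W))
      (P.op (mixedLetter T r c') - P.op (pureLetter T W c')) ≤
      2 * (4 * mixedFailure E κ T P W r) + 2 * (16 * (1 - mixedPureSuccess E κ T P)) := by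
    refine le_trans ?_ (add_le_add (mul_le_mul_of_nonneg_left c1 zero_le_two)
      (mul_le_mul_of_nonneg_left c2 zero_le_two))
    rw [encState_eq_sum, nsq_sum_state, Finset.mul_sum, Finset.mul_sum, ← Finset.sum_add_distrib]
    refine Finset.sum_le_sum fun u _ => ?_
    rw [nsq_sub_comm (P.op (pureLetter T W c'))]
    exact nsq_triangle (decState_posSemidef E κ T P (.pure W) u) _ _ _
  linarith

/-- This is the relation that `nsq_swapIso_mul_sub` calls for when `M` is an observable of the mixed
measurement. -/
theorem Indist.mixed_relation (h : Indist E κ T P η) (hη : 0 ≤ η) (hμ : μ < 1)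
    (hS : IsBiased μ T.S) {δ : ℝ} (hδ : 0 ≤ δ) (h1 : 1 - δ ≤ braidingSuccess E κ T P)
    (h2 : 1 - δ ≤ mixedPureSuccess E κ T P) (r : Bits T.seedLen) (a' c : Bits T.n) (x : T.AQ) :
    nsq (encState E κ T P x) (P.op (pureLetter T .Z a') *
        (P.op (mixedLetter T r (restrict (T.sample r) .X c)) *
          P.op (mixedLetter T r (restrict (T.sample r) .Z c))) -
        sgn (a' ⬝ᵥ restrict (T.sample r) .X c) •
          (P.op (pureLetter T .X (restrict (T.sample r) .X c)) * P.op (pureLetter T .Z a') *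
            P.op (pureLetter T .Z (restrict (T.sample r) .Z c)))) ≤
      16 * mixedFailure E κ T P .Z r + 64 * mixedFailure E κ T P .X r +
        (8 * pauliConst μ + 1344) * (δ + η) := by
  have m1 := h.mixed_sub_pure h2 .Z r c x
  have m2 := h.mixed_sub_pure h2 .X r c (.pure .Z)
  set a := restrict (T.sample r) .Z c
  set b := restrict (T.sample r) .X c
  have hc : Consistent E κ T P (.pure .Z) (pureLetter T .Z a) (fun u : Bits T.n => a ⬝ᵥ u)
      (16 * δ) := (consistent_pureLetter .Z a).trans (by linarith)
  have m3 := h.pauli_relation hη hμ hS hδ h1 h2 a' b (.pure .Z)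
  have t2 := h.mul_right [mixedLetter T r b] [pureLetter T .X b] (pureLetter T .Z a) 0 (by simp)
    hc (le_of_eq_of_le (by rw [word_one, word_one, sgn_zero, one_smul]) m2) x
  have t3 := h.mul_right [pureLetter T .Z a', pureLetter T .X b]
    [pureLetter T .X b, pureLetter T .Z a'] (pureLetter T .Z a) (a' ⬝ᵥ b) (by simp)
    hc (le_of_eq_of_le (by rw [word_two, word_two]) m3) x
  rw [word_one, word_one, sgn_zero, one_smul] at t2
  rw [word_two, word_two] at t3
  set Z' := P.op (pureLetter T .Z a')
  set Z := P.op (pureLetter T .Z a)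
  set X := P.op (pureLetter T .X b)
  set A := P.op (mixedLetter T r b)
  set B := P.op (mixedLetter T r a)
  -- The mixed factors are made pure from right to left, then Z' is moved past X. The last two steps
  -- carry Z on the right, which is consistent at the question Z, so `Indist.mul_right` applies.
  have e1 : Z' * (A * B) - sgn (a' ⬝ᵥ b) • (X * Z' * Z) =
      Z' * (A * (B - Z)) + (Z' * ((A - X) * Z) + (Z' * X - sgn (a' ⬝ᵥ b) • (X * Z')) * Z) := by
    simp only [mul_sub, sub_mul, smul_mul_assoc, mul_assoc]
    abel
  have hρ := encState_posSemidef E κ T P x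
  rw [e1]
  have n1 := nsq_add_le hρ (Z' * (A * (B - Z)))
    (Z' * ((A - X) * Z) + (Z' * X - sgn (a' ⬝ᵥ b) • (X * Z')) * Z)
  have n2 := nsq_add_le hρ (Z' * ((A - X) * Z)) ((Z' * X - sgn (a' ⬝ᵥ b) • (X * Z')) * Z)
  rw [nsq_isometry_mul (P.op_isometry _), nsq_isometry_mul (P.op_isometry _)] at n1
  rw [nsq_isometry_mul (P.op_isometry _)] at n2
  linarith

/-- The rounding error with the isometry moved to one side. -/
def swapError (E : EncScheme) (κ : ℕ) (T : ProtocolData) (P : Prover)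
    (V : Matrix (Bits T.n × Fin d) (Bits P.N) ℂ) (x : T.AQ) : ℝ :=
  avg fun r : Bits T.seedLen => ∑ u : Bits T.n, nsq (encState E κ T P x)
    (V * mixedMeas T P r u -
      (pauliProj (T.sample r) u ⊗ₖ (1 : Matrix (Fin d) (Fin d) ℂ)) * V)

/-- The constant in `Indist.swapError_le`. -/
def swapConst (μ : ℝ) : ℝ := 8 * pauliConst μ + 1664

theorem Indist.swapError_le (h : Indist E κ T P η) (hη : 0 ≤ η) (hμ : μ < 1)
    (hS : IsBiased μ T.S) {δ : ℝ} (hδ : 0 ≤ δ) (h1 : 1 - δ ≤ braidingSuccess E κ T P)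
    (h2 : 1 - δ ≤ mixedPureSuccess E κ T P) (x : T.AQ) :
    swapError E κ T P (swapIso T P e) x ≤ swapConst μ * (δ + η) := by
  have key : ∀ r : Bits T.seedLen, ∑ u : Bits T.n, nsq (encState E κ T P x)
      (swapIso T P e * mixedMeas T P r u -
        (pauliProj (T.sample r) u ⊗ₖ (1 : Matrix (Fin d) (Fin d) ℂ)) * swapIso T P e) ≤
      16 * mixedFailure E κ T P .Z r + 64 * mixedFailure E κ T P .X r +
        (8 * pauliConst μ + 1344) * (δ + η) := fun r => by
    -- Parseval in the outcome, with dual variable `c`. The bound does not depend on `c`, nor later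
    -- on `a'`, so it is written as a constant average each time.
    rw [sum_nsq_eq_avg, ← avg_const (α := Bits T.n) (16 * mixedFailure E κ T P .Z r + _ + _)]
    refine avg_mono fun c => ?_
    simp only [smul_sub, Finset.sum_sub_distrib]
    rw [sum_smul_kronecker_mul, sum_sgn_smul_pauliProj, sigma_eq]
    simp only [← Matrix.mul_smul, ← Matrix.mul_sum]
    rw [sum_sgn_smul_mixedMeas, nsq_swapIso_mul_sub,
      ← avg_const (α := Bits T.n) (16 * mixedFailure E κ T P .Z r + _ + _)]
    exact avg_mono fun a' => h.mixed_relation hη hμ hS hδ h1 h2 r a' c x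
  refine (avg_mono key).trans ?_
  have hZ := (one_sub_acceptProb_pure_le (E := E) (κ := κ) (T := T) (P := P) .Z).2
  have hX := (one_sub_acceptProb_pure_le (E := E) (κ := κ) (T := T) (P := P) .X).2
  have hZ' : avg (mixedFailure E κ T P .Z) ≤ 4 * (1 - mixedPureSuccess E κ T P) := hZ
  have hX' : avg (mixedFailure E κ T P .X) ≤ 4 * (1 - mixedPureSuccess E κ T P) := hX
  rw [avg_add, avg_add, avg_const, avg_mul_left, avg_mul_left, swapConst]
  linarith

/-- The rounding difference is V† applied to the one-sided difference, and V† is a contraction. -/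
theorem roundingError_le {V : Matrix (Bits T.n × Fin d) (Bits P.N) ℂ} (hV : Vᴴ * V = 1)
    (x : T.AQ) : roundingError E κ T P V x ≤ swapError E κ T P V x := by
  refine avg_mono fun r => Finset.sum_le_sum fun u _ => ?_
  have e : mixedMeas T P r u -
      Vᴴ * (pauliProj (T.sample r) u ⊗ₖ (1 : Matrix (Fin d) (Fin d) ℂ)) * V =
      Vᴴ * (V * mixedMeas T P r u -
        (pauliProj (T.sample r) u ⊗ₖ (1 : Matrix (Fin d) (Fin d) ℂ)) * V) := by
    rw [Matrix.mul_sub, ← Matrix.mul_assoc, hV, Matrix.one_mul, Matrix.mul_assoc]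
  rw [stateNormSq_eq, e]
  exact nsq_conjTranspose_mul_le (encState_posSemidef E κ T P x) hV _

end Rounding

/-! ### The energy of the corrected state -/

section TraceAux

variable {ι κ ν : Type*} [Fintype κ]

theorem traceAux_posSemidef [Fintype ι] {M : Matrix (ι × κ) (ι × κ) ℂ} (h : M.PosSemidef) :
    (traceAux M).PosSemidef := by
  have e : traceAux M = ∑ j, M.submatrix (fun i => (i, j)) (fun i => (i, j)) := by
    ext x y
    simp [traceAux, Matrix.sum_apply]
  rw [e]
  exact Matrix.posSemidef_sum _ fun j _ => h.submatrix _

theorem trace_traceAux_mul [Fintype ι] [DecidableEq κ] (M : Matrix (ι × κ) (ι × κ) ℂ)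
    (A : Matrix ι ι ℂ) :
    (traceAux M * A).trace = (M * (A ⊗ₖ (1 : Matrix κ κ ℂ))).trace := by
  simp only [Matrix.trace, Matrix.diag_apply, Matrix.mul_apply, traceAux, Matrix.of_apply,
    Fintype.sum_prod_type, Matrix.kroneckerMap_apply, Matrix.one_apply, mul_ite, mul_one, mul_zero,
    Finset.sum_ite_eq', Finset.mem_univ, if_true, Finset.sum_mul]
  exact Finset.sum_congr rfl fun x _ => Finset.sum_comm

/-- The reduced state on the first tensor factor after applying `W`. -/
def reduce [Fintype ν] (W : Matrix (ι × κ) ν ℂ) : Matrix ν ν ℂ →ₗ[ℝ] Matrix ι ι ℂ where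
  toFun ρ := traceAux (W * ρ * Wᴴ)
  map_add' ρ σ := by
    rw [Matrix.mul_add, Matrix.add_mul]
    ext x y
    simp [traceAux, Finset.sum_add_distrib]
  map_smul' c ρ := by
    rw [Matrix.mul_smul, Matrix.smul_mul]
    ext x y
    simp [traceAux, Finset.mul_sum]

theorem reduce_apply [Fintype ν] (W : Matrix (ι × κ) ν ℂ) (ρ : Matrix ν ν ℂ) :
    reduce W ρ = traceAux (W * ρ * Wᴴ) := rfl

theorem reduce_posSemidef [Fintype ι] [Fintype ν] (W : Matrix (ι × κ) ν ℂ) {ρ : Matrix ν ν ℂ}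
    (h : ρ.PosSemidef) : (reduce W ρ).PosSemidef :=
  traceAux_posSemidef (h.mul_mul_conjTranspose_same W)

theorem trace_reduce_mul [Fintype ι] [Fintype ν] [DecidableEq κ] (W : Matrix (ι × κ) ν ℂ)
    (ρ : Matrix ν ν ℂ) (A : Matrix ι ι ℂ) :
    (reduce W ρ * A).trace = (Wᴴ * ((A ⊗ₖ (1 : Matrix κ κ ℂ)) * W) * ρ).trace := by
  rw [reduce_apply, trace_traceAux_mul, Matrix.trace_mul_comm, ← Matrix.mul_assoc,
    ← Matrix.mul_assoc, Matrix.trace_mul_comm]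
  simp only [Matrix.mul_assoc]

theorem trace_reduce [Fintype ι] [DecidableEq ι] [Fintype ν] [DecidableEq ν] [DecidableEq κ]
    {W : Matrix (ι × κ) ν ℂ} (hW : Wᴴ * W = 1) (ρ : Matrix ν ν ℂ) :
    (reduce W ρ).trace = ρ.trace := by
  have h := trace_reduce_mul W ρ 1
  rwa [mul_one, Matrix.one_kronecker_one, Matrix.one_mul, hW, Matrix.one_mul] at h

theorem trace_reduce_mul_proj [Fintype ι] [Fintype ν] [DecidableEq κ] (W : Matrix (ι × κ) ν ℂ)
    (ρ : Matrix ν ν ℂ) {A : Matrix ι ι ℂ} (h1 : Aᴴ = A) (h2 : A * A = A) :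
    (reduce W ρ * A).trace.re = nsq ρ ((A ⊗ₖ (1 : Matrix κ κ ℂ)) * W) := by
  have e : (A ⊗ₖ (1 : Matrix κ κ ℂ))ᴴ * (A ⊗ₖ (1 : Matrix κ κ ℂ)) = A ⊗ₖ (1 : Matrix κ κ ℂ) := by
    rw [Matrix.conjTranspose_kronecker, h1, Matrix.conjTranspose_one, ← Matrix.mul_kronecker_mul,
      h2, one_mul]
  have e' : ((A ⊗ₖ (1 : Matrix κ κ ℂ)) * W)ᴴ * ((A ⊗ₖ (1 : Matrix κ κ ℂ)) * W) =
      Wᴴ * ((A ⊗ₖ (1 : Matrix κ κ ℂ)) * W) := by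
    rw [Matrix.conjTranspose_mul, Matrix.mul_assoc, ← Matrix.mul_assoc _ _ W, e]
  rw [trace_reduce_mul, nsq, ip_apply, e']

end TraceAux

/-- The left side is the inner product of A - B and A + B. Cauchy–Schwarz is used with a free
parameter `t`, so that one choice of `t` works after all sums and averages. -/
theorem nsq_sub_nsq_le {ι κ : Type*} [Fintype ι] [Fintype κ] {ρ : Matrix κ κ ℂ}
    (hρ : ρ.PosSemidef) (A B : Matrix ι κ ℂ) {t : ℝ} (ht : 0 < t) :
    nsq ρ A - nsq ρ B ≤ t / 2 * nsq ρ (A - B) + t⁻¹ * (nsq ρ A + nsq ρ B) := by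
  have h := nsq_nonneg hρ (t • (A - B) - (A + B))
  have h1 := nsq_add_le hρ A B
  have h2 : ip ρ (A - B) (A + B) = nsq ρ A - nsq ρ B := by
    simp only [nsq, map_sub, map_add, LinearMap.sub_apply]
    rw [ip_comm hρ B A]
    ring
  rw [nsq_sub hρ, nsq_smul, map_smul, LinearMap.smul_apply, h2, smul_eq_mul] at h
  have h3 : 0 ≤ (2 * t)⁻¹ * (t * t * nsq ρ (A - B) - 2 * (t * (nsq ρ A - nsq ρ B)) +
      2 * (nsq ρ A + nsq ρ B)) := mul_nonneg (by positivity) (by linarith)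
  have h4 : (2 * t)⁻¹ * (t * t * nsq ρ (A - B) - 2 * (t * (nsq ρ A - nsq ρ B)) +
      2 * (nsq ρ A + nsq ρ B)) =
      t / 2 * nsq ρ (A - B) - (nsq ρ A - nsq ρ B) + t⁻¹ * (nsq ρ A + nsq ρ B) := by
    field_simp
  linarith

/-! ### The corrected state and its energy -/

section Energy

variable {E : EncScheme} {κ : ℕ} {T : ProtocolData} {P : Prover} {d : ℕ}
  {V : Matrix (Bits T.n × Fin d) (Bits P.N) ℂ}

/-- Alice's post-measurement state for the decrypted answer `a` to the teleportation question. -/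
def teleState (E : EncScheme) (κ : ℕ) (T : ProtocolData) (P : Prover) (a : Bits (T.n + T.n)) :
    Op P.N :=
  decState E κ T P .tele a

theorem teleState_posSemidef (a : Bits (T.n + T.n)) : (teleState E κ T P a).PosSemidef :=
  decState_posSemidef E κ T P .tele a

theorem sum_teleState : ∑ a, teleState E κ T P a = encState E κ T P .tele :=
  (encState_eq_sum E κ T P .tele).symm

/-- The effect of the teleportation correction on the outcomes in the basis `w(r)`. -/
def teleShift (T : ProtocolData) (r : Bits T.seedLen) (a : Bits (T.n + T.n)) : Bits T.n :=
  correct (T.sample r) 0 (teleX a) (teleZ a)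

/-- The teleportation correction. -/
def teleOp {n : ℕ} (d : ℕ) (a : Bits (n + n)) : Matrix (Bits n × Fin d) (Bits n × Fin d) ℂ :=
  (sigma (fun _ => .X) (teleX a) * sigma (fun _ => .Z) (teleZ a)) ⊗ₖ 1

theorem teleOp_isometry {n : ℕ} (a : Bits (n + n)) : (teleOp d a)ᴴ * teleOp d a = 1 := by
  rw [teleOp, Matrix.conjTranspose_kronecker, ← Matrix.mul_kronecker_mul, correction_isometry,
    Matrix.conjTranspose_one, one_mul, Matrix.one_kronecker_one]

theorem pauliProj_mul_teleOp (r : Bits T.seedLen) (u : Bits T.n) (a : Bits (T.n + T.n)) :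
    (pauliProj (T.sample r) u ⊗ₖ (1 : Matrix (Fin d) (Fin d) ℂ)) * teleOp d a =
      teleOp d a * (pauliProj (T.sample r) (u + teleShift T r a) ⊗ₖ
        (1 : Matrix (Fin d) (Fin d) ℂ)) := by
  rw [teleOp, ← Matrix.mul_kronecker_mul, ← Matrix.mul_kronecker_mul, pauliProj_mul_correction]
  rfl

theorem correctedState_eq :
    correctedState E κ T P V = ∑ a, reduce (teleOp d a * V) (teleState E κ T P a) := by
  refine Eq.trans ?_ (expect_map_postState E κ T P .tele
    fun a : Bits (T.n + T.n) => reduce (teleOp d a * V))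
  simp only [reduce_apply, Matrix.conjTranspose_mul, ← Matrix.mul_assoc]
  rfl

theorem teleOp_mul_isometry (hV : Vᴴ * V = 1) (a : Bits (T.n + T.n)) :
    (teleOp d a * V)ᴴ * (teleOp d a * V) = 1 := by
  rw [isometry_mul_conj (teleOp_isometry a), hV]

theorem correctedState_isState (hV : Vᴴ * V = 1) : IsState (correctedState E κ T P V) := by
  rw [correctedState_eq]
  refine ⟨Matrix.posSemidef_sum _ fun a _ => reduce_posSemidef _ (teleState_posSemidef a), ?_⟩
  rw [Matrix.trace_sum, ← trace_encState E κ T P .tele, ← sum_teleState, Matrix.trace_sum]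
  exact Finset.sum_congr rfl fun a _ => trace_reduce (teleOp_mul_isometry hV a) _

/-- The projector is moved through the correction, which shifts its label. The correction is then an
isometry on the left and disappears. -/
theorem trace_correctedState_mul_pauliProj (r : Bits T.seedLen) (u : Bits T.n) :
    (correctedState E κ T P V * pauliProj (T.sample r) u).trace.re =
      ∑ a, nsq (teleState E κ T P a) ((pauliProj (T.sample r) (u + teleShift T r a) ⊗ₖ
        (1 : Matrix (Fin d) (Fin d) ℂ)) * V) := by
  rw [correctedState_eq, Finset.sum_mul, Matrix.trace_sum, Complex.re_sum]
  refine Finset.sum_congr rfl fun a _ => ?_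
  rw [trace_reduce_mul_proj _ _ (pauliProj_conjTranspose _ _) (pauliProj_mul_self _ _),
    ← Matrix.mul_assoc, pauliProj_mul_teleOp, Matrix.mul_assoc,
    nsq_isometry_mul (teleOp_isometry a)]

theorem trace_correctedState_mul_hamiltonian (hV : Vᴴ * V = 1) :
    (correctedState E κ T P V * T.hamiltonian).trace.re =
      1 - avg fun r : Bits T.seedLen => ∑ u ∈ T.Q (T.sample r), ∑ a,
        nsq (teleState E κ T P a) ((pauliProj (T.sample r) (u + teleShift T r a) ⊗ₖ
          (1 : Matrix (Fin d) (Fin d) ℂ)) * V) := by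
  simp only [← trace_correctedState_mul_pauliProj, ProtocolData.hamiltonian]
  have h : ∀ A : Op T.n, (correctedState E κ T P V * A).trace.re =
      evState (correctedState E κ T P V) A := fun A => by
    rw [evState_apply, ev_apply]
  simp only [h, map_sub, map_avg, map_sum]
  rw [← h, mul_one, (correctedState_isState hV).2, Complex.one_re]

end Energy

/-! ### The Hamiltonian test compared with the energy -/

section EnergyBound

variable {E : EncScheme} {κ : ℕ} {T : ProtocolData} {P : Prover} {d : ℕ}
  {V : Matrix (Bits T.n × Fin d) (Bits P.N) ℂ}

theorem nsq_mixedMeas (ρ : Op P.N) (r : Bits T.seedLen) (u : Bits T.n) :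
    nsq ρ (mixedMeas T P r u) = ∑ v : Bits T.n,
      if mask (T.sample r) v = u then ev ρ (P.bob (T.bobCode (.mixed r)) v) else 0 := by
  have h := P.nsq_sum_bob (y := T.bobCode (.mixed r)) (ρ := ρ)
    fun v : Bits T.n => if mask (T.sample r) v = u then (1 : ℝ) else 0
  simp only [ite_smul, one_smul, zero_smul, mul_ite, mul_one, mul_zero, ite_mul, one_mul,
    zero_mul] at h
  rw [mixedMeas, h]
  exact Finset.sum_congr rfl fun v _ => by split_ifs <;> rfl

/-- Same form as `trace_correctedState_mul_hamiltonian`, with Bob's actual measurement in place of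
the Pauli projectors. -/
theorem hamiltonianSuccess_eq : hamiltonianSuccess E κ T P =
    avg fun r : Bits T.seedLen => ∑ u ∈ T.Q (T.sample r), ∑ a,
      nsq (teleState E κ T P a) (mixedMeas T P r (u + teleShift T r a)) := by
  refine congrArg avg (funext fun r => ?_)
  rw [acceptProb_eq]
  refine Eq.trans ?_ Finset.sum_comm
  refine Finset.sum_congr rfl fun (a : Bits (T.n + T.n)) _ => ?_
  simp only [nsq_mixedMeas]
  rw [Finset.sum_comm]
  refine Finset.sum_congr rfl fun (v : Bits T.n) _ => ?_
  have h : ∀ u : Bits T.n, mask (T.sample r) v = u + teleShift T r a ↔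
      correct (T.sample r) v (teleX a) (teleZ a) = u := fun u => by
    rw [correct_eq, teleShift]
    exact bits_eq_add_iff.trans eq_comm
  simp only [h, Finset.sum_ite_eq]
  split_ifs <;> rfl

theorem sum_nsq_mixedMeas (ρ : Op P.N) (r : Bits T.seedLen) :
    ∑ u, nsq ρ (mixedMeas T P r u) = ρ.trace.re := by
  simp only [nsq_mixedMeas]
  rw [Finset.sum_comm]
  simp only [Finset.sum_ite_eq, Finset.mem_univ, if_true]
  rw [← map_sum, P.sum_bob, ev_apply, one_mul]

theorem sum_nsq_pauliProj_mul (hV : Vᴴ * V = 1) (ρ : Op P.N) (w : Fin T.n → Pauli) :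
    ∑ u, nsq ρ ((pauliProj w u ⊗ₖ (1 : Matrix (Fin d) (Fin d) ℂ)) * V) = ρ.trace.re := by
  simp only [← trace_reduce_mul_proj V ρ (pauliProj_conjTranspose _ _) (pauliProj_mul_self _ _)]
  rw [← Complex.re_sum, ← Matrix.trace_sum, ← Finset.mul_sum, sum_pauliProj, mul_one,
    trace_reduce hV]

/-- The Hamiltonian test gains no more than the energy, up to the rounding error. -/
theorem hamiltonianSuccess_sub_le (hV : Vᴴ * V = 1) {t : ℝ} (ht : 0 < t) :
    hamiltonianSuccess E κ T P -
        (1 - (correctedState E κ T P V * T.hamiltonian).trace.re) ≤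
      t / 2 * swapError E κ T P V .tele + t⁻¹ * 2 := by
  have e1 := trace_correctedState_mul_hamiltonian (E := E) (κ := κ) (P := P) hV
  rw [e1, sub_sub_cancel, hamiltonianSuccess_eq, ← avg_sub, swapError, ← avg_mul_left,
    ← avg_const (α := Bits T.seedLen) (t⁻¹ * 2), ← avg_add]
  refine avg_mono fun r => ?_
  set ρ := teleState E κ T P
  set A := fun u => V * mixedMeas T P r u with hA
  set B := fun u => (pauliProj (T.sample r) u ⊗ₖ (1 : Matrix (Fin d) (Fin d) ℂ)) * V with hB
  set F := fun (a : Bits (T.n + T.n)) u =>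
    t / 2 * nsq (ρ a) (A u - B u) + t⁻¹ * (nsq (ρ a) (A u) + nsq (ρ a) (B u)) with hF
  have hρ : ∀ a, (ρ a).PosSemidef := fun a => teleState_posSemidef a
  have hF0 : ∀ a u, 0 ≤ F a u := fun a u =>
    add_nonneg (mul_nonneg (by positivity) (nsq_nonneg (hρ a) _))
      (mul_nonneg (by positivity) (add_nonneg (nsq_nonneg (hρ a) _) (nsq_nonneg (hρ a) _)))
  have h1 : (∑ u ∈ T.Q (T.sample r), ∑ a, nsq (ρ a) (mixedMeas T P r (u + teleShift T r a))) -
      (∑ u ∈ T.Q (T.sample r), ∑ a, nsq (ρ a) (B (u + teleShift T r a))) ≤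
      ∑ u ∈ T.Q (T.sample r), ∑ a, F a (u + teleShift T r a) := by
    rw [← Finset.sum_sub_distrib]
    refine Finset.sum_le_sum fun u _ => ?_
    rw [← Finset.sum_sub_distrib]
    refine Finset.sum_le_sum fun a _ => ?_
    rw [← nsq_isometry_mul hV]
    exact nsq_sub_nsq_le (hρ a) _ _ ht
  refine h1.trans ?_
  -- Since `F` is nonnegative the accepting set can be enlarged to all strings. For each decrypted
  -- answer the shift is then a reindexing.
  have h2 : ∑ u ∈ T.Q (T.sample r), ∑ a, F a (u + teleShift T r a) ≤ ∑ a, ∑ u, F a u := by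
    refine (Finset.sum_le_univ_sum_of_nonneg fun u =>
      Finset.sum_nonneg fun a _ => hF0 a _).trans_eq ?_
    rw [Finset.sum_comm]
    exact Finset.sum_congr rfl fun a _ => Equiv.sum_comp (Equiv.addRight (teleShift T r a)) (F a)
  refine h2.trans_eq ?_
  have h3 : ∀ C : Bits T.n → Matrix (Bits T.n × Fin d) (Bits P.N) ℂ,
      ∑ a, ∑ u, nsq (ρ a) (C u) = ∑ u, nsq (encState E κ T P .tele) (C u) := fun C => by
    rw [Finset.sum_comm, ← sum_teleState]
    exact Finset.sum_congr rfl fun u _ => (nsq_sum_state _ _ _).symm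
  simp only [hF, Finset.sum_add_distrib, ← Finset.mul_sum, h3]
  have h4 : ∑ u, nsq (encState E κ T P .tele) (A u) = 1 := by
    simp only [hA, nsq_isometry_mul hV]
    rw [sum_nsq_mixedMeas, trace_encState, Complex.one_re]
  have h5 : ∑ u, nsq (encState E κ T P .tele) (B u) = 1 := by
    rw [hB, sum_nsq_pauliProj_mul hV, trace_encState, Complex.one_re]
  rw [h4, h5, one_add_one_eq_two]

theorem hamiltonianSuccess_sub_le_sqrt (hV : Vᴴ * V = 1) {D : ℝ}
    (hD : swapError E κ T P V .tele ≤ D) :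
    hamiltonianSuccess E κ T P -
        (1 - (correctedState E κ T P V * T.hamiltonian).trace.re) ≤ 2 * √D := by
  rcases le_or_gt D 0 with h | h
  · rw [Real.sqrt_eq_zero_of_nonpos h, mul_zero]
    -- With no error to balance against, `t` is taken arbitrarily large.
    refine le_of_forall_pos_le_add fun ε hε => ?_
    have h1 := hamiltonianSuccess_sub_le (E := E) (κ := κ) hV (t := 2 / ε) (by positivity)
    have h2 : 2 / ε / 2 * swapError E κ T P V .tele ≤ 0 :=
      mul_nonpos_of_nonneg_of_nonpos (by positivity) (hD.trans h)
    rw [inv_div, div_mul_cancel₀ _ two_ne_zero] at h1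
    linarith
  · have hs := Real.sqrt_pos.mpr h
    -- This `t` makes both terms of the bound equal to √D.
    have h1 := hamiltonianSuccess_sub_le (E := E) (κ := κ) hV (t := 2 / √D) (by positivity)
    have h2 : 2 / √D / 2 * swapError E κ T P V .tele ≤ 2 / √D / 2 * D :=
      mul_le_mul_of_nonneg_left hD (by positivity)
    have h3 : 2 / √D / 2 * D = √D := by
      field_simp
      exact (Real.sq_sqrt h.le).symm
    rw [inv_div, div_mul_cancel₀ _ two_ne_zero] at h1
    linarith

end EnergyBound

/-! ### Final exponents and constants -/

section Assembly

variable {E : EncScheme} {κ : ℕ} {T : ProtocolData} {P : Prover} {μ η : ℝ}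

theorem mixedPureSuccess_nonneg : 0 ≤ mixedPureSuccess E κ T P := by
  refine avg_nonneg fun W => avg_nonneg fun bit => ?_
  cases bit
  · exact acceptProb_nonneg E κ T P _ _ _
  · exact avg_nonneg fun r => acceptProb_nonneg E κ T P _ _ _

theorem mixedPureSuccess_le_one : mixedPureSuccess E κ T P ≤ 1 := by
  rw [mixedPureSuccess, ← avg_const (α := PureBasis) (1 : ℝ)]
  refine avg_mono fun W => ?_
  rw [← avg_const (α := Bool) (1 : ℝ)]
  refine avg_mono fun bit => ?_
  cases bit
  · exact acceptProb_le_one E κ T P _ _ _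
  · simp only [if_true]
    rw [← avg_const (α := Bits T.seedLen) (1 : ℝ)]
    exact avg_mono fun r => acceptProb_le_one E κ T P _ _ _

theorem braidingSuccess_nonneg : 0 ≤ braidingSuccess E κ T P := by
  refine avg_nonneg fun a => avg_nonneg fun b => ?_
  split_ifs
  · exact avg_nonneg fun W => acceptProb_nonneg E κ T P _ _ _
  · refine avg_nonneg fun row => avg_nonneg fun col => avg_nonneg fun isCol => ?_
    simp only [squareSuccess]
    split_ifs <;> exact acceptProb_nonneg E κ T P _ _ _

/-- Decay against the power 2k gives decay of the square root against the power k. -/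
theorem Negligible.sqrt {f : ℕ → ℝ} (h : Negligible f) :
    Negligible fun κ => √(f κ) := by
  intro k
  have h1 := (Real.continuous_sqrt.tendsto 0).comp (h (2 * k))
  rw [Real.sqrt_zero] at h1
  refine h1.congr fun κ => ?_
  have e : (κ : ℝ) ^ (2 * k) = ((κ : ℝ) ^ k) ^ 2 := by rw [mul_comm, pow_mul]
  simp only [Function.comp_apply]
  rw [Real.sqrt_mul (by positivity), e, Real.sqrt_sq (by positivity)]

theorem swapConst_nonneg (hμ : μ < 1) : 0 ≤ swapConst μ := by
  have := pauliConst_nonneg hμ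
  rw [swapConst]
  linarith

/-- The rounding and energy bounds for the swap isometry. -/
theorem Indist.rounding_and_energy (h : Indist E κ T P η) (hη : 0 ≤ η) (hμ : μ < 1)
    (hS : IsBiased μ T.S) {δ : ℝ} (h1 : 1 - δ ≤ braidingSuccess E κ T P)
    (h2 : 1 - δ ≤ mixedPureSuccess E κ T P) {d : ℕ} (e : Bits P.N ≃ Fin d) :
    (∀ x, roundingError E κ T P (swapIso T P e) x ≤ swapConst μ * √δ + swapConst μ * η) ∧
      (correctedState E κ T P (swapIso T P e) * T.hamiltonian).trace.re ≤
        (1 - hamiltonianSuccess E κ T P) + 2 * √(swapConst μ) * δ ^ (1 / 4 : ℝ) +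
          2 * √(swapConst μ) * √η := by
  have hC := swapConst_nonneg hμ
  have hδ : 0 ≤ δ := by linarith [mixedPureSuccess_le_one (E := E) (κ := κ) (T := T) (P := P)]
  have hV := swapIso_isometry (T := T) e
  -- Lowering the exponents of δ is only valid below 1. For larger δ the hypotheses hold with error
  -- 1, since success probabilities are nonnegative.
  set ε := min δ 1 with hε
  have hε0 : 0 ≤ ε := le_min hδ zero_le_one
  have hb : 1 - ε ≤ braidingSuccess E κ T P := by
    rcases min_choice δ 1 with h | h
    · rwa [hε, h]
    · rw [hε, h, sub_self]; exact braidingSuccess_nonneg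
  have hm : 1 - ε ≤ mixedPureSuccess E κ T P := by
    rcases min_choice δ 1 with h | h
    · rwa [hε, h]
    · rw [hε, h, sub_self]; exact mixedPureSuccess_nonneg
  have hD := h.swapError_le e hη hμ hS hε0 hb hm
  have hs : √ε ≤ δ ^ (1 / 4 : ℝ) := by
    rw [Real.sqrt_eq_rpow]
    exact (Real.rpow_le_rpow_of_exponent_ge' hε0 (min_le_right _ _) (by norm_num)
      (by norm_num)).trans (Real.rpow_le_rpow hε0 (min_le_left _ _) (by norm_num))
  have hs' : ε ≤ √δ := by
    refine le_trans ?_ (Real.sqrt_le_sqrt (min_le_left δ 1))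
    exact Real.le_sqrt_of_sq_le (by rw [sq]; exact mul_le_of_le_one_right hε0 (min_le_right _ _))
  refine ⟨fun x => ((roundingError_le hV x).trans (hD x)).trans ?_, ?_⟩
  · rw [mul_add]
    exact add_le_add_left (mul_le_mul_of_nonneg_left hs' hC) _
  · have h3 := hamiltonianSuccess_sub_le_sqrt hV (hD .tele)
    have h4 : √(swapConst μ * (ε + η)) ≤ √(swapConst μ) * (δ ^ (1 / 4 : ℝ) + √η) := by
      rw [Real.sqrt_mul hC]
      refine mul_le_mul_of_nonneg_left ?_ (Real.sqrt_nonneg _)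
      refine le_trans (Real.sqrt_le_iff.mpr ⟨by positivity, ?_⟩) (add_le_add_left hs _)
      nlinarith [Real.sq_sqrt hε0, Real.sq_sqrt hη, mul_nonneg (Real.sqrt_nonneg ε)
        (Real.sqrt_nonneg η)]
    linarith

end Assembly

end CompiledQMA

end

theorem mainTheorem10 (μ : ℝ) (hμ : μ < 1) :
    ∃ C : ℝ, 0 < C ∧
      ∀ (E : EncScheme) (T : ℕ → ProtocolData) (P : ℕ → Prover) (δ : ℕ → ℝ),
        E.Secure →
        (∀ κ, IsBiased μ (T κ).S) →
        PolyBounded (fun κ => (T κ).n) →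
        PolyBounded (fun κ => (T κ).aliceLen) →
        PolyBounded (fun κ => (T κ).bobLen) →
        EfficientProver P →
        (∀ κ, 1 - δ κ ≤ braidingSuccess E κ (T κ) (P κ)) →
        (∀ κ, 1 - δ κ ≤ mixedPureSuccess E κ (T κ) (P κ)) →
        ∃ η : ℕ → ℝ, Negligible η ∧
          ∀ κ, ∃ (d : ℕ) (V : Matrix (Bits (T κ).n × Fin d) (Bits (P κ).N) ℂ),
            Vᴴ * V = 1 ∧
            (∀ x : (T κ).AQ, roundingError E κ (T κ) (P κ) V x ≤ C * √(δ κ) + η κ) ∧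
            ∃ ρ : Op (T κ).n,
              ρ = correctedState E κ (T κ) (P κ) V ∧
              IsState ρ ∧
              (ρ * (T κ).hamiltonian).trace.re ≤
                (1 - hamiltonianSuccess E κ (T κ) (P κ)) + C * (δ κ) ^ (1 / 4 : ℝ) + η κ := by
  have hC := swapConst_nonneg hμ
  have hC' := Real.sqrt_nonneg (swapConst μ)
  refine ⟨swapConst μ + 2 * √(swapConst μ) + 1, by positivity, ?_⟩
  intro E T P δ hE hS _ hT _ hP hb hm
  obtain ⟨η, hη, hη0, h⟩ := exists_negligible_indist E T P hE hT hP
  -- The first term serves the rounding bound. The energy bound takes a square root of δ + η, hence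
  -- √η.
  refine ⟨fun κ => swapConst μ * η κ + 2 * √(swapConst μ) * √(η κ),
    (hη.const_mul _).add (hη.sqrt.const_mul _), fun κ => ?_⟩
  -- The auxiliary space is a copy of the prover's own space.
  have e := Fintype.equivFin (Bits (P κ).N)
  obtain ⟨h1, h2⟩ := (h κ).rounding_and_energy (hη0 κ) hμ (hS κ) (hb κ) (hm κ) e
  have hδ : 0 ≤ δ κ := by
    linarith [hm κ, mixedPureSuccess_le_one (E := E) (κ := κ) (T := T κ) (P := P κ)]
  have hs := Real.sqrt_nonneg (δ κ)
  have hq : 0 ≤ δ κ ^ (1 / 4 : ℝ) := Real.rpow_nonneg hδ _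
  have hη1 := mul_nonneg hC (hη0 κ)
  have hη2 := mul_nonneg hC' (Real.sqrt_nonneg (η κ))
  have hV := swapIso_isometry (T := T κ) e
  refine ⟨_, swapIso (T κ) (P κ) e, hV, fun x => ?_, _, rfl, correctedState_isState hV, ?_⟩
  · linarith [h1 x, mul_nonneg hC' hs]
  · linarith [mul_nonneg hC hq]
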